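/- Let $\mathbb k$ be a field of characteristic zero. Throughout, $A=(A,\Delta)$ denotes a $\mathbb Z$-graded commutative associative (not necessarily unital) $\mathbb k$-algebra with a degree $+1$ linear map $\Delta$ such that $\Delta^2=0$; $\Delta$ need not be a derivation. *Symmetric coalgebra.* $\mathbb S^cA=\bigoplus_{k\ge1}\mathbb S^kA$ is the graded symmetric coalgebra with the (reduced) unshuffle diagonal. A linear map $f:\mathbb S^cA\to\mathbb S^cA$ has components $f_k=\pi\circ f|_{\mathbb S^kA}:\mathbb S^kA\to A$, $k\ge1$, where $\pi:\mathbb S^cA\to A$ is the projection. An $L_\infty$-algebra $(A,l_1,l_2,\dots)$ is a degree $+1$ coderivation $l$ of $\mathbb S^cA$ with $l^2=0$, the degree $+1$ operations $l_k:\mathbb S^kA\to A$ being its components. The trivial $L_\infty$-algebra $\mathcal L_\Delta=(A,\Delta,0,0,\dots)$ is given by the coderivation with components $(\Delta,0,0,\dots)$, also denoted $\Delta$. The twisting of $(A,l)$ by an automorphism $\phi$ of the graded coalgebra $\mathbb S^cA$ is $(A,\phi^{-1}l\phi)$. *Naturality.* A natural operation of arity $k$ and degree $d$ is a family of degree $d$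 linear maps $\beta_A:\mathbb S^kA\to A$, one for each $(A,\Delta)$, such that 1. $\varphi\circ\beta_A=\beta_B\circ\varphi^{\otimes k}$ for every linear map $\varphi:A\to B$, homogeneous or not, that preserves the parity of degrees, is multiplicative, and satisfies $\varphi\Delta_A=\Delta_B\varphi$; 2. $\beta_A$ is graded linear over constants: $\beta_A(ca_1,a_2,\dots,a_k)=(-1)^{d|c|}\,c\,\beta_A(a_1,\dots,a_k)$ whenever $c\in A$ is homogeneous with $\Delta(cx)=(-1)^{|c|}c\,\Delta(x)$ for all $x\in A$. A natural $L_\infty$-algebra is a family $\mathcal L=(A,l_1,l_2,\dots)$ of $L_\infty$-algebras, one for each $(A,\Delta)$, such that every $l_k$, $k\ge1$, is a natural operation of degree $1$. A natural automorphism is a family $\phi$ of automorphisms of the graded coalgebras $\mathbb S^cA$ such that every $\phi_k$, $k\ge1$, is a natural operation of degree $0$. **Theorem.** For each natural $L_\infty$-algebra $\mathcal L=(A,l_1,l_2,l_3,\dots)$ with $l_1=\Delta$ there exists a unique natural automorphism $\phi=(\mathrm{id},\phi_2,\phi_3,\dots)$ of the symmetric coalgebra $\mathbb S^cA$ such that $\mathcal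 L$ is the twisting of $\mathcal L_\Delta$ via $\phi$, i.e. $l=\phi^{-1}\Delta\phi$ on $\mathbb S^cA$ for every $A$. Moreover, $$l_2(a_1,a_2)=\Delta(a_1a_2)-(-1)^{|a_1|}a_1\Delta(a_2)-\Delta(a_1)a_2$$ for all $A$, all homogeneous $a_1\in A$ and all $a_2\in A$, if and only if $\phi_2$ is the product, i.e. $\phi_2(a,b)=ab$ for all $A$ and all $a,b\in A$. -/

import Mathlib

open scoped DirectSum TensorProduct

universe u v

noncomputable section

namespace KoszulBraces

/-- The sign `(-1)^n`, as a scalar of the ground field. -/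
def ksign (K : Type u) [Field K] (n : ℤ) : K := ((n.negOnePow : ℤ) : K)

section GradedSpace

variable {K : Type u} [Field K] {M : Type v} [AddCommGroup M] [Module K M]

/-- The linear map that multiplies the elements of degree `i` by `(-1)^i`. -/
def parity (𝒱 : ℤ → Submodule K M) [DirectSum.Decomposition 𝒱] : M →ₗ[K] M :=
  (DirectSum.toModule K ℤ M fun i => ksign K i • (𝒱 i).subtype) ∘ₗ
    (DirectSum.decomposeLinearEquiv 𝒱).toLinearMap

end GradedSpace

section SymmetricAlgebra

variable {K : Type u} [Field K] {V : Type v} [AddCommGroup V] [Module K V]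
variable (𝒱 : ℤ → Submodule K V)

/-- Graded commutativity `a ⊗ b ~ (-1)^{|a||b|} b ⊗ a`, imposed on the tensor algebra. -/
inductive SymRel : TensorAlgebra K V → TensorAlgebra K V → Prop
  | swap {i j : ℤ} {a b : V} (ha : a ∈ 𝒱 i) (hb : b ∈ 𝒱 j) :
      SymRel (TensorAlgebra.ι K a * TensorAlgebra.ι K b)
        (ksign K (i * j) • (TensorAlgebra.ι K b * TensorAlgebra.ι K a))

/-- The graded symmetric algebra `S(V) = ⨁_{k ≥ 0} S^k V` of a graded vector space `V`. -/
def SymAlg : Type (max u v) := (ringConGen (SymRel 𝒱)).Quotient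

instance : Ring (SymAlg 𝒱) := inferInstanceAs (Ring (ringConGen (SymRel 𝒱)).Quotient)

instance : Algebra K (SymAlg 𝒱) := inferInstanceAs (Algebra K (ringConGen (SymRel 𝒱)).Quotient)

namespace SymAlg

/-- The inclusion of the generators `V → S(V)`. -/
def ι : V →ₗ[K] SymAlg 𝒱 :=
  (RingCon.mkₐ K (ringConGen (SymRel 𝒱))).toLinearMap ∘ₗ TensorAlgebra.ι K

theorem ι_swap {i j : ℤ} {a b : V} (ha : a ∈ 𝒱 i) (hb : b ∈ 𝒱 j) :
    ι 𝒱 a * ι 𝒱 b = ksign K (i * j) • (ι 𝒱 b * ι 𝒱 a) :=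
  Quotient.sound <| RingCon.le_ringConGen _ _ (SymRel.swap ha hb)

variable {B : Type*} [Semiring B] [Algebra K B]

/-- The universal property of the graded symmetric algebra. -/
def lift (f : V →ₗ[K] B)
    (hf : ∀ (i j : ℤ) (a b : V), a ∈ 𝒱 i → b ∈ 𝒱 j → f a * f b = ksign K (i * j) • (f b * f a)) :
    SymAlg 𝒱 →ₐ[K] B :=
  RingCon.liftₐ (ringConGen (SymRel 𝒱)) (TensorAlgebra.lift K f) (by
    exact RingCon.ringConGen_le.2 fun x y (h : SymRel 𝒱 x y) => by
      induction h with
      | swap ha hb => simpa using hf _ _ _ _ ha hb)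

theorem lift_ι (f : V →ₗ[K] B)
    (hf : ∀ (i j : ℤ) (a b : V), a ∈ 𝒱 i → b ∈ 𝒱 j → f a * f b = ksign K (i * j) • (f b * f a))
    (a : V) : lift 𝒱 f hf (ι 𝒱 a) = f a :=
  (RingCon.liftₐ_mk _ _ _ _).trans (TensorAlgebra.lift_ι_apply _ a)

variable {𝒱} in
theorem hom_ext {f g : SymAlg 𝒱 →ₐ[K] B} (h : ∀ a, f (ι 𝒱 a) = g (ι 𝒱 a)) : f = g :=
  RingCon.Quotient.hom_extₐ <| TensorAlgebra.hom_ext <| LinearMap.ext h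

/-- The part of `S(V)` of total degree `n`: the span of the products `v₁ ⋯ v_k` of homogeneous
elements of `V` (of degrees `d₁, …, d_k`, listed together with the `v_i`) with
`d₁ + ⋯ + d_k = n`. -/
def gr (n : ℤ) : Submodule K (SymAlg 𝒱) :=
  Submodule.span K {x | ∃ l : List (ℤ × V), (∀ p ∈ l, p.2 ∈ 𝒱 p.1) ∧
    (l.map Prod.fst).sum = n ∧ (l.map fun p => ι 𝒱 p.2).prod = x}

theorem ι_mem_gr {i : ℤ} {a : V} (ha : a ∈ 𝒱 i) : ι 𝒱 a ∈ gr 𝒱 i :=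
  Submodule.subset_span ⟨[(i, a)], by simpa using ha, by simp, by simp⟩

instance : SetLike.GradedMonoid (gr 𝒱) where
  one_mem := Submodule.subset_span ⟨[], by simp, by simp, by simp⟩
  mul_mem i j x y hx hy := by
    induction hx using Submodule.span_induction with
    | zero => simp
    | add x x' _ _ h h' => rw [add_mul]; exact add_mem h h'
    | smul c x _ h => rw [smul_mul_assoc]; exact Submodule.smul_mem _ _ h
    | mem x hx =>
      induction hy using Submodule.span_induction with
      | zero => simp
      | add y y' _ _ h h' => rw [mul_add]; exact add_mem h h'
      | smul c y _ h => rw [mul_smul_comm]; exact Submodule.smul_mem _ _ h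
      | mem y hy =>
        obtain ⟨l, hl, rfl, rfl⟩ := hx
        obtain ⟨m, hm, rfl, rfl⟩ := hy
        refine Submodule.subset_span ⟨l ++ m, ?_, by simp, by simp⟩
        intro p hp
        rcases List.mem_append.1 hp with h | h
        exacts [hl p h, hm p h]

/-- The counit (augmentation) of `S(V)`, with kernel `⨁_{k ≥ 1} S^k V`. -/
def counit : SymAlg 𝒱 →ₐ[K] K := lift 𝒱 0 fun _ _ _ _ _ _ => by simp

/-- The projection of `S(V)` to its summand `S^1 V = V`. -/
def proj : SymAlg 𝒱 →ₗ[K] V :=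
  letI : Module Kᵐᵒᵖ V := Module.compHom _ ((RingHom.id K).fromOpposite mul_comm)
  haveI : IsCentralScalar K V := ⟨fun _ _ => rfl⟩
  TrivSqZeroExt.sndHom K V ∘ₗ
    (lift 𝒱 (TrivSqZeroExt.inrHom K V) fun _ _ _ _ _ _ => by simp).toLinearMap

variable [DirectSum.Decomposition 𝒱]

/-- Auxiliary map for the grading of `S(V)`. -/
def toGradedι : V →ₗ[K] ⨁ i, gr 𝒱 i :=
  (DirectSum.toModule K ℤ _ fun i => DirectSum.lof K ℤ (fun i => gr 𝒱 i) i ∘ₗ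
    ((ι 𝒱 ∘ₗ (𝒱 i).subtype).codRestrict (gr 𝒱 i) fun a => ι_mem_gr 𝒱 a.2)) ∘ₗ
    (DirectSum.decomposeLinearEquiv 𝒱).toLinearMap

theorem toGradedι_of_mem {i : ℤ} {a : V} (ha : a ∈ 𝒱 i) :
    toGradedι 𝒱 a = DirectSum.of (fun i => gr 𝒱 i) i ⟨ι 𝒱 a, ι_mem_gr 𝒱 ha⟩ := by
  simp only [toGradedι, LinearMap.comp_apply, LinearEquiv.coe_coe,
    DirectSum.decomposeLinearEquiv_apply, DirectSum.decompose_of_mem 𝒱 ha]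
  rw [← DirectSum.lof_eq_of K, DirectSum.toModule_lof]
  rfl

theorem toGradedι_swap (i j : ℤ) (a b : V) (ha : a ∈ 𝒱 i) (hb : b ∈ 𝒱 j) :
    toGradedι 𝒱 a * toGradedι 𝒱 b = ksign K (i * j) • (toGradedι 𝒱 b * toGradedι 𝒱 a) := by
  rw [toGradedι_of_mem 𝒱 ha, toGradedι_of_mem 𝒱 hb, DirectSum.of_mul_of, DirectSum.of_mul_of,
    ← DirectSum.lof_eq_of K, ← DirectSum.lof_eq_of K, ← map_smul, DirectSum.lof_eq_of,
    DirectSum.lof_eq_of]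
  exact DirectSum.of_eq_of_gradedMonoid_eq (Sigma.subtype_ext (add_comm _ _) (ι_swap 𝒱 ha hb))

/-- Auxiliary map for the grading of `S(V)`. -/
def toGraded : SymAlg 𝒱 →ₐ[K] ⨁ i, gr 𝒱 i := lift 𝒱 (toGradedι 𝒱) (toGradedι_swap 𝒱)

theorem toGraded_of_mem {n : ℤ} (x : gr 𝒱 n) :
    toGraded 𝒱 x = DirectSum.of (fun i => gr 𝒱 i) n x := by
  obtain ⟨x, hx⟩ := x
  induction hx using Submodule.span_induction with
  | zero => exact (map_zero _).trans (map_zero _).symm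
  | add x y hx hy h h' =>
    have : (⟨x + y, add_mem hx hy⟩ : gr 𝒱 n) = ⟨x, hx⟩ + ⟨y, hy⟩ := rfl
    rw [this, map_add, ← h, ← h']
    exact map_add _ _ _
  | smul c x hx h =>
    have : (⟨c • x, Submodule.smul_mem _ _ hx⟩ : gr 𝒱 n) = c • ⟨x, hx⟩ := rfl
    rw [this, ← DirectSum.lof_eq_of K, map_smul, DirectSum.lof_eq_of, ← h]
    exact map_smul _ _ _
  | mem x hx =>
    obtain ⟨l, hl, rfl, rfl⟩ := hx
    dsimp only
    induction l with
    | nil => exact map_one _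
    | cons p l ih =>
      have hl' : ∀ q ∈ l, q.2 ∈ 𝒱 q.1 := fun q hq => hl q (List.mem_cons_of_mem _ hq)
      have hp : p.2 ∈ 𝒱 p.1 := hl p List.mem_cons_self
      simp only [List.map_cons, List.prod_cons, map_mul]
      rw [ih hl', toGraded, lift_ι,
        toGradedι_of_mem 𝒱 hp, DirectSum.of_mul_of]
      exact DirectSum.of_eq_of_gradedMonoid_eq (Sigma.subtype_ext List.sum_cons.symm rfl)

/-- `S(V)` is graded by the total degree. -/
instance : GradedAlgebra (gr 𝒱) :=
  GradedAlgebra.ofAlgHom _ (toGraded 𝒱)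
    (by
      refine hom_ext fun a => ?_
      induction a using DirectSum.Decomposition.inductionOn 𝒱 with
      | zero => simp
      | add a b h h' => rw [map_add, map_add, h, h', map_add]
      | homogeneous a =>
        rw [AlgHom.comp_apply, toGraded, lift_ι, toGradedι_of_mem 𝒱 a.2, DirectSum.coeAlgHom_of]
        rfl)
    (fun _ x => toGraded_of_mem 𝒱 x)

/-- The coproduct on generators. -/
def coprodι : V →ₗ[K] (gr 𝒱 ᵍ⊗[K] gr 𝒱) :=
  (GradedTensorProduct.includeLeft (gr 𝒱) (gr 𝒱)).toLinearMap ∘ₗ ι 𝒱 +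
    (GradedTensorProduct.includeRight (gr 𝒱) (gr 𝒱)).toLinearMap ∘ₗ ι 𝒱

theorem coprodι_swap (i j : ℤ) (a b : V) (ha : a ∈ 𝒱 i) (hb : b ∈ 𝒱 j) :
    coprodι 𝒱 a * coprodι 𝒱 b = ksign K (i * j) • (coprodι 𝒱 b * coprodι 𝒱 a) := by
  have anti : ∀ {i j : ℤ} {a b : V}, a ∈ 𝒱 i → b ∈ 𝒱 j →
      GradedTensorProduct.includeRight (gr 𝒱) (gr 𝒱) (ι 𝒱 a) *
        GradedTensorProduct.includeLeft (gr 𝒱) (gr 𝒱) (ι 𝒱 b) =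
      ksign K (i * j) • (GradedTensorProduct.includeLeft (gr 𝒱) (gr 𝒱) (ι 𝒱 b) *
        GradedTensorProduct.includeRight (gr 𝒱) (gr 𝒱) (ι 𝒱 a)) := by
    intro i j a b ha hb
    have h := GradedTensorProduct.tmul_coe_mul_coe_tmul (R := K) (gr 𝒱) (gr 𝒱) 1
      (⟨ι 𝒱 a, ι_mem_gr 𝒱 ha⟩ : gr 𝒱 i) (⟨ι 𝒱 b, ι_mem_gr 𝒱 hb⟩ : gr 𝒱 j) 1
    have h' := GradedTensorProduct.tmul_one_mul_one_tmul (R := K) (gr 𝒱) (gr 𝒱) (ι 𝒱 b) (ι 𝒱 a)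
    simp only [one_mul, mul_one] at h
    rw [GradedTensorProduct.includeRight_apply, GradedTensorProduct.includeLeft_apply, h, h',
      Units.smul_def, ← Int.cast_smul_eq_zsmul K]
    rfl
  have hs : ∀ n : ℤ, ksign K n * ksign K n = 1 := by
    intro n
    rw [ksign, ← Int.cast_mul, ← Units.val_mul, Int.units_mul_self, Units.val_one, Int.cast_one]
  have h1 := anti ha hb
  have h2 := anti hb ha
  rw [mul_comm j i] at h2
  have h3 : ∀ f : SymAlg 𝒱 →ₐ[K] (gr 𝒱 ᵍ⊗[K] gr 𝒱),
      f (ι 𝒱 a) * f (ι 𝒱 b) = ksign K (i * j) • (f (ι 𝒱 b) * f (ι 𝒱 a)) := by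
    intro f
    rw [← map_mul f, ← map_mul f, ι_swap 𝒱 ha hb, map_smul]
  simp only [coprodι, LinearMap.add_apply, LinearMap.comp_apply, AlgHom.toLinearMap_apply,
    add_mul, mul_add, smul_add, h1, h2, h3 (GradedTensorProduct.includeLeft (gr 𝒱) (gr 𝒱)),
    h3 (GradedTensorProduct.includeRight (gr 𝒱) (gr 𝒱)), smul_smul, hs, one_smul]
  abel

/-- The coproduct of `S(V)`: the algebra map to the graded tensor product `S(V) ⊗ S(V)` with
`v ↦ v ⊗ 1 + 1 ⊗ v` on generators. On products it is the unshuffle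
(de-concatenation) coproduct
`v₁ ⋯ v_n ↦ ∑ ± v_{σ(1)} ⋯ v_{σ(i)} ⊗ v_{σ(i+1)} ⋯ v_{σ(n)}`, summed over all `i` and all
`(i, n-i)`-unshuffles `σ`, with Koszul signs. -/
def coprod : SymAlg 𝒱 →ₐ[K] (gr 𝒱 ᵍ⊗[K] gr 𝒱) := lift 𝒱 (coprodι 𝒱) (coprodι_swap 𝒱)

end SymAlg

end SymmetricAlgebra

section SymmetricCoalgebra

variable {K : Type u} [Field K] {V : Type v} [AddCommGroup V] [Module K V]
variable (𝒱 : ℤ → Submodule K V)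

/-- The underlying space `⨁_{k ≥ 1} S^k V` of the symmetric coalgebra `S^c V`: the augmentation
ideal of `S(V)`. -/
def SymCoalg : Submodule K (SymAlg 𝒱) := LinearMap.ker (SymAlg.counit 𝒱).toLinearMap

namespace SymCoalg

/-- The projection `S(V) → S^c V`, `x ↦ x - ε(x) 1`, which removes the summand `S^0 V`. -/
def reduce : SymAlg 𝒱 →ₗ[K] SymCoalg 𝒱 :=
  (LinearMap.id - Algebra.linearMap K (SymAlg 𝒱) ∘ₗ (SymAlg.counit 𝒱).toLinearMap).codRestrict
    (SymCoalg 𝒱) fun x => by simp [SymCoalg]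

/-- The symmetric product `v₁ ⊙ ⋯ ⊙ v_k ∈ S^k V ⊆ S^c V`, as a multilinear map (meaningful for
`k ≥ 1`). -/
def monomial (k : ℕ) : MultilinearMap K (fun _ : Fin k => V) (SymCoalg 𝒱) :=
  (reduce 𝒱).compMultilinearMap
    ((MultilinearMap.mkPiAlgebraFin K k (SymAlg 𝒱)).compLinearMap fun _ => SymAlg.ι 𝒱)

/-- The component `f_k = π ∘ f ∘ ι_k : S^k V → V`, `k ≥ 1`, of a linear map `f : S^c V → S^c V`,
as a multilinear map on `V`. -/
def component (f : SymCoalg 𝒱 →ₗ[K] SymCoalg 𝒱) (k : ℕ) :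
    MultilinearMap K (fun _ : Fin k => V) V :=
  (SymAlg.proj 𝒱 ∘ₗ (SymCoalg 𝒱).subtype ∘ₗ f).compMultilinearMap (monomial 𝒱 k)

/-- `f` raises the total degree by `d`. -/
def HasDegree (d : ℤ) (f : SymCoalg 𝒱 →ₗ[K] SymCoalg 𝒱) : Prop :=
  ∀ (n : ℤ) (x : SymCoalg 𝒱),
    (x : SymAlg 𝒱) ∈ SymAlg.gr 𝒱 n → (f x : SymAlg 𝒱) ∈ SymAlg.gr 𝒱 (n + d)

variable [DirectSum.Decomposition 𝒱]

/-- The diagonal of `S^c V`: the reduced unshuffle (de-concatenation) coproduct, i.e. the part of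
the coproduct of `S(V)` in `S^c V ⊗ S^c V`. -/
def diag : SymCoalg 𝒱 →ₗ[K] SymCoalg 𝒱 ⊗[K] SymCoalg 𝒱 :=
  TensorProduct.map (reduce 𝒱) (reduce 𝒱) ∘ₗ
    (GradedTensorProduct.of K (SymAlg.gr 𝒱) (SymAlg.gr 𝒱)).symm.toLinearMap ∘ₗ
    (SymAlg.coprod 𝒱).toLinearMap ∘ₗ (SymCoalg 𝒱).subtype

/-- `x ↦ (-1)^{|x|} x` on `S^c V`. -/
def sign : SymCoalg 𝒱 →ₗ[K] SymCoalg 𝒱 :=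
  reduce 𝒱 ∘ₗ parity (SymAlg.gr 𝒱) ∘ₗ (SymCoalg 𝒱).subtype

/-- Degree `+1` coderivations of `S^c V`: `diag ∘ θ = (θ ⊗ id + id ⊗ θ) ∘ diag`, where, by the
Koszul sign rule, `(id ⊗ θ)(x ⊗ y) = (-1)^{|x|} x ⊗ θ y`. -/
structure IsCoderivation (θ : SymCoalg 𝒱 →ₗ[K] SymCoalg 𝒱) : Prop where
  hasDegree : HasDegree 𝒱 1 θ
  diag_comp : diag 𝒱 ∘ₗ θ =
    (TensorProduct.map θ LinearMap.id + TensorProduct.map (sign 𝒱) θ) ∘ₗ diag 𝒱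

/-- Automorphisms of the graded coalgebra `S^c V`. -/
structure Aut where
  toEquiv : SymCoalg 𝒱 ≃ₗ[K] SymCoalg 𝒱
  hasDegree : HasDegree 𝒱 0 toEquiv.toLinearMap
  diag_comp : diag 𝒱 ∘ₗ toEquiv.toLinearMap =
    TensorProduct.map toEquiv.toLinearMap toEquiv.toLinearMap ∘ₗ diag 𝒱

end SymCoalg

/-- `L∞`-algebras `(V, l)` on a graded vector space `V`, in the desuspended convention where all
structure operations have degree `+1`: degree `+1` coderivations `l` of `S^c V` with `l² = 0`. -/
structure LInfinity [DirectSum.Decomposition 𝒱] where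
  l : SymCoalg 𝒱 →ₗ[K] SymCoalg 𝒱
  isCoderivation : SymCoalg.IsCoderivation 𝒱 l
  sq_zero : l ∘ₗ l = 0

namespace LInfinity

variable {𝒱} [DirectSum.Decomposition 𝒱]

/-- The structure operation `l_k : S^k V → V`, as a multilinear map on `V`. -/
def op (L : LInfinity 𝒱) (k : ℕ) : MultilinearMap K (fun _ : Fin k => V) V :=
  SymCoalg.component 𝒱 L.l k

/-- `L` is the trivial `L∞`-algebra `(V, Δ, 0, 0, …)`. -/
def IsTrivial (L : LInfinity 𝒱) (Δ : V →ₗ[K] V) : Prop :=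
  (∀ v : V, L.op 1 ![v] = Δ v) ∧ ∀ k : ℕ, 2 ≤ k → L.op k = 0

/-- `L` is the twisting `E^φ` of `E` by `φ`, i.e. its coderivation is `φ⁻¹ ∘ E ∘ φ`. -/
def IsTwisting (L E : LInfinity 𝒱) (φ : SymCoalg.Aut 𝒱) : Prop :=
  L.l = φ.toEquiv.symm.toLinearMap ∘ₗ E.l ∘ₗ φ.toEquiv.toLinearMap

end LInfinity

end SymmetricCoalgebra

section Naturality

/-- A `ℤ`-graded commutative associative (not necessarily unital) algebra `A` over `K`, with a
differential: a degree `+1` linear map `Δ` with `Δ² = 0`, not required to be a derivation. -/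
structure DiffCommAlg (K : Type u) [Field K] where
  carrier : Type u
  [ring : NonUnitalRing carrier]
  [module : Module K carrier]
  [scalarTower : IsScalarTower K carrier carrier]
  [smulComm : SMulCommClass K carrier carrier]
  gr : ℤ → Submodule K carrier
  [decomposition : DirectSum.Decomposition gr]
  mul_mem : ∀ {i j : ℤ} {a b : carrier}, a ∈ gr i → b ∈ gr j → a * b ∈ gr (i + j)
  mul_comm : ∀ {i j : ℤ} {a b : carrier}, a ∈ gr i → b ∈ gr j →
    a * b = ksign K (i * j) • (b * a)
  Δ : carrier →ₗ[K] carrier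
  Δ_mem : ∀ {i : ℤ} {a : carrier}, a ∈ gr i → Δ a ∈ gr (i + 1)
  Δ_Δ : ∀ a : carrier, Δ (Δ a) = 0

namespace DiffCommAlg

variable {K : Type u} [Field K]

instance : CoeSort (DiffCommAlg K) (Type u) := ⟨carrier⟩

attribute [instance] ring module scalarTower smulComm decomposition

/-- The linear maps with respect to which natural operations are natural: they are multiplicative
and commute with the differentials. They need not be homogeneous; they only preserve the parity
of degrees, on which all Koszul signs depend. -/
structure IsMorphism {A B : DiffCommAlg K} (f : A →ₗ[K] B) : Prop where
  map_mul : ∀ a a' : A, f (a * a') = f a * f a'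
  map_Δ : ∀ a : A, f (A.Δ a) = B.Δ (f a)
  parity : ∀ (i : ℤ) (a : A), a ∈ A.gr i → f a ∈ ⨆ m : ℤ, B.gr (i + 2 * m)

/-- `c`, homogeneous of degree `n`, is a constant: `Δ` is graded linear with respect to the
multiplication by `c`. -/
def IsConstant (A : DiffCommAlg K) (n : ℤ) (c : A) : Prop :=
  c ∈ A.gr n ∧ ∀ x : A, A.Δ (c * x) = ksign K n • (c * A.Δ x)

/-- A degree `d` natural operation `S^k A → A`: a family of graded symmetric `k`-linear maps
`β_A : A × ⋯ × A → A`, of degree `d`, one for each `A`, which is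
natural, and graded linear over constants
(`β (c a₁, a₂, …, a_k) = (-1)^{d |c|} c β (a₁, …, a_k)`). -/
structure IsNatural (k : ℕ) (d : ℤ)
    (β : (A : DiffCommAlg K) → MultilinearMap K (fun _ : Fin k => A) A) : Prop where
  degree : ∀ (A : DiffCommAlg K) (n : Fin k → ℤ) (a : Fin k → A), (∀ i, a i ∈ A.gr (n i)) →
    β A a ∈ A.gr ((∑ i, n i) + d)
  symm : ∀ (A : DiffCommAlg K) (n : Fin k → ℤ) (a : Fin k → A), (∀ i, a i ∈ A.gr (n i)) →
    ∀ i j : Fin k, (j : ℕ) = i + 1 → β A (a ∘ Equiv.swap i j) = ksign K (n i * n j) • β A a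
  natural : ∀ (A B : DiffCommAlg K) (f : A →ₗ[K] B), IsMorphism f → ∀ a : Fin k → A,
    f (β A a) = β B (fun i => f (a i))
  linear_const : ∀ (A : DiffCommAlg K) (n : ℤ) (c : A), A.IsConstant n c →
    ∀ (a : Fin k → A) (i : Fin k), (i : ℕ) = 0 →
      β A (Function.update a i (c * a i)) = ksign K (d * n) • (c * β A a)

end DiffCommAlg

open DiffCommAlg

variable {K : Type u} [Field K]

/-- A natural `L∞`-algebra: an `L∞`-algebra on each `A` such that all
structure operations `l_k` are degree `1` natural operations. -/
def IsNaturalLInfinity (L : (A : DiffCommAlg K) → LInfinity A.gr) : Prop :=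
  ∀ k : ℕ, 1 ≤ k → IsNatural k 1 fun A => (L A).op k

/-- A natural automorphism: an automorphism of `S^c A` for each `A` such that all components
`φ_k` are degree `0` natural operations. -/
def IsNaturalAut (φ : (A : DiffCommAlg K) → SymCoalg.Aut A.gr) : Prop :=
  ∀ k : ℕ, 1 ≤ k → IsNatural k 0 fun A => SymCoalg.component A.gr (φ A).toEquiv.toLinearMap k

/-- `φ` is a natural automorphism of the form `(id, φ₂, φ₃, …)`, and `L A` is, for each `A`, the
twisting of the trivial `L∞`-algebra `(A, Δ, 0, 0, …)` via `φ`. -/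
structure IsNaturalTwisting (L : (A : DiffCommAlg K) → LInfinity A.gr)
    (φ : (A : DiffCommAlg K) → SymCoalg.Aut A.gr) : Prop where
  natural : IsNaturalAut φ
  linear_part : ∀ (A : DiffCommAlg K) (a : A),
    SymCoalg.component A.gr (φ A).toEquiv.toLinearMap 1 ![a] = a
  twisting : ∀ A : DiffCommAlg K, ∃ E : LInfinity A.gr, E.IsTrivial A.Δ ∧ (L A).IsTwisting E (φ A)

end Naturality

end KoszulBraces

end

open KoszulBraces

/-!
The idea is to show that a natural `L∞`-algebra is encoded by a single power series, and that the
automorphism `φ` is the substitution of the identity of `A` in that series.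

*Coalgebra maps as convolutions.* Let `S(A)` be the full symmetric coalgebra, of which `S^c A` is the
reduced part. Linear maps from `S(A)` to the unitization `K ⊕ A` form an algebra under convolution.
The projection `π : S(A) → A` is locally nilpotent in it, so that every power series `f` has a value
`f(π)` (`series`); on `a₁ ⋯ a_n` it is `n! f_n` times the product of the `a_i`. An automorphism of `S^c A`
amounts to its projection to `A`, which is subject to being the identity on generators only
(`expAut`, a convolution exponential, and `Aut.ext_component`). Composing with a coderivation `D` obeys
the chain rule `f(π) D = Q * f'(π)`, where `Q` is the projection of `D` (`IsCoder.psum_comp`).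

*Natural operations.* Polarization and the multiplication by an adjoined constant, which turns a factor
of any degree into one of degree zero, show that a natural operation is determined by its values on
the powers of elements of degree zero (`universal_apply_mono_eq_zero`). By naturality these values lie
in the subalgebra generated by one element `a` and its differentials. Hence an operation of degree
zero is a multiple of the product (`exists_eq_smul_prodMap`), and one of degree one is a combination
of the operations `koszulOp i j`, the sums of the `± Δ(a_{σ(1)} ⋯ a_{σ(j)}) a_{σ(j+1)} ⋯ a_{σ(j+i)}` over
unshuffles (`exists_eq_sum_koszulOp`).

*The equation `l² = 0`.* The structure `l` is thus given by numbers `c (i, j)`, the coefficients of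
`koszulOp i j`. For fixed `j` they are collected in the series `P_j = ∑ c (i, j) X^i / i!` (`column`), and
`G = ∑_{j ≥ 1} c (0, j) X^j / j!` is that of the row `i = 0` (`rowSeries`). The projection of `l²` is evaluated
on the divided powers of `x` in algebras `K[x]⟨e, f⟩`, exterior over `K[x]`, with suitable differentials.
The coefficient of `e f` gives `P_m P₁' = P₁ P_m'`, so that all columns are proportional to `P₁`
(`column_eq`), and `P₁ G' = 1` (`column_mul_derivative_rowSeries`). By the first relation `l` has
projection `Δ G(π) * P₁(π)`, and the chain rule with the second one gives
`G(π) l = Δ G(π) * P₁(π) * G'(π) = Δ G(π)`; this says that the automorphism `φ` with projection `G(π)`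
satisfies `φ l = Δ φ` (`series_rowSeries_comp`).

*Uniqueness and the binary operations.* Conversely a natural `φ` has projection `f(π)` for some `f`,
and `φ l = Δ φ` evaluated in one of the test algebras forces `P₁ f' = 1`, so `f = G` (`eq_rowSeries`).
Finally `φ₂` is `c (0, 2)` times the product, and `l₂` is `c (0, 2)` times the deviation of `Δ` from being
a derivation (`op_two`), which does not vanish identically; so either condition on the binary
operations says that `c (0, 2) = 1`.
-/

noncomputable section

namespace KoszulBraces

/-! ### Signs -/

section Signs

variable {K : Type u} [Field K]

@[simp] theorem ksign_zero : ksign K 0 = 1 := by simp [ksign]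

theorem ksign_add (m n : ℤ) : ksign K (m + n) = ksign K m * ksign K n := by
  simp [ksign, Int.negOnePow_add]

theorem ksign_mul_self (n : ℤ) : ksign K n * ksign K n = 1 := by
  rw [ksign, ← Int.cast_mul, ← Units.val_mul, Int.units_mul_self, Units.val_one, Int.cast_one]

theorem ksign_ne_zero (n : ℤ) : ksign K n ≠ 0 := fun h => by
  simpa [h] using ksign_mul_self (K := K) n

theorem ksign_congr {m n : ℤ} (h : Even (m - n)) : ksign K m = ksign K n := by
  rw [ksign, ksign, (Int.negOnePow_eq_iff m n).2 h]

theorem units_smul_eq_ksign {M : Type*} [AddCommGroup M] [Module K M] (n : ℤ) (x : M) :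
    ((-1 : ℤˣ) ^ n) • x = ksign K n • x := by
  rw [Units.smul_def, ← Int.cast_smul_eq_zsmul K]
  rfl

end Signs

/-! ### Twisting a graded space by signs -/

section Twist

variable {K : Type u} [Field K] {M : Type v} [AddCommGroup M] [Module K M]
variable (𝒱 : ℤ → Submodule K M) [DirectSum.Decomposition 𝒱]

/-- The linear map that multiplies the elements of degree `i` by `(-1)^(n i)`: the Koszul sign for
moving an object of degree `n` past an element of `M`. -/
def twist (n : ℤ) : M →ₗ[K] M :=
  (DirectSum.toModule K ℤ M fun i => ksign K (n * i) • (𝒱 i).subtype) ∘ₗ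
    (DirectSum.decomposeLinearEquiv 𝒱).toLinearMap

theorem twist_of_mem (n : ℤ) {i : ℤ} {x : M} (hx : x ∈ 𝒱 i) :
    twist 𝒱 n x = ksign K (n * i) • x := by
  simp only [twist, LinearMap.comp_apply, LinearEquiv.coe_coe,
    DirectSum.decomposeLinearEquiv_apply, DirectSum.decompose_of_mem 𝒱 hx]
  rw [← DirectSum.lof_eq_of K, DirectSum.toModule_lof]
  rfl

theorem parity_of_mem {i : ℤ} {x : M} (hx : x ∈ 𝒱 i) : parity 𝒱 x = ksign K i • x := by
  simp only [parity, LinearMap.comp_apply, LinearEquiv.coe_coe,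
    DirectSum.decomposeLinearEquiv_apply, DirectSum.decompose_of_mem 𝒱 hx]
  rw [← DirectSum.lof_eq_of K, DirectSum.toModule_lof]
  rfl

theorem twist_mem (n : ℤ) {i : ℤ} {x : M} (hx : x ∈ 𝒱 i) : twist 𝒱 n x ∈ 𝒱 i := by
  rw [twist_of_mem 𝒱 n hx]
  exact Submodule.smul_mem _ _ hx

/-- A linear map out of a graded space is determined by its values on homogeneous elements. -/
theorem linearMap_ext_homogeneous {N : Type*} [AddCommGroup N] [Module K N] {f g : M →ₗ[K] N}
    (h : ∀ (i : ℤ) (x : M), x ∈ 𝒱 i → f x = g x) : f = g :=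
  DirectSum.decompose_lhom_ext 𝒱 fun i => LinearMap.ext fun x => h i x x.2

/-- Two linear maps agree on homogeneous tensors only if they are equal. -/
theorem tensor_ext_homogeneous {N : Type*} [AddCommGroup N] [Module K N]
    {f g : M ⊗[K] M →ₗ[K] N}
    (h : ∀ (i j : ℤ) (x y : M), x ∈ 𝒱 i → y ∈ 𝒱 j → f (x ⊗ₜ y) = g (x ⊗ₜ y)) : f = g := by
  refine TensorProduct.ext <| linearMap_ext_homogeneous 𝒱 fun i x hx =>
    linearMap_ext_homogeneous 𝒱 fun j y hy => ?_
  exact h i j x y hx hy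

theorem twist_zero : twist 𝒱 0 = LinearMap.id :=
  linearMap_ext_homogeneous 𝒱 fun i x hx => by simp [twist_of_mem 𝒱 0 hx]

theorem twist_one : twist 𝒱 1 = parity 𝒱 :=
  linearMap_ext_homogeneous 𝒱 fun i x hx => by simp [twist_of_mem 𝒱 1 hx, parity_of_mem 𝒱 hx]

end Twist

namespace SymAlg

variable {K : Type u} [Field K] {V : Type v} [AddCommGroup V] [Module K V]
variable (𝒱 : ℤ → Submodule K V) [DirectSum.Decomposition 𝒱]

/-! ### The symmetric algebra as a coalgebra -/

variable {𝒱} in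
/-- Induction on the number of factors of products of homogeneous generators. -/
theorem induction {P : SymAlg 𝒱 → Prop} (one : P 1) (add : ∀ x y, P x → P y → P (x + y))
    (smul : ∀ (c : K) x, P x → P (c • x))
    (mul : ∀ (i : ℤ) (a : V), a ∈ 𝒱 i → ∀ x, P x → P (ι 𝒱 a * x)) (x : SymAlg 𝒱) : P x := by
  have zero : P 0 := by simpa using smul 0 1 one
  induction x using DirectSum.Decomposition.inductionOn (gr 𝒱) with
  | zero => exact zero
  | add x y hx hy => exact add x y hx hy
  | homogeneous x =>
    obtain ⟨x, hx⟩ := x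
    dsimp only
    induction hx using Submodule.span_induction with
    | zero => exact zero
    | add x y _ _ hx hy => exact add x y hx hy
    | smul c x _ hx => exact smul c x hx
    | mem x hx =>
      obtain ⟨l, hl, -, rfl⟩ := hx
      induction l with
      | nil => exact one
      | cons p l ih =>
        rw [List.map_cons, List.prod_cons]
        exact mul p.1 p.2 (hl p List.mem_cons_self) _
          (ih fun q hq => hl q (List.mem_cons_of_mem _ hq))

variable {𝒱} in
theorem linearMap_ext {N : Type*} [AddCommGroup N] [Module K N] {f g : SymAlg 𝒱 →ₗ[K] N}
    (one : f 1 = g 1)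
    (mul : ∀ (i : ℤ) (a : V), a ∈ 𝒱 i → ∀ x, f x = g x → f (ι 𝒱 a * x) = g (ι 𝒱 a * x)) :
    f = g :=
  LinearMap.ext <| induction one (fun x y hx hy => by rw [map_add, map_add, hx, hy])
    (fun c x hx => by rw [map_smul, map_smul, hx]) mul

/-- The unshuffle coproduct as a linear map to the ordinary tensor product. -/
def comulₗ : SymAlg 𝒱 →ₗ[K] SymAlg 𝒱 ⊗[K] SymAlg 𝒱 :=
  (GradedTensorProduct.of K (gr 𝒱) (gr 𝒱)).symm.toLinearMap ∘ₗ (coprod 𝒱).toLinearMap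

theorem comulₗ_one : comulₗ 𝒱 1 = 1 ⊗ₜ 1 := by
  exact congrArg (GradedTensorProduct.of K (gr 𝒱) (gr 𝒱)).symm (map_one (coprod 𝒱))

/-- The coproduct of a product with a generator. All properties of the coproduct are derived from
this recursion. -/
theorem comulₗ_ι_mul {i : ℤ} {a : V} (ha : a ∈ 𝒱 i) (x : SymAlg 𝒱) :
    comulₗ 𝒱 (ι 𝒱 a * x) =
      TensorProduct.map (LinearMap.mulLeft K (ι 𝒱 a)) LinearMap.id (comulₗ 𝒱 x) +
        TensorProduct.map (twist (gr 𝒱) i) (LinearMap.mulLeft K (ι 𝒱 a)) (comulₗ 𝒱 x) := by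
  have hL : ∀ t : SymAlg 𝒱 ⊗[K] SymAlg 𝒱,
      (GradedTensorProduct.of K (gr 𝒱) (gr 𝒱)).symm
        (GradedTensorProduct.includeLeft (gr 𝒱) (gr 𝒱) (ι 𝒱 a) *
          GradedTensorProduct.of K (gr 𝒱) (gr 𝒱) t) =
      TensorProduct.map (LinearMap.mulLeft K (ι 𝒱 a)) LinearMap.id t := by
    intro t
    induction t using TensorProduct.induction_on with
    | zero => simp
    | add s t hs ht => rw [map_add, mul_add, map_add, map_add, hs, ht]
    | tmul x y =>
      induction x using DirectSum.Decomposition.inductionOn (gr 𝒱) with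
      | zero => simp
      | add x x' hx hx' => rw [TensorProduct.add_tmul, map_add, mul_add, map_add, map_add, hx, hx']
      | homogeneous x =>
        have := GradedTensorProduct.tmul_one_mul_coe_tmul (R := K) (gr 𝒱) (gr 𝒱) (ι 𝒱 a) x y
        rw [GradedTensorProduct.includeLeft_apply, this]
        rfl
  have hR : ∀ t : SymAlg 𝒱 ⊗[K] SymAlg 𝒱,
      (GradedTensorProduct.of K (gr 𝒱) (gr 𝒱)).symm
        (GradedTensorProduct.includeRight (gr 𝒱) (gr 𝒱) (ι 𝒱 a) *
          GradedTensorProduct.of K (gr 𝒱) (gr 𝒱) t) =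
      TensorProduct.map (twist (gr 𝒱) i) (LinearMap.mulLeft K (ι 𝒱 a)) t := by
    intro t
    induction t using TensorProduct.induction_on with
    | zero => simp
    | add s t hs ht => rw [map_add, mul_add, map_add, map_add, hs, ht]
    | tmul x y =>
      induction x using DirectSum.Decomposition.inductionOn (gr 𝒱) with
      | zero => simp
      | add x x' hx hx' => rw [TensorProduct.add_tmul, map_add, mul_add, map_add, map_add, hx, hx']
      | homogeneous x =>
        have := GradedTensorProduct.tmul_coe_mul_coe_tmul (R := K) (gr 𝒱) (gr 𝒱) 1
          (⟨ι 𝒱 a, ι_mem_gr 𝒱 ha⟩ : gr 𝒱 i) x y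
        dsimp only at this
        rw [GradedTensorProduct.includeRight_apply, this, units_smul_eq_ksign (K := K), map_smul,
          one_mul, TensorProduct.map_tmul, twist_of_mem (gr 𝒱) i x.2, ← TensorProduct.smul_tmul']
        rfl
  have h : ∀ y, coprod 𝒱 y = GradedTensorProduct.of K (gr 𝒱) (gr 𝒱) (comulₗ 𝒱 y) := fun y => rfl
  rw [← hL, ← hR, ← h, ← map_add, ← add_mul]
  change (GradedTensorProduct.of K (gr 𝒱) (gr 𝒱)).symm (coprod 𝒱 (ι 𝒱 a * x)) = _
  rw [map_mul]
  congr 2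
  exact lift_ι _ _ _ _

theorem comulₗ_comp_mulLeft {i : ℤ} {a : V} (ha : a ∈ 𝒱 i) :
    comulₗ 𝒱 ∘ₗ LinearMap.mulLeft K (ι 𝒱 a) =
      (TensorProduct.map (LinearMap.mulLeft K (ι 𝒱 a)) LinearMap.id +
        TensorProduct.map (twist (gr 𝒱) i) (LinearMap.mulLeft K (ι 𝒱 a))) ∘ₗ comulₗ 𝒱 :=
  LinearMap.ext fun x => comulₗ_ι_mul 𝒱 ha x

theorem twist_one_apply (n : ℤ) : twist (gr 𝒱) n 1 = 1 := by
  rw [twist_of_mem (gr 𝒱) n (SetLike.GradedOne.one_mem (A := gr 𝒱)), mul_zero, ksign_zero, one_smul]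

theorem twist_mul (n : ℤ) (x y : SymAlg 𝒱) :
    twist (gr 𝒱) n (x * y) = twist (gr 𝒱) n x * twist (gr 𝒱) n y := by
  have : (twist (gr 𝒱) n) ∘ₗ LinearMap.mul' K (SymAlg 𝒱) = LinearMap.mul' K (SymAlg 𝒱) ∘ₗ
      TensorProduct.map (twist (gr 𝒱) n) (twist (gr 𝒱) n) :=
    tensor_ext_homogeneous (gr 𝒱) fun i j x y hx hy => by
      simp only [LinearMap.comp_apply, LinearMap.mul'_apply, TensorProduct.map_tmul,
        twist_of_mem (gr 𝒱) n hx, twist_of_mem (gr 𝒱) n hy,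
        twist_of_mem (gr 𝒱) n (SetLike.GradedMul.mul_mem hx hy), mul_add, ksign_add,
        smul_mul_smul_comm]
  exact LinearMap.congr_fun this (x ⊗ₜ y)

theorem twist_ι {i : ℤ} {a : V} (ha : a ∈ 𝒱 i) (n : ℤ) :
    twist (gr 𝒱) n (ι 𝒱 a) = ksign K (n * i) • ι 𝒱 a :=
  twist_of_mem _ _ (ι_mem_gr 𝒱 ha)

theorem comulₗ_twist (n : ℤ) :
    comulₗ 𝒱 ∘ₗ twist (gr 𝒱) n =
      TensorProduct.map (twist (gr 𝒱) n) (twist (gr 𝒱) n) ∘ₗ comulₗ 𝒱 := by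
  refine linearMap_ext ?_ fun i a ha x hx => ?_
  · simp [twist_one_apply, comulₗ_one]
  · simp only [LinearMap.comp_apply] at hx ⊢
    rw [twist_mul, twist_ι 𝒱 ha, smul_mul_assoc, map_smul, comulₗ_ι_mul 𝒱 ha,
      comulₗ_ι_mul 𝒱 ha, hx]
    refine LinearMap.congr_fun (f := ksign K (n * i) •
        (TensorProduct.map (LinearMap.mulLeft K (ι 𝒱 a)) LinearMap.id +
          TensorProduct.map (twist (gr 𝒱) i) (LinearMap.mulLeft K (ι 𝒱 a))) ∘ₗ
        TensorProduct.map (twist (gr 𝒱) n) (twist (gr 𝒱) n))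
      (g := TensorProduct.map (twist (gr 𝒱) n) (twist (gr 𝒱) n) ∘ₗ
        (TensorProduct.map (LinearMap.mulLeft K (ι 𝒱 a)) LinearMap.id +
          TensorProduct.map (twist (gr 𝒱) i) (LinearMap.mulLeft K (ι 𝒱 a))))
      (tensor_ext_homogeneous (gr 𝒱) fun p q y z hy hz => ?_) _
    simp only [LinearMap.smul_apply, LinearMap.comp_apply, LinearMap.add_apply,
      TensorProduct.map_tmul, LinearMap.mulLeft_apply, LinearMap.id_apply, map_add, smul_add,
      twist_mul, twist_ι 𝒱 ha, twist_of_mem _ _ hy, twist_of_mem _ _ hz, map_smul, mul_smul_comm,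
      smul_mul_assoc, TensorProduct.smul_tmul', TensorProduct.tmul_smul, smul_smul]
    congr 3 <;> ring

omit [DirectSum.Decomposition 𝒱] in
theorem counit_ι (a : V) : counit 𝒱 (ι 𝒱 a) = 0 := by
  rw [counit, lift_ι]
  rfl

omit [DirectSum.Decomposition 𝒱] in
theorem counit_ι_mul (a : V) (x : SymAlg 𝒱) : counit 𝒱 (ι 𝒱 a * x) = 0 := by
  rw [map_mul, counit_ι, zero_mul]

theorem counit_twist (n : ℤ) (x : SymAlg 𝒱) : counit 𝒱 (twist (gr 𝒱) n x) = counit 𝒱 x := by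
  refine LinearMap.congr_fun (f := (counit 𝒱).toLinearMap ∘ₗ twist (gr 𝒱) n)
    (g := (counit 𝒱).toLinearMap) (linearMap_ext ?_ fun i a ha x _ => ?_) x
  · simp [twist_one_apply]
  · simp [twist_mul, twist_ι 𝒱 ha, counit_ι]

/-- The coalgebra structure of `S(V)`. The underlying coalgebra in the ungraded sense suffices:
no signs appear in the counit and coassociativity axioms. -/
instance : Coalgebra K (SymAlg 𝒱) where
  comul := comulₗ 𝒱
  counit := (counit 𝒱).toLinearMap
  coassoc := by
    refine linearMap_ext ?_ fun i a ha x hx => ?_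
    · simp [comulₗ_one]
    · simp only [LinearMap.comp_apply, LinearEquiv.coe_coe, LinearMap.rTensor, LinearMap.lTensor]
        at hx ⊢
      rw [comulₗ_ι_mul 𝒱 ha]
      simp only [map_add]
      simp only [TensorProduct.map_map, LinearMap.id_comp, LinearMap.comp_id,
        comulₗ_comp_mulLeft 𝒱 ha, comulₗ_twist]
      have key : ∀ (f g h : SymAlg 𝒱 →ₗ[K] SymAlg 𝒱) (t),
          TensorProduct.assoc K _ _ _
            (TensorProduct.map (TensorProduct.map f g ∘ₗ comulₗ 𝒱) h t) =
          TensorProduct.map f (TensorProduct.map g h) (TensorProduct.assoc K _ _ _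
            (TensorProduct.map (comulₗ 𝒱) LinearMap.id t)) := by
        intro f g h t
        rw [TensorProduct.map_map_assoc, TensorProduct.map_map, LinearMap.comp_id]
      simp only [LinearMap.add_comp, TensorProduct.map_add_left, TensorProduct.map_add_right,
        LinearMap.add_apply, map_add, key, hx]
      simp only [TensorProduct.map_map, LinearMap.comp_id, TensorProduct.map_id,
        LinearMap.id_comp]
      abel
  rTensor_counit_comp_comul := by
    refine linearMap_ext ?_ fun i a ha x hx => ?_
    · simp [comulₗ_one]
    · simp only [LinearMap.comp_apply, LinearMap.rTensor] at hx ⊢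
      have h0 : (counit 𝒱).toLinearMap ∘ₗ LinearMap.mulLeft K (ι 𝒱 a) = 0 :=
        LinearMap.ext fun x => counit_ι_mul 𝒱 a x
      have h1 : (counit 𝒱).toLinearMap ∘ₗ twist (gr 𝒱) i = LinearMap.id ∘ₗ (counit 𝒱).toLinearMap :=
        LinearMap.ext fun x => counit_twist 𝒱 i x
      rw [comulₗ_ι_mul 𝒱 ha, map_add, TensorProduct.map_map, TensorProduct.map_map, h0, h1,
        TensorProduct.map_zero_left, LinearMap.zero_apply, zero_add,
        LinearMap.id_comp (LinearMap.mulLeft K (ι 𝒱 a)),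
        show TensorProduct.map (LinearMap.id ∘ₗ (counit 𝒱).toLinearMap)
          (LinearMap.mulLeft K (ι 𝒱 a)) = TensorProduct.map LinearMap.id
          (LinearMap.mulLeft K (ι 𝒱 a)) ∘ₗ TensorProduct.map (counit 𝒱).toLinearMap LinearMap.id
          from by rw [← TensorProduct.map_comp, LinearMap.comp_id], LinearMap.comp_apply, hx]
      simp
  lTensor_counit_comp_comul := by
    refine linearMap_ext ?_ fun i a ha x hx => ?_
    · simp [comulₗ_one]
    · simp only [LinearMap.comp_apply, LinearMap.lTensor] at hx ⊢
      have h0 : (counit 𝒱).toLinearMap ∘ₗ LinearMap.mulLeft K (ι 𝒱 a) = 0 :=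
        LinearMap.ext fun x => counit_ι_mul 𝒱 a x
      rw [comulₗ_ι_mul 𝒱 ha, map_add, TensorProduct.map_map, TensorProduct.map_map, h0,
        TensorProduct.map_zero_right, LinearMap.zero_apply, add_zero, LinearMap.id_comp,
        LinearMap.comp_id, ← LinearMap.id_comp (counit 𝒱).toLinearMap,
        ← LinearMap.comp_id (LinearMap.mulLeft K (ι 𝒱 a)), TensorProduct.map_comp,
        LinearMap.comp_apply, hx]
      simp

theorem counit_eq (x : SymAlg 𝒱) : Coalgebra.counit (R := K) x = counit 𝒱 x := rfl

/-- Graded cocommutativity, in a form that applies to the convolution product of two maps that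
commute up to the Koszul sign. -/
theorem apply_comul_of_swap {N : Type*} [AddCommGroup N] [Module K N]
    {f g : SymAlg 𝒱 ⊗[K] SymAlg 𝒱 →ₗ[K] N}
    (h : ∀ (i j : ℤ) (x y : SymAlg 𝒱), x ∈ gr 𝒱 i → y ∈ gr 𝒱 j →
      f (x ⊗ₜ y) = ksign K (i * j) • g (y ⊗ₜ x)) (x : SymAlg 𝒱) :
    f (comulₗ 𝒱 x) = g (comulₗ 𝒱 x) := by
  have hc : (GradedTensorProduct.comm (R := K) (gr 𝒱) (gr 𝒱)).toAlgHom.comp (coprod 𝒱) =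
      coprod 𝒱 := by
    refine hom_ext fun a => ?_
    induction a using DirectSum.Decomposition.inductionOn 𝒱 with
    | zero => simp
    | add a b h h' => simp only [map_add, h, h']
    | homogeneous a =>
      rename_i i
      have h1 := GradedTensorProduct.comm_coe_tmul_coe (R := K) (gr 𝒱) (gr 𝒱)
        (⟨ι 𝒱 a, ι_mem_gr 𝒱 a.2⟩ : gr 𝒱 i) (⟨1, SetLike.GradedOne.one_mem⟩ : gr 𝒱 0)
      have h2 := GradedTensorProduct.comm_coe_tmul_coe (R := K) (gr 𝒱) (gr 𝒱)
        (⟨1, SetLike.GradedOne.one_mem⟩ : gr 𝒱 0) (⟨ι 𝒱 a, ι_mem_gr 𝒱 a.2⟩ : gr 𝒱 i)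
      simp only [zero_mul, mul_zero, uzpow_zero, one_smul] at h1 h2
      simp only [AlgHom.comp_apply, coprod, lift_ι, coprodι, LinearMap.add_apply,
        LinearMap.comp_apply, AlgHom.toLinearMap_apply, map_add,
        GradedTensorProduct.includeLeft_apply, GradedTensorProduct.includeRight_apply]
      erw [h1, h2]
      exact add_comm _ _
  have hfg : f = g ∘ₗ (GradedTensorProduct.of K (gr 𝒱) (gr 𝒱)).symm.toLinearMap ∘ₗ
      (GradedTensorProduct.comm (R := K) (gr 𝒱) (gr 𝒱)).toLinearMap ∘ₗ
      (GradedTensorProduct.of K (gr 𝒱) (gr 𝒱)).toLinearMap := by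
    refine tensor_ext_homogeneous (gr 𝒱) fun i j x y hx hy => ?_
    have h1 := GradedTensorProduct.comm_coe_tmul_coe (R := K) (gr 𝒱) (gr 𝒱)
      (⟨x, hx⟩ : gr 𝒱 i) (⟨y, hy⟩ : gr 𝒱 j)
    rw [h i j x y hx hy]
    simp only [LinearMap.comp_apply, LinearEquiv.coe_coe, AlgEquiv.toLinearMap_apply]
    erw [h1]
    rw [units_smul_eq_ksign (K := K), mul_comm j i]
    exact (g.map_smul _ _).symm
  rw [hfg]
  simp only [LinearMap.comp_apply, LinearEquiv.coe_coe, AlgEquiv.toLinearMap_apply]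
  congr 1
  have := AlgHom.congr_fun hc x
  exact congrArg (GradedTensorProduct.of K (gr 𝒱) (gr 𝒱)).symm this

end SymAlg

/-! ### Locally finite sums of linear maps -/

section LocallyFinite

variable {K : Type u} [Field K]
variable {M N M' N' : Type*} [AddCommGroup M] [Module K M] [AddCommGroup N] [Module K N]
  [AddCommGroup M'] [Module K M'] [AddCommGroup N'] [Module K N']

/-- A sequence of linear maps such that only finitely many of them are non-zero at any given
vector. -/
def LocFin (T : ℕ → M →ₗ[K] N) : Prop := ∀ x, ∃ n, ∀ k, n ≤ k → T k x = 0

/-- The sum of a locally finite sequence of linear maps. -/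
def lsum (T : ℕ → M →ₗ[K] N) (hT : LocFin T) : M →ₗ[K] N where
  toFun x := ∑ᶠ k, T k x
  map_add' x y := by
    have fin : ∀ x, (Function.support fun k => T k x).Finite := fun x => by
      obtain ⟨n, hn⟩ := hT x
      exact (Set.finite_lt_nat n).subset fun k hk => not_le.1 fun h => hk (hn k h)
    simp only [map_add]
    exact finsum_add_distrib (fin x) (fin y)
  map_smul' c x := by
    simp only [map_smul, RingHom.id_apply]
    exact (smul_finsum c _).symm

theorem lsum_apply {T : ℕ → M →ₗ[K] N} (hT : LocFin T) {x : M} {n : ℕ}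
    (hn : ∀ k, n ≤ k → T k x = 0) : lsum T hT x = ∑ k ∈ Finset.range n, T k x :=
  finsum_eq_sum_of_support_subset _ fun k hk => by
    simp only [Finset.coe_range, Set.mem_Iio]
    exact not_le.1 fun h => hk (hn k h)

theorem lsum_apply_eq_of_forall_ne {T : ℕ → M →ₗ[K] N} (hT : LocFin T) {x : M} (n : ℕ)
    (hn : ∀ k, k ≠ n → T k x = 0) : lsum T hT x = T n x :=
  finsum_eq_single _ n hn

theorem LocFin.comp_left {T : ℕ → M →ₗ[K] N} (hT : LocFin T) (f : N →ₗ[K] N') :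
    LocFin fun k => f ∘ₗ T k := fun x =>
  let ⟨n, hn⟩ := hT x
  ⟨n, fun k hk => by simp [hn k hk]⟩

theorem LocFin.comp_right {T : ℕ → M →ₗ[K] N} (hT : LocFin T) (f : M' →ₗ[K] M) :
    LocFin fun k => T k ∘ₗ f := fun x =>
  let ⟨n, hn⟩ := hT (f x)
  ⟨n, fun k hk => by simp [hn k hk]⟩

theorem LocFin.smul {T : ℕ → M →ₗ[K] N} (hT : LocFin T) (c : ℕ → K) :
    LocFin fun k => c k • T k := fun x =>
  let ⟨n, hn⟩ := hT x
  ⟨n, fun k hk => by simp [hn k hk]⟩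

theorem comp_lsum {T : ℕ → M →ₗ[K] N} (hT : LocFin T) (f : N →ₗ[K] N') :
    f ∘ₗ lsum T hT = lsum (fun k => f ∘ₗ T k) (hT.comp_left f) := by
  ext x
  obtain ⟨n, hn⟩ := hT x
  rw [LinearMap.comp_apply, lsum_apply hT hn, lsum_apply _ (fun k hk => by simp [hn k hk]), map_sum]
  rfl

theorem lsum_comp {T : ℕ → M →ₗ[K] N} (hT : LocFin T) (f : M' →ₗ[K] M) :
    lsum T hT ∘ₗ f = lsum (fun k => T k ∘ₗ f) (hT.comp_right f) := rfl

theorem lsum_congr {T T' : ℕ → M →ₗ[K] N} {hT : LocFin T} {hT' : LocFin T'}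
    (h : ∀ k, T k = T' k) : lsum T hT = lsum T' hT' := by
  obtain rfl : T = T' := funext h
  rfl

/-- The Cauchy product formula for the tensor product of two locally finite sums. -/
theorem map_lsum_lsum {T : ℕ → M →ₗ[K] N} (hT : LocFin T) {T' : ℕ → M' →ₗ[K] N'}
    (hT' : LocFin T') (t : M ⊗[K] M') : ∃ n, ∀ k, n ≤ k →
      (∑ p ∈ Finset.HasAntidiagonal.antidiagonal k, TensorProduct.map (T p.1) (T' p.2) t) = 0 ∧
      TensorProduct.map (lsum T hT) (lsum T' hT') t = ∑ m ∈ Finset.range k,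
        ∑ p ∈ Finset.HasAntidiagonal.antidiagonal m, TensorProduct.map (T p.1) (T' p.2) t := by
  induction t using TensorProduct.induction_on with
  | zero => exact ⟨0, fun k _ => by simp⟩
  | add s t hs ht =>
    obtain ⟨m, hm⟩ := hs
    obtain ⟨n, hn⟩ := ht
    refine ⟨max m n, fun k hk => ?_⟩
    obtain ⟨h1, h2⟩ := hm k (le_of_max_le_left hk)
    obtain ⟨h3, h4⟩ := hn k (le_of_max_le_right hk)
    simp only [map_add, Finset.sum_add_distrib, h1, h3, h2, h4, add_zero, and_self]
  | tmul x y =>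
    obtain ⟨m, hm⟩ := hT x
    obtain ⟨n, hn⟩ := hT' y
    refine ⟨m + n, fun k hk => ⟨Finset.sum_eq_zero fun p hp => ?_, ?_⟩⟩
    · rw [Finset.HasAntidiagonal.mem_antidiagonal] at hp
      rw [TensorProduct.map_tmul]
      rcases le_or_gt m p.1 with h | h
      · rw [hm _ h, TensorProduct.zero_tmul]
      · rw [hn _ (by omega), TensorProduct.tmul_zero]
    · simp only [Finset.Nat.sum_antidiagonal_eq_sum_range_succ_mk, TensorProduct.map_tmul]
      rw [Finset.sum_range_diag_flip k fun i j => T i x ⊗ₜ[K] T' j y,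
        lsum_apply hT hm, lsum_apply hT' hn, TensorProduct.sum_tmul]
      rw [← Finset.sum_subset (Finset.range_mono (show m ≤ k by omega)) fun i _ hi => by
        rw [Finset.mem_range, not_lt] at hi
        simp [hm i hi]]
      refine Finset.sum_congr rfl fun i hi => ?_
      rw [Finset.mem_range] at hi
      rw [TensorProduct.tmul_sum]
      exact Finset.sum_subset (Finset.range_mono (by omega)) fun j _ hj => by
        rw [Finset.mem_range, not_lt] at hj
        simp [hn j hj]

end LocallyFinite

/-! ### The convolution algebra -/

namespace SymAlg

variable {K : Type u} [Field K] {V : Type v} [AddCommGroup V] [Module K V]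
variable (𝒱 : ℤ → Submodule K V) [DirectSum.Decomposition 𝒱]
variable {B : Type*} [Ring B] [Algebra K B]

/-- The convolution algebra of linear maps from the coalgebra `S(V)` to an algebra `B`. -/
abbrev Conv (B : Type*) [Ring B] [Algebra K B] := WithConv (SymAlg 𝒱 →ₗ[K] B)

variable {𝒱}

open WithConv

theorem conv_apply (f g : Conv 𝒱 B) (x : SymAlg 𝒱) :
    (f * g).ofConv x = LinearMap.mul' K B (TensorProduct.map f.ofConv g.ofConv (comulₗ 𝒱 x)) := rfl

theorem conv_apply_one (f g : Conv 𝒱 B) : (f * g).ofConv 1 = f.ofConv 1 * g.ofConv 1 := by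
  rw [conv_apply, comulₗ_one, TensorProduct.map_tmul, LinearMap.mul'_apply]

theorem convOne_apply (x : SymAlg 𝒱) :
    (1 : Conv 𝒱 B).ofConv x = algebraMap K B (counit 𝒱 x) := rfl

theorem conv_apply_ι_mul (f g : Conv 𝒱 B) {i : ℤ} {a : V} (ha : a ∈ 𝒱 i) (x : SymAlg 𝒱) :
    (f * g).ofConv (ι 𝒱 a * x) =
      (toConv (f.ofConv ∘ₗ LinearMap.mulLeft K (ι 𝒱 a)) * g).ofConv x +
        (toConv (f.ofConv ∘ₗ twist (gr 𝒱) i) *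
          toConv (g.ofConv ∘ₗ LinearMap.mulLeft K (ι 𝒱 a))).ofConv x := by
  simp only [conv_apply, comulₗ_ι_mul 𝒱 ha, map_add, TensorProduct.map_map, LinearMap.comp_id]

theorem mulLeft_comp_conv (b : B) (f g : Conv 𝒱 B) :
    toConv (LinearMap.mulLeft K b ∘ₗ f.ofConv) * g =
      toConv (LinearMap.mulLeft K b ∘ₗ (f * g).ofConv) := by
  ext x
  change LinearMap.mul' K B (TensorProduct.map (LinearMap.mulLeft K b ∘ₗ f.ofConv) g.ofConv
    (comulₗ 𝒱 x)) = b * LinearMap.mul' K B (TensorProduct.map f.ofConv g.ofConv (comulₗ 𝒱 x))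
  induction comulₗ 𝒱 x using TensorProduct.induction_on with
  | zero => simp
  | add s t hs ht => simp only [map_add, hs, ht, mul_add]
  | tmul x y => simp [mul_assoc]

/-- Two convolution products agree if they agree on homogeneous pairs. -/
theorem conv_congr {f g f' g' : SymAlg 𝒱 →ₗ[K] B}
    (h : ∀ (i j : ℤ) (x y : SymAlg 𝒱), x ∈ gr 𝒱 i → y ∈ gr 𝒱 j → f x * g y = f' x * g' y) :
    toConv f * toConv g = toConv f' * toConv g' := by
  ext x
  refine LinearMap.congr_fun (f := LinearMap.mul' K B ∘ₗ TensorProduct.map f g)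
    (g := LinearMap.mul' K B ∘ₗ TensorProduct.map f' g')
    (tensor_ext_homogeneous (gr 𝒱) fun i j x y hx hy => ?_) (comulₗ 𝒱 x)
  simpa using h i j x y hx hy

/-- Graded commutativity of the convolution product. -/
theorem conv_comm_of_swap {f g f' g' : SymAlg 𝒱 →ₗ[K] B}
    (h : ∀ (i j : ℤ) (x y : SymAlg 𝒱), x ∈ gr 𝒱 i → y ∈ gr 𝒱 j →
      f x * g y = ksign K (i * j) • (g' y * f' x)) :
    toConv f * toConv g = toConv g' * toConv f' := by
  ext x
  exact apply_comul_of_swap 𝒱 (f := LinearMap.mul' K B ∘ₗ TensorProduct.map f g)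
    (g := LinearMap.mul' K B ∘ₗ TensorProduct.map g' f')
    (fun i j x y hx hy => by simpa using h i j x y hx hy) x

/-! ### The projection to the generators -/

section Proj

omit [DirectSum.Decomposition 𝒱]

theorem proj_ι_mul (a : V) (x : SymAlg 𝒱) : proj 𝒱 (ι 𝒱 a * x) = counit 𝒱 x • a := by
  let _ : Module Kᵐᵒᵖ V := Module.compHom _ ((RingHom.id K).fromOpposite mul_comm)
  have : IsCentralScalar K V := ⟨fun _ _ => rfl⟩
  have hf : ∀ y : SymAlg 𝒱, (lift 𝒱 (TrivSqZeroExt.inrHom K V) (fun _ _ _ _ _ _ => by simp) y).fst =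
      counit 𝒱 y := fun y => by
    refine AlgHom.congr_fun (φ₁ := (TrivSqZeroExt.fstHom K K V).comp
      (lift 𝒱 (TrivSqZeroExt.inrHom K V) fun _ _ _ _ _ _ => by simp)) (hom_ext fun a => ?_) y
    rw [counit_ι]
    simp [lift_ι]
  change (lift 𝒱 (TrivSqZeroExt.inrHom K V) (fun _ _ _ _ _ _ => by simp) (ι 𝒱 a * x)).snd = _
  rw [map_mul, TrivSqZeroExt.snd_mul, hf, hf, lift_ι, counit_ι, zero_smul, zero_add]
  exact op_smul_eq_smul _ _

theorem proj_one : proj 𝒱 1 = 0 := by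
  let _ : Module Kᵐᵒᵖ V := Module.compHom _ ((RingHom.id K).fromOpposite mul_comm)
  have : IsCentralScalar K V := ⟨fun _ _ => rfl⟩
  change (lift 𝒱 (TrivSqZeroExt.inrHom K V) (fun _ _ _ _ _ _ => by simp) 1).snd = _
  simp

theorem proj_ι (a : V) : proj 𝒱 (ι 𝒱 a) = a := by
  simpa using proj_ι_mul a (1 : SymAlg 𝒱)

theorem proj_mem {n : ℤ} {x : SymAlg 𝒱} (hx : x ∈ gr 𝒱 n) : proj 𝒱 x ∈ 𝒱 n := by
  induction hx using Submodule.span_induction with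
  | zero => simp
  | add x y _ _ hx hy => rw [map_add]; exact add_mem hx hy
  | smul c x _ hx => rw [map_smul]; exact Submodule.smul_mem _ _ hx
  | mem x hx =>
    obtain ⟨l, hl, rfl, rfl⟩ := hx
    match l, hl with
    | [], _ => simp [proj_one]
    | [p], hl =>
      simpa [proj_ι] using hl p List.mem_cons_self
    | p :: q :: l, _ =>
      simp only [List.map_cons, List.prod_cons]
      rw [proj_ι_mul, counit_ι_mul, zero_smul]
      exact zero_mem _

end Proj

/-! ### Convolution powers of the projection -/

/-- Divided powers `x ^ n / n!`. -/
def dpow {C : Type*} [Ring C] [Algebra K C] (x : C) (n : ℕ) : C := (n.factorial : K)⁻¹ • x ^ n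

section Powers

variable (𝒱) in
/-- A linear map from the generators to an algebra, extended by zero to the other symmetric
powers. -/
def extendZero (r : V →ₗ[K] B) : Conv 𝒱 B := toConv (r ∘ₗ proj 𝒱)

variable {r : V →ₗ[K] B}
  (hr : ∀ (i j : ℤ) (a b : V), a ∈ 𝒱 i → b ∈ 𝒱 j → r a * r b = ksign K (i * j) • (r b * r a))

theorem extendZero_pow_one (k : ℕ) : (extendZero 𝒱 r ^ (k + 1)).ofConv 1 = 0 := by
  rw [pow_succ', conv_apply_one]
  simp [extendZero, proj_one]

include hr in
theorem extendZero_pow_ι_mul (k : ℕ) (a : V) (x : SymAlg 𝒱) :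
    (extendZero 𝒱 r ^ (k + 1)).ofConv (ι 𝒱 a * x) =
      (k + 1 : K) • (r a * (extendZero 𝒱 r ^ k).ofConv x) := by
  induction a using DirectSum.Decomposition.inductionOn 𝒱 with
  | zero => simp
  | add a b ha hb => simp only [map_add, add_mul, ha, hb, smul_add]
  | @homogeneous i a =>
    obtain ⟨a, ha⟩ := a
    dsimp only
    have h1 : toConv ((extendZero 𝒱 r).ofConv ∘ₗ LinearMap.mulLeft K (ι 𝒱 a)) =
        toConv (LinearMap.mulLeft K (r a) ∘ₗ (1 : Conv 𝒱 B).ofConv) := by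
      ext x
      change r (proj 𝒱 (ι 𝒱 a * x)) = r a * algebraMap K B (counit 𝒱 x)
      rw [proj_ι_mul, map_smul, ← Algebra.commutes, Algebra.smul_def]
    have h2 : ∀ g : Conv 𝒱 B, toConv ((extendZero 𝒱 r).ofConv ∘ₗ twist (gr 𝒱) i) *
        toConv (LinearMap.mulLeft K (r a) ∘ₗ g.ofConv) =
        toConv (LinearMap.mulLeft K (r a) ∘ₗ (extendZero 𝒱 r * g).ofConv) := by
      intro g
      rw [← mulLeft_comp_conv]
      refine conv_congr (g' := g.ofConv) fun m n x y hx hy => ?_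
      have := hr m i _ a (proj_mem hx) ha
      simp only [extendZero, LinearMap.comp_apply, ofConv_toConv, LinearMap.mulLeft_apply,
        twist_of_mem _ _ hx, map_smul, smul_mul_assoc]
      rw [← mul_assoc, this, smul_mul_assoc, smul_smul, mul_comm m i, ksign_mul_self, one_smul]
    induction k generalizing x with
    | zero =>
      rw [zero_add, pow_one, pow_zero]
      have := LinearMap.congr_fun (congrArg ofConv h1) x
      simpa using this
    | succ k ih =>
      have h3 : toConv ((extendZero 𝒱 r ^ (k + 1)).ofConv ∘ₗ LinearMap.mulLeft K (ι 𝒱 a)) =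
          (k + 1 : K) • toConv (LinearMap.mulLeft K (r a) ∘ₗ (extendZero 𝒱 r ^ k).ofConv) := by
        ext x
        exact ih x
      rw [pow_succ', conv_apply_ι_mul _ _ ha, h1, mulLeft_comp_conv, one_mul, h3, mul_smul_comm,
        h2, ← pow_succ']
      simp only [ofConv_smul, LinearMap.smul_apply, LinearMap.comp_apply,
        LinearMap.mulLeft_apply]
      push_cast
      module

theorem dpow_extendZero_one (k : ℕ) :
    (dpow (K := K) (extendZero 𝒱 r) (k + 1)).ofConv 1 = 0 := by
  simp [dpow, extendZero_pow_one]

theorem dpow_extendZero_zero_ι_mul (a : V) (x : SymAlg 𝒱) :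
    (dpow (K := K) (extendZero 𝒱 r) 0).ofConv (ι 𝒱 a * x) = 0 := by
  simp only [dpow, pow_zero, ofConv_smul, LinearMap.smul_apply, convOne_apply, counit_ι_mul]
  simp

variable [CharZero K]

include hr in
theorem dpow_extendZero_ι_mul (k : ℕ) (a : V) (x : SymAlg 𝒱) :
    (dpow (K := K) (extendZero 𝒱 r) (k + 1)).ofConv (ι 𝒱 a * x) =
      r a * (dpow (K := K) (extendZero 𝒱 r) k).ofConv x := by
  simp only [dpow, ofConv_smul, LinearMap.smul_apply, extendZero_pow_ι_mul hr, mul_smul_comm,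
    smul_smul, Nat.factorial_succ, Nat.cast_mul]
  congr 1
  have : (k + 1 : K) ≠ 0 := Nat.cast_add_one_ne_zero k
  have : (k.factorial : K) ≠ 0 := Nat.cast_ne_zero.2 k.factorial_ne_zero
  push_cast
  field_simp

variable (𝒱) in
/-- The product of a list of generators. -/
def mono (l : List V) : SymAlg 𝒱 := (l.map (ι 𝒱)).prod

omit [DirectSum.Decomposition 𝒱] [CharZero K] in
@[simp] theorem mono_nil : mono 𝒱 [] = 1 := rfl

omit [DirectSum.Decomposition 𝒱] [CharZero K] in
@[simp] theorem mono_cons (a : V) (l : List V) : mono 𝒱 (a :: l) = ι 𝒱 a * mono 𝒱 l := by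
  simp [mono]

include hr in
/-- The `k`-th divided convolution power of `r ∘ π` multiplies the images of the factors of a
product of `k` generators, and vanishes on the other symmetric powers. -/
theorem dpow_extendZero_mono (k : ℕ) (l : List V) :
    (dpow (K := K) (extendZero 𝒱 r) k).ofConv (mono 𝒱 l) =
      if l.length = k then (l.map r).prod else 0 := by
  induction l generalizing k with
  | nil =>
    cases k with
    | zero => simp [dpow, counit_eq]
    | succ k => simp [dpow_extendZero_one]
  | cons a l ih =>
    cases k with
    | zero => simp [dpow_extendZero_zero_ι_mul]
    | succ k =>
      rw [mono_cons, dpow_extendZero_ι_mul hr, ih]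
      by_cases h : l.length = k <;> simp [h]

end Powers

/-- A linear map that vanishes on the products of `n` homogeneous generators vanishes on the products
of `n` arbitrary ones. -/
theorem apply_mono_eq_zero {N : Type*} [AddCommGroup N] [Module K N] (f : SymAlg 𝒱 →ₗ[K] N) {n : ℕ}
    (h : ∀ l : List (ℤ × V), (∀ p ∈ l, p.2 ∈ 𝒱 p.1) → l.length = n →
      f (mono 𝒱 (l.map Prod.snd)) = 0) {l : List V} (hl : l.length = n) : f (mono 𝒱 l) = 0 := by
  induction n generalizing f l with
  | zero =>
    obtain rfl := List.length_eq_zero_iff.1 hl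
    exact h [] (by simp) rfl
  | succ n ih =>
    match l, hl with
    | a :: l, hl =>
      rw [mono_cons]
      induction a using DirectSum.Decomposition.inductionOn 𝒱 with
      | zero => simp
      | add a b ha hb =>
        rw [map_add, add_mul, map_add, ha (by simpa using hl), hb (by simpa using hl), add_zero]
      | @homogeneous i a =>
        refine ih (f ∘ₗ LinearMap.mulLeft K (ι 𝒱 (a : V))) (fun l' hl' hn => ?_) (by simpa using hl)
        refine (congrArg f (mono_cons _ _)).symm.trans (h ((i, (a : V)) :: l') ?_ (by simp [hn]))
        intro p hp
        rcases List.mem_cons.1 hp with rfl | hp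
        exacts [a.2, hl' p hp]

variable (𝒱) in
theorem span_mono_eq_top : Submodule.span K (Set.range (mono 𝒱)) = ⊤ := by
  refine eq_top_iff.2 fun x _ => induction
    (P := fun x => x ∈ Submodule.span K (Set.range (mono 𝒱))) (Submodule.subset_span ⟨[], rfl⟩)
    (fun x y hx hy => add_mem hx hy) (fun c x hx => Submodule.smul_mem _ c hx)
    (fun i a _ x hx => ?_) x
  induction hx using Submodule.span_induction with
  | zero => simp
  | add x y _ _ hx hy => rw [mul_add]; exact add_mem hx hy
  | smul c x _ hx => rw [mul_smul_comm]; exact Submodule.smul_mem _ _ hx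
  | mem x hx =>
    obtain ⟨l, rfl⟩ := hx
    exact Submodule.subset_span ⟨a :: l, mono_cons a l⟩

theorem linearMap_ext_mono {N : Type*} [AddCommGroup N] [Module K N] {f g : SymAlg 𝒱 →ₗ[K] N}
    (h : ∀ l, f (mono 𝒱 l) = g (mono 𝒱 l)) : f = g :=
  LinearMap.ext_on_range (span_mono_eq_top 𝒱) h

/-! ### Power series in a locally nilpotent element -/

section PowerSeries

open PowerSeries

/-- The convolution powers of `F` are locally finite. -/
def LocNilp (F : Conv 𝒱 B) : Prop := LocFin fun n => (F ^ n).ofConv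

/-- The substitution of a locally nilpotent `F` in a power series `f`. -/
def psum (F : Conv 𝒱 B) (hF : LocNilp F) (f : K⟦X⟧) : Conv 𝒱 B :=
  toConv (lsum (fun n => coeff n f • (F ^ n).ofConv) (hF.smul _))

theorem lsum_conv_lsum {T T' U : ℕ → SymAlg 𝒱 →ₗ[K] B} (hT : LocFin T) (hT' : LocFin T')
    (hU : LocFin U)
    (h : ∀ n, U n = ∑ p ∈ Finset.HasAntidiagonal.antidiagonal n,
      (toConv (T p.1) * toConv (T' p.2)).ofConv) :
    toConv (lsum T hT) * toConv (lsum T' hT') = toConv (lsum U hU) := by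
  ext x
  obtain ⟨n, hn⟩ := map_lsum_lsum hT hT' (comulₗ 𝒱 x)
  have hU' : ∀ k, U k x = LinearMap.mul' K B (∑ p ∈ Finset.HasAntidiagonal.antidiagonal k,
      TensorProduct.map (T p.1) (T' p.2) (comulₗ 𝒱 x)) := fun k => by
    rw [h, LinearMap.sum_apply, map_sum]
    rfl
  change LinearMap.mul' K B (TensorProduct.map (lsum T hT) (lsum T' hT') (comulₗ 𝒱 x)) = lsum U hU x
  rw [lsum_apply hU (n := n) fun k hk => by rw [hU', (hn k hk).1, map_zero], (hn n le_rfl).2,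
    map_sum]
  exact Finset.sum_congr rfl fun k _ => (hU' k).symm

theorem psum_mul (F : Conv 𝒱 B) (hF : LocNilp F) (f g : K⟦X⟧) :
    psum F hF (f * g) = psum F hF f * psum F hF g := by
  refine (lsum_conv_lsum _ _ _ fun n => ?_).symm
  rw [coeff_mul, Finset.sum_smul]
  refine Finset.sum_congr rfl fun p hp => ?_
  have : F ^ n = F ^ p.1 * F ^ p.2 := by
    rw [← pow_add, Finset.HasAntidiagonal.mem_antidiagonal.1 hp]
  rw [this, mul_smul]
  change _ = ((coeff p.1 f • F ^ p.1) * (coeff p.2 g • F ^ p.2)).ofConv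
  rw [smul_mul_smul_comm, ← smul_smul]
  rfl

theorem psum_apply_eq_sum (F : Conv 𝒱 B) (hF : LocNilp F) (f : K⟦X⟧) {x : SymAlg 𝒱} {n : ℕ}
    (hn : ∀ k, n ≤ k → (F ^ k).ofConv x = 0) :
    (psum F hF f).ofConv x = ∑ k ∈ Finset.range n, coeff k f • (F ^ k).ofConv x :=
  lsum_apply (hF.smul fun k => coeff k f) fun k hk => by
    simp only [LinearMap.smul_apply, hn k hk, smul_zero]

theorem psum_one (F : Conv 𝒱 B) (hF : LocNilp F) : psum F hF 1 = 1 := by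
  ext x
  refine (lsum_apply_eq_of_forall_ne (hF.smul fun k => coeff k 1) 0 fun k hk => ?_).trans ?_
  · simp [coeff_one, hk]
  · simp

end PowerSeries

/-! ### The convolution exponential -/

section Exp

variable [CharZero K]

theorem dpow_add_of_commute {C : Type*} [Ring C] [Algebra K C] {x y : C} (h : Commute x y) (n : ℕ) :
    dpow (K := K) (x + y) n =
      ∑ p ∈ Finset.HasAntidiagonal.antidiagonal n, dpow (K := K) x p.1 * dpow (K := K) y p.2 := by
  rw [dpow, h.add_pow', Finset.smul_sum]
  refine Finset.sum_congr rfl fun p hp => ?_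
  obtain rfl := Finset.HasAntidiagonal.mem_antidiagonal.1 hp
  rw [dpow, dpow, smul_mul_smul_comm, ← Nat.cast_smul_eq_nsmul K, smul_smul]
  congr 1
  have h0 : ∀ m : ℕ, (m.factorial : K) ≠ 0 := fun m => Nat.cast_ne_zero.2 m.factorial_ne_zero
  rw [Nat.cast_add_choose K]
  have := h0 p.1
  have := h0 p.2
  have := h0 (p.1 + p.2)
  field_simp

omit [CharZero K] in
theorem LocNilp.dpow {F : Conv 𝒱 B} (hF : LocNilp F) :
    LocFin fun n => (dpow (K := K) F n).ofConv :=
  hF.smul fun n => (n.factorial : K)⁻¹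

/-- The convolution exponential of a locally nilpotent `F`. -/
def convExp (F : Conv 𝒱 B) (hF : LocNilp F) : Conv 𝒱 B := toConv (lsum _ hF.dpow)

theorem convExp_add {F G : Conv 𝒱 B} (hF : LocNilp F) (hG : LocNilp G) (hFG : LocNilp (F + G))
    (h : Commute F G) : convExp (F + G) hFG = convExp F hF * convExp G hG :=
  (lsum_conv_lsum _ _ _ fun n => by
    rw [dpow_add_of_commute h, ofConv_sum]).symm

end Exp

end SymAlg

namespace SymAlg

variable {K : Type u} [Field K] {V : Type v} [AddCommGroup V] [Module K V]
variable (𝒱 : ℤ → Submodule K V)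

open WithConv

/-! ### Gradings of the symmetric coalgebra -/

section Weight

variable {I : Type*} [AddCommMonoid I] (w : ℤ → I)

/-- The span of the products of homogeneous generators whose weights sum up to `n`, where a
generator of degree `i` has weight `w i`. The total degree is the case `w = id`, the number of
factors is the case `w = 1`. -/
def wgr (n : I) : Submodule K (SymAlg 𝒱) :=
  Submodule.span K {x | ∃ l : List (ℤ × V), (∀ p ∈ l, p.2 ∈ 𝒱 p.1) ∧
    (l.map fun p => w p.1).sum = n ∧ (l.map fun p => ι 𝒱 p.2).prod = x}

theorem one_mem_wgr : (1 : SymAlg 𝒱) ∈ wgr 𝒱 w 0 :=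
  Submodule.subset_span ⟨[], by simp, by simp, by simp⟩

theorem ι_mul_mem_wgr {i : ℤ} {a : V} (ha : a ∈ 𝒱 i) {n : I} {x : SymAlg 𝒱}
    (hx : x ∈ wgr 𝒱 w n) : ι 𝒱 a * x ∈ wgr 𝒱 w (w i + n) := by
  induction hx using Submodule.span_induction with
  | zero => simp
  | add x y _ _ hx hy => rw [mul_add]; exact add_mem hx hy
  | smul c x _ hx => rw [mul_smul_comm]; exact Submodule.smul_mem _ _ hx
  | mem x hx =>
    obtain ⟨l, hl, rfl, rfl⟩ := hx
    refine Submodule.subset_span ⟨(i, a) :: l, ?_, by simp, by simp⟩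
    intro p hp
    rcases List.mem_cons.1 hp with rfl | hp
    exacts [ha, hl p hp]

theorem mul_mem_wgr {m n : I} {x y : SymAlg 𝒱} (hx : x ∈ wgr 𝒱 w m) (hy : y ∈ wgr 𝒱 w n) :
    x * y ∈ wgr 𝒱 w (m + n) := by
  induction hx using Submodule.span_induction with
  | zero => simp
  | add x y _ _ hx hy => rw [add_mul]; exact add_mem hx hy
  | smul c x _ hx => rw [smul_mul_assoc]; exact Submodule.smul_mem _ _ hx
  | mem x hx =>
    obtain ⟨l, hl, rfl, rfl⟩ := hx
    induction l with
    | nil => simpa using hy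
    | cons p l ih =>
      simp only [List.map_cons, List.sum_cons, List.prod_cons]
      rw [mul_assoc, add_assoc]
      exact ι_mul_mem_wgr 𝒱 w (hl p List.mem_cons_self)
        (ih fun q hq => hl q (List.mem_cons_of_mem _ hq))

theorem iSup_wgr_eq_top [DirectSum.Decomposition 𝒱] : ⨆ n, wgr 𝒱 w n = ⊤ := by
  refine eq_top_iff.2 fun x _ => induction (P := fun x => x ∈ ⨆ n, wgr 𝒱 w n)
    (Submodule.mem_iSup_of_mem 0 (one_mem_wgr 𝒱 w)) (fun x y hx hy => add_mem hx hy)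
    (fun c x hx => Submodule.smul_mem _ c hx) (fun i a ha x hx => ?_) x
  induction hx using Submodule.iSup_induction' with
  | mem n x hx => exact Submodule.mem_iSup_of_mem _ (ι_mul_mem_wgr 𝒱 w ha hx)
  | zero => simp
  | add x y _ _ hx hy => rw [mul_add]; exact add_mem hx hy

variable [DirectSum.Decomposition 𝒱]

theorem twist_mem_wgr (m : ℤ) {n : I} {x : SymAlg 𝒱} (hx : x ∈ wgr 𝒱 w n) :
    twist (gr 𝒱) m x ∈ wgr 𝒱 w n := by
  induction hx using Submodule.span_induction with
  | zero => simp
  | add x y _ _ hx hy => rw [map_add]; exact add_mem hx hy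
  | smul c x _ hx => rw [map_smul]; exact Submodule.smul_mem _ _ hx
  | mem x hx =>
    obtain ⟨l, hl, rfl, rfl⟩ := hx
    have : (l.map fun p => ι 𝒱 p.2).prod ∈ gr 𝒱 (l.map Prod.fst).sum :=
      Submodule.subset_span ⟨l, hl, rfl, rfl⟩
    rw [twist_of_mem _ _ this]
    exact Submodule.smul_mem _ _ (Submodule.subset_span ⟨l, hl, rfl, rfl⟩)

/-- The coproduct is compatible with every grading that comes from a weight of the generators. -/
theorem comulₗ_mem_wgr {n : I} {x : SymAlg 𝒱} (hx : x ∈ wgr 𝒱 w n) :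
    comulₗ 𝒱 x ∈ Submodule.span K {t | ∃ i j : I, i + j = n ∧ ∃ y ∈ wgr 𝒱 w i,
      ∃ z ∈ wgr 𝒱 w j, y ⊗ₜ[K] z = t} := by
  induction hx using Submodule.span_induction with
  | zero => simp
  | add x y _ _ hx hy => rw [map_add]; exact add_mem hx hy
  | smul c x _ hx => rw [map_smul]; exact Submodule.smul_mem _ _ hx
  | mem x hx =>
    obtain ⟨l, hl, rfl, rfl⟩ := hx
    induction l with
    | nil =>
      refine Submodule.subset_span ⟨0, 0, by simp, 1, one_mem_wgr 𝒱 w, 1, one_mem_wgr 𝒱 w, ?_⟩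
      simp [comulₗ_one]
    | cons p l ih =>
      have hp := hl p List.mem_cons_self
      have ih := ih fun q hq => hl q (List.mem_cons_of_mem _ hq)
      simp only [List.map_cons, List.sum_cons, List.prod_cons]
      rw [comulₗ_ι_mul 𝒱 hp]
      revert ih
      generalize comulₗ 𝒱 (l.map fun p => ι 𝒱 p.2).prod = t
      intro ih
      refine add_mem ?_ ?_
      · induction ih using Submodule.span_induction with
        | zero => simp
        | add x y _ _ hx hy => rw [map_add]; exact add_mem hx hy
        | smul c x _ hx => rw [map_smul]; exact Submodule.smul_mem _ _ hx
        | mem t ht =>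
          obtain ⟨i, j, hij, y, hy, z, hz, rfl⟩ := ht
          exact Submodule.subset_span ⟨w p.1 + i, j, by rw [add_assoc, hij], _,
            ι_mul_mem_wgr 𝒱 w hp hy, z, hz, rfl⟩
      · induction ih using Submodule.span_induction with
        | zero => simp
        | add x y _ _ hx hy => rw [map_add]; exact add_mem hx hy
        | smul c x _ hx => rw [map_smul]; exact Submodule.smul_mem _ _ hx
        | mem t ht =>
          obtain ⟨i, j, hij, y, hy, z, hz, rfl⟩ := ht
          exact Submodule.subset_span ⟨i, w p.1 + j, by rw [add_left_comm, hij], _,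
            twist_mem_wgr 𝒱 w p.1 hy, _, ι_mul_mem_wgr 𝒱 w hp hz, rfl⟩

variable {𝒱 w} in
/-- The value of a convolution product on a homogeneous element lies in any subspace that
contains the products of the values on homogeneous elements of complementary weights. -/
theorem conv_mem {B : Type*} [Ring B] [Algebra K B] (P : Submodule K B) {f g : Conv 𝒱 B} {n : I}
    (h : ∀ i j : I, i + j = n → ∀ y ∈ wgr 𝒱 w i, ∀ z ∈ wgr 𝒱 w j, f.ofConv y * g.ofConv z ∈ P)
    {x : SymAlg 𝒱} (hx : x ∈ wgr 𝒱 w n) : (f * g).ofConv x ∈ P := by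
  rw [conv_apply]
  have ht := comulₗ_mem_wgr 𝒱 w hx
  revert ht
  generalize comulₗ 𝒱 x = t
  intro ht
  induction ht using Submodule.span_induction with
  | zero => simp
  | add x y _ _ hx hy => rw [map_add, map_add]; exact add_mem hx hy
  | smul c x _ hx => rw [map_smul, map_smul]; exact Submodule.smul_mem _ _ hx
  | mem t ht =>
    obtain ⟨i, j, hij, y, hy, z, hz, rfl⟩ := ht
    simpa using h i j hij y hy z hz

end Weight

/-- The symmetric power `S^n V`. -/
abbrev symPow (n : ℕ) : Submodule K (SymAlg 𝒱) := wgr 𝒱 (fun _ => 1) n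

variable {𝒱}

theorem mem_symPow_zero {x : SymAlg 𝒱} (hx : x ∈ symPow 𝒱 0) : ∃ c : K, x = c • 1 := by
  induction hx using Submodule.span_induction with
  | zero => exact ⟨0, by simp⟩
  | add x y _ _ hx hy =>
    obtain ⟨⟨c, rfl⟩, d, rfl⟩ := And.intro hx hy
    exact ⟨c + d, by rw [add_smul]⟩
  | smul c x _ hx =>
    obtain ⟨d, rfl⟩ := hx
    exact ⟨c * d, by rw [mul_smul]⟩
  | mem x hx =>
    obtain ⟨l, hl, hn, rfl⟩ := hx
    obtain rfl : l = [] := by simpa using hn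
    exact ⟨1, by simp⟩

theorem apply_eq_of_mem_symPow {N : Type*} [AddCommGroup N] [Module K N]
    {f g : SymAlg 𝒱 →ₗ[K] N} {n : ℕ} (h : ∀ l : List V, l.length = n → f (mono 𝒱 l) = g (mono 𝒱 l))
    {x : SymAlg 𝒱} (hx : x ∈ symPow 𝒱 n) : f x = g x := by
  induction hx using Submodule.span_induction with
  | zero => simp
  | add x y _ _ hx hy => rw [map_add, map_add, hx, hy]
  | smul c x _ hx => rw [map_smul, map_smul, hx]
  | mem x hx =>
    obtain ⟨l, -, hn, rfl⟩ := hx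
    simpa [mono, Function.comp_def] using h (l.map Prod.snd) (by simpa using hn)

variable [DirectSum.Decomposition 𝒱]

theorem ι_mem_symPow (a : V) : ι 𝒱 a ∈ symPow 𝒱 1 := by
  induction a using DirectSum.Decomposition.inductionOn 𝒱 with
  | zero => simp
  | add a b ha hb => rw [map_add]; exact add_mem ha hb
  | homogeneous a =>
    simpa using ι_mul_mem_wgr 𝒱 (fun _ => 1) a.2 (one_mem_wgr 𝒱 fun _ => 1)

variable {B : Type*} [Ring B] [Algebra K B]

theorem pow_apply_eq_zero {F : Conv 𝒱 B} (hF : F.ofConv 1 = 0) {m n : ℕ} (hmn : m < n)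
    {x : SymAlg 𝒱} (hx : x ∈ symPow 𝒱 m) : (F ^ n).ofConv x = 0 := by
  induction n generalizing m x with
  | zero => omega
  | succ n ih =>
    rw [pow_succ', ← Submodule.mem_bot (R := K)]
    refine conv_mem ⊥ (fun i j hij y hy z hz => ?_) hx
    rw [Submodule.mem_bot]
    rcases Nat.eq_zero_or_pos i with rfl | hi
    · obtain ⟨c, rfl⟩ := mem_symPow_zero hy
      rw [map_smul, hF, smul_zero, zero_mul]
    · rw [ih (by omega) hz, mul_zero]

/-- Conilpotency: a map that vanishes at `1` is locally nilpotent for the convolution product. -/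
theorem locNilp {F : Conv 𝒱 B} (hF : F.ofConv 1 = 0) : LocNilp F := by
  intro x
  have hx : x ∈ ⨆ n, symPow 𝒱 n := by
    rw [iSup_wgr_eq_top]
    trivial
  induction hx using Submodule.iSup_induction' with
  | mem n x hx => exact ⟨n + 1, fun k hk => pow_apply_eq_zero hF (by omega) hx⟩
  | zero => exact ⟨0, fun k _ => map_zero _⟩
  | add x y _ _ hx hy =>
    obtain ⟨m, hm⟩ := hx
    obtain ⟨n, hn⟩ := hy
    refine ⟨max m n, fun k hk => ?_⟩
    have h1 := hm k (le_of_max_le_left hk)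
    have h2 := hn k (le_of_max_le_right hk)
    simp only at h1 h2
    simp only [map_add, h1, h2, add_zero]

/-- On `S^n V`, the `n`-th convolution power only depends on the linear part. -/
theorem pow_apply_congr {F G : Conv 𝒱 B} (hF : F.ofConv 1 = 0) (hG : G.ofConv 1 = 0)
    (hFG : ∀ a, F.ofConv (ι 𝒱 a) = G.ofConv (ι 𝒱 a)) (n : ℕ) {x : SymAlg 𝒱}
    (hx : x ∈ symPow 𝒱 n) : (F ^ n).ofConv x = (G ^ n).ofConv x := by
  induction n generalizing x with
  | zero => rfl
  | succ n ih =>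
    have key : ((F * F ^ n) - G * G ^ n).ofConv x ∈ (⊥ : Submodule K B) := by
      have : F * F ^ n - G * G ^ n = F * (F ^ n - G ^ n) + (F - G) * G ^ n := by
        rw [mul_sub, sub_mul]; abel
      rw [this]
      refine add_mem (conv_mem ⊥ (fun i j hij y hy z hz => ?_) hx)
        (conv_mem ⊥ (fun i j hij y hy z hz => ?_) hx)
      · rw [Submodule.mem_bot]
        rcases Nat.eq_zero_or_pos i with rfl | hi
        · obtain ⟨c, rfl⟩ := mem_symPow_zero hy
          rw [map_smul, hF, smul_zero, zero_mul]
        · rw [ofConv_sub, LinearMap.sub_apply]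
          rcases (show j ≤ n by omega).eq_or_lt with rfl | hj
          · rw [ih hz, sub_self, mul_zero]
          · rw [pow_apply_eq_zero hF hj hz, pow_apply_eq_zero hG hj hz, sub_self, mul_zero]
      · rw [Submodule.mem_bot, ofConv_sub, LinearMap.sub_apply]
        rcases Nat.lt_or_ge j n with hj | hj
        · rw [pow_apply_eq_zero hG hj hz, mul_zero]
        rcases Nat.eq_zero_or_pos i with rfl | hi
        · obtain ⟨c, rfl⟩ := mem_symPow_zero hy
          rw [map_smul, map_smul, hF, hG, sub_self, zero_mul]
        · obtain rfl : i = 1 := by omega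
          have : F.ofConv y = G.ofConv y := apply_eq_of_mem_symPow (fun l hl => by
            obtain ⟨a, rfl⟩ := List.length_eq_one_iff.1 hl
            simpa using hFG a) hy
          rw [this, sub_self, zero_mul]
    rw [pow_succ', pow_succ']
    rw [Submodule.mem_bot, ofConv_sub, LinearMap.sub_apply, sub_eq_zero] at key
    exact key

/-! ### Functoriality of the convolution algebra -/

section Functoriality

variable {B' : Type*} [Ring B'] [Algebra K B']

theorem algHom_comp_pow (h : B →ₐ[K] B') (F : Conv 𝒱 B) (n : ℕ) :
    h.toLinearMap ∘ₗ (F ^ n).ofConv = (toConv (h.toLinearMap ∘ₗ F.ofConv) ^ n).ofConv := by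
  induction n with
  | zero => ext x; simp
  | succ n ih =>
    rw [pow_succ, pow_succ, LinearMap.algHom_comp_convMul_distrib, ih]

theorem LocNilp.algHom_comp {F : Conv 𝒱 B} (hF : LocNilp F) (h : B →ₐ[K] B') :
    LocNilp (toConv (h.toLinearMap ∘ₗ F.ofConv)) := by
  intro x
  obtain ⟨n, hn⟩ := hF x
  exact ⟨n, fun k hk => by
    have := hn k hk
    simp only at this
    simp only [← algHom_comp_pow, LinearMap.comp_apply, this, map_zero]⟩

variable [CharZero K]

omit [CharZero K] in
theorem algHom_comp_convExp (h : B →ₐ[K] B') {F : Conv 𝒱 B} (hF : LocNilp F) :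
    h.toLinearMap ∘ₗ (convExp F hF).ofConv =
      (convExp (toConv (h.toLinearMap ∘ₗ F.ofConv)) (hF.algHom_comp h)).ofConv := by
  refine (comp_lsum hF.dpow _).trans (lsum_congr (hT' := (hF.algHom_comp h).dpow) fun k => ?_)
  simp only [SymAlg.dpow, ofConv_smul, LinearMap.comp_smul, algHom_comp_pow]

/-- A coalgebra endomorphism of `S(V)`. -/
structure IsCoalgHom (Ψ : SymAlg 𝒱 →ₗ[K] SymAlg 𝒱) : Prop where
  comul_apply : ∀ x, comulₗ 𝒱 (Ψ x) = TensorProduct.map Ψ Ψ (comulₗ 𝒱 x)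
  counit_apply : ∀ x, counit 𝒱 (Ψ x) = counit 𝒱 x

omit [CharZero K] in
theorem IsCoalgHom.pow_comp {Ψ : SymAlg 𝒱 →ₗ[K] SymAlg 𝒱} (hΨ : IsCoalgHom Ψ) (F : Conv 𝒱 B)
    (n : ℕ) : (F ^ n).ofConv ∘ₗ Ψ = (toConv (F.ofConv ∘ₗ Ψ) ^ n).ofConv := by
  induction n with
  | zero =>
    ext x
    exact congrArg _ (hΨ.counit_apply x)
  | succ n ih =>
    ext x
    rw [pow_succ, pow_succ, LinearMap.comp_apply, conv_apply, conv_apply, hΨ.comul_apply,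
      TensorProduct.map_map, ih]

/-- `S(V)` decomposes into the symmetric powers, and the projections are the divided convolution
powers of the projection to the generators. -/
theorem lsum_dpow_extendZero_ι (h : LocNilp (extendZero 𝒱 (ι 𝒱))) :
    lsum _ h.dpow = LinearMap.id :=
  linearMap_ext_mono fun l => by
    rw [lsum_apply_eq_of_forall_ne h.dpow l.length fun k hk => ?_]
    · rw [dpow_extendZero_mono fun _ _ _ _ ha hb => ι_swap 𝒱 ha hb, if_pos rfl]
      rfl
    · rw [dpow_extendZero_mono fun _ _ _ _ ha hb => ι_swap 𝒱 ha hb, if_neg (Ne.symm hk)]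

omit [DirectSum.Decomposition 𝒱] [CharZero K] in
theorem extendZero_apply_one (r : V →ₗ[K] B) : (extendZero 𝒱 r).ofConv 1 = 0 := by
  simp [extendZero, proj_one]

/-- Coalgebra endomorphisms of `S(V)` are determined by their projections to the generators. -/
theorem IsCoalgHom.ext {Ψ Ψ' : SymAlg 𝒱 →ₗ[K] SymAlg 𝒱} (hΨ : IsCoalgHom Ψ)
    (hΨ' : IsCoalgHom Ψ') (h : proj 𝒱 ∘ₗ Ψ = proj 𝒱 ∘ₗ Ψ') : Ψ = Ψ' := by
  have hE : LocNilp (extendZero 𝒱 (ι 𝒱)) := locNilp (extendZero_apply_one _)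
  rw [← LinearMap.id_comp Ψ, ← LinearMap.id_comp Ψ', ← lsum_dpow_extendZero_ι hE, lsum_comp,
    lsum_comp]
  refine lsum_congr fun k => ?_
  simp only [dpow, ofConv_smul, LinearMap.smul_comp, hΨ.pow_comp, hΨ'.pow_comp]
  simp only [extendZero, LinearMap.comp_assoc, h]

end Functoriality

/-! ### Coalgebra endomorphisms with prescribed projection to the generators -/

section CoalgHom

variable (f : SymAlg 𝒱 →ₗ[K] V) (h1 : f 1 = 0)

variable (h0 : ∀ (i : ℤ) (x : SymAlg 𝒱), x ∈ gr 𝒱 i → f x ∈ 𝒱 i)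

include h1 in
theorem locNilp_ι_comp : LocNilp (toConv (ι 𝒱 ∘ₗ f)) :=
  locNilp (by simp [h1])

/-- The coalgebra endomorphism of `S(V)` whose projection to the generators is `f`: the convolution
exponential of `f`. -/
def expHom : SymAlg 𝒱 →ₗ[K] SymAlg 𝒱 := (convExp (toConv (ι 𝒱 ∘ₗ f)) (locNilp_ι_comp f h1)).ofConv

theorem counit_comp_ι_comp :
    toConv ((counit 𝒱).toLinearMap ∘ₗ (toConv (ι 𝒱 ∘ₗ f)).ofConv) = 0 := by
  ext x
  exact counit_ι 𝒱 (f x)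

theorem counit_expHom (x : SymAlg 𝒱) : counit 𝒱 (expHom f h1 x) = counit 𝒱 x := by
  refine (LinearMap.congr_fun (algHom_comp_convExp (counit 𝒱) (locNilp_ι_comp f h1)) x).trans ?_
  refine (lsum_apply_eq_of_forall_ne
    ((locNilp_ι_comp f h1).algHom_comp (counit 𝒱)).dpow 0 fun k hk => ?_).trans ?_
  · rw [counit_comp_ι_comp]
    simp [dpow, zero_pow hk]
  · simp only [dpow, pow_zero, ofConv_smul, LinearMap.smul_apply, convOne_apply]
    simp

theorem proj_expHom (x : SymAlg 𝒱) : proj 𝒱 (expHom f h1 x) = f x := by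
  refine (LinearMap.congr_fun (comp_lsum (locNilp_ι_comp f h1).dpow (proj 𝒱)) x).trans ?_
  rw [lsum_apply_eq_of_forall_ne _ 1 fun k hk => ?_]
  · simp [dpow, proj_ι]
  · simp only [LinearMap.comp_apply, dpow, ofConv_smul, LinearMap.smul_apply, map_smul]
    match k, hk with
    | 0, _ =>
      rw [pow_zero, convOne_apply, Algebra.algebraMap_eq_smul_one, map_smul, proj_one, smul_zero,
        smul_zero]
    | k + 2, _ =>
      have hc : ∀ y, counit 𝒱 ((toConv (ι 𝒱 ∘ₗ f) ^ (k + 1)).ofConv y) = 0 := fun y => by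
        refine (LinearMap.congr_fun (algHom_comp_pow (counit 𝒱) _ (k + 1)) y).trans ?_
        rw [counit_comp_ι_comp, zero_pow (Nat.succ_ne_zero k)]
        rfl
      rw [pow_succ', conv_apply]
      have : proj 𝒱 ∘ₗ LinearMap.mul' K (SymAlg 𝒱) ∘ₗ TensorProduct.map
          (toConv (ι 𝒱 ∘ₗ f)).ofConv (toConv (ι 𝒱 ∘ₗ f) ^ (k + 1)).ofConv = 0 :=
        TensorProduct.ext' fun y z => by simp [proj_ι_mul, hc]
      rw [show proj 𝒱 (LinearMap.mul' K (SymAlg 𝒱) _) = 0 from LinearMap.congr_fun this _,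
        smul_zero]

include h0 in
theorem includeLeft_ι_comp_swap (i j : ℤ) (x y : SymAlg 𝒱) (hx : x ∈ gr 𝒱 i) (hy : y ∈ gr 𝒱 j) :
    GradedTensorProduct.includeLeft (gr 𝒱) (gr 𝒱) (ι 𝒱 (f x)) *
      GradedTensorProduct.includeRight (gr 𝒱) (gr 𝒱) (ι 𝒱 (f y)) =
    ksign K (i * j) • (GradedTensorProduct.includeRight (gr 𝒱) (gr 𝒱) (ι 𝒱 (f y)) *
      GradedTensorProduct.includeLeft (gr 𝒱) (gr 𝒱) (ι 𝒱 (f x))) := by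
  have h := GradedTensorProduct.tmul_coe_mul_coe_tmul (R := K) (gr 𝒱) (gr 𝒱) 1
    (⟨ι 𝒱 (f y), ι_mem_gr 𝒱 (h0 j y hy)⟩ : gr 𝒱 j)
    (⟨ι 𝒱 (f x), ι_mem_gr 𝒱 (h0 i x hx)⟩ : gr 𝒱 i) 1
  have h' := GradedTensorProduct.tmul_one_mul_one_tmul (R := K) (gr 𝒱) (gr 𝒱)
    (ι 𝒱 (f x)) (ι 𝒱 (f y))
  simp only [one_mul, mul_one] at h
  rw [GradedTensorProduct.includeRight_apply, GradedTensorProduct.includeLeft_apply, h, h',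
    units_smul_eq_ksign (K := K), smul_smul, mul_comm j i, ksign_mul_self, one_smul]

variable [CharZero K]

include h0 in
/-- Since the coproduct is an algebra map and `f` takes primitive values, the coproduct maps the
convolution exponential of `f` to `exp (f ⊗ 1 + 1 ⊗ f) = exp (f ⊗ 1) * exp (1 ⊗ f)`. -/
theorem isCoalgHom_expHom : IsCoalgHom (expHom f h1) := by
  refine ⟨fun x => ?_, counit_expHom f h1⟩
  have hF := locNilp_ι_comp f h1
  have hadd : toConv ((coprod 𝒱).toLinearMap ∘ₗ (toConv (ι 𝒱 ∘ₗ f)).ofConv) =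
      toConv ((GradedTensorProduct.includeLeft (gr 𝒱) (gr 𝒱)).toLinearMap ∘ₗ
        (toConv (ι 𝒱 ∘ₗ f)).ofConv) +
      toConv ((GradedTensorProduct.includeRight (gr 𝒱) (gr 𝒱)).toLinearMap ∘ₗ
        (toConv (ι 𝒱 ∘ₗ f)).ofConv) := by
    ext x
    exact lift_ι 𝒱 (coprodι 𝒱) (coprodι_swap 𝒱) (f x)
  have hcomm : Commute
      (toConv ((GradedTensorProduct.includeLeft (gr 𝒱) (gr 𝒱)).toLinearMap ∘ₗ
        (toConv (ι 𝒱 ∘ₗ f)).ofConv))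
      (toConv ((GradedTensorProduct.includeRight (gr 𝒱) (gr 𝒱)).toLinearMap ∘ₗ
        (toConv (ι 𝒱 ∘ₗ f)).ofConv)) :=
    conv_comm_of_swap fun i j x y hx hy => includeLeft_ι_comp_swap f h0 i j x y hx hy
  have key := algHom_comp_convExp (coprod 𝒱) hF
  have hsum := hF.algHom_comp (coprod 𝒱)
  rw [hadd] at hsum
  have key2 : coprod 𝒱 (expHom f h1 x) = (convExp _ hsum).ofConv x := by
    refine (LinearMap.congr_fun key x).trans ?_
    simp only [hadd]
  rw [convExp_add (hF.algHom_comp _) (hF.algHom_comp _) hsum hcomm] at key2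
  refine (congrArg (GradedTensorProduct.of K (gr 𝒱) (gr 𝒱)).symm key2).trans ?_
  have hL := algHom_comp_convExp (GradedTensorProduct.includeLeft (gr 𝒱) (gr 𝒱)) hF
  have hR := algHom_comp_convExp (GradedTensorProduct.includeRight (gr 𝒱) (gr 𝒱)) hF
  rw [conv_apply, ← hL, ← hR]
  generalize comulₗ 𝒱 x = t
  induction t using TensorProduct.induction_on with
  | zero => simp
  | add s t hs ht => simp only [map_add, hs, ht]
  | tmul y z =>
    exact congrArg (GradedTensorProduct.of K (gr 𝒱) (gr 𝒱)).symm
      (GradedTensorProduct.tmul_one_mul_one_tmul (R := K) (gr 𝒱) (gr 𝒱) _ _)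

omit [CharZero K] in
include h0 in
theorem pow_ι_comp_mem_gr (n : ℕ) {i : ℤ} {x : SymAlg 𝒱} (hx : x ∈ gr 𝒱 i) :
    (toConv (ι 𝒱 ∘ₗ f) ^ n).ofConv x ∈ gr 𝒱 i := by
  induction n generalizing i x with
  | zero =>
    rw [pow_zero]
    rw [convOne_apply, Algebra.algebraMap_eq_smul_one]
    induction hx using Submodule.span_induction with
    | zero => simp
    | add x y _ _ hx hy => rw [map_add, add_smul]; exact add_mem hx hy
    | smul c x _ hx =>
      rw [map_smul, smul_assoc]
      exact Submodule.smul_mem _ _ hx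
    | mem x hx =>
      obtain ⟨l, hl, rfl, rfl⟩ := hx
      match l with
      | [] =>
        simpa using SetLike.GradedOne.one_mem (A := gr 𝒱)
      | p :: l =>
        simp only [List.map_cons, List.prod_cons]
        rw [counit_ι_mul, zero_smul]
        exact zero_mem _
  | succ n ih =>
    rw [pow_succ']
    refine conv_mem (w := id) (gr 𝒱 i) (fun p q hpq y hy z hz => ?_) hx
    rw [← hpq]
    exact SetLike.GradedMul.mul_mem (ι_mem_gr 𝒱 (h0 p y hy)) (ih hz)

omit [CharZero K] in
include h0 in
theorem expHom_mem_gr {i : ℤ} {x : SymAlg 𝒱} (hx : x ∈ gr 𝒱 i) : expHom f h1 x ∈ gr 𝒱 i := by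
  obtain ⟨n, hn⟩ := (locNilp_ι_comp f h1).dpow x
  have hx' : expHom f h1 x = _ := lsum_apply (locNilp_ι_comp f h1).dpow hn
  rw [hx']
  exact sum_mem fun k _ => Submodule.smul_mem _ _ (pow_ι_comp_mem_gr f h0 k hx)

omit [CharZero K] in
theorem pow_ι_comp_mem_symPow (n : ℕ) (x : SymAlg 𝒱) :
    (toConv (ι 𝒱 ∘ₗ f) ^ n).ofConv x ∈ symPow 𝒱 n := by
  induction n generalizing x with
  | zero =>
    rw [pow_zero, convOne_apply, Algebra.algebraMap_eq_smul_one]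
    exact Submodule.smul_mem _ _ (one_mem_wgr 𝒱 _)
  | succ n ih =>
    rw [pow_succ', conv_apply]
    generalize comulₗ 𝒱 x = t
    induction t using TensorProduct.induction_on with
    | zero => simp
    | add s t hs ht => rw [map_add, map_add]; exact add_mem hs ht
    | tmul y z =>
      rw [add_comm, TensorProduct.map_tmul, LinearMap.mul'_apply]
      exact mul_mem_wgr 𝒱 _ (ι_mem_symPow _) (ih z)

/-- If `f` is the identity on the generators, then `expHom f` is unipotent with respect to the
filtration by the symmetric powers, hence bijective. -/
theorem expHom_bijective (hι : ∀ a, f (ι 𝒱 a) = a) : Function.Bijective (expHom f h1) := by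
  set φ := expHom f h1 with hφ
  set D : Module.End K (SymAlg 𝒱) := 1 - φ with hD
  have hstep : ∀ n, ∀ x ∈ symPow 𝒱 n, D x ∈ ⨆ m : Fin n, symPow 𝒱 (m : ℕ) := by
    intro n x hx
    have hF := locNilp_ι_comp f h1
    have hx' : φ x = ∑ k ∈ Finset.range (n + 1),
        (dpow (K := K) (toConv (ι 𝒱 ∘ₗ f)) k).ofConv x :=
      lsum_apply hF.dpow fun k hk => by
        simp [dpow, pow_apply_eq_zero (F := toConv (ι 𝒱 ∘ₗ f)) (by simp [h1]) hk hx]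
    have htop : (dpow (K := K) (toConv (ι 𝒱 ∘ₗ f)) n).ofConv x = x := by
      have : (dpow (K := K) (toConv (ι 𝒱 ∘ₗ f)) n).ofConv x =
          (dpow (K := K) (extendZero 𝒱 (ι 𝒱)) n).ofConv x := by
        simp only [dpow, ofConv_smul, LinearMap.smul_apply]
        congr 1
        exact pow_apply_congr (by simp [h1]) (extendZero_apply_one _)
          (fun a => by simp [extendZero, hι, proj_ι]) n hx
      rw [this]
      refine apply_eq_of_mem_symPow (g := LinearMap.id) (fun l hl => ?_) hx
      rw [dpow_extendZero_mono fun _ _ _ _ ha hb => ι_swap 𝒱 ha hb, if_pos hl]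
      rfl
    rw [hD, LinearMap.sub_apply, Module.End.one_apply, hx', Finset.sum_range_succ, htop,
      sub_add_cancel_right]
    refine neg_mem (sum_mem fun k hk => ?_)
    exact Submodule.mem_iSup_of_mem (⟨k, Finset.mem_range.1 hk⟩ : Fin n)
      (Submodule.smul_mem _ _ (pow_ι_comp_mem_symPow f k x))
  have hpow : ∀ n, ∀ m < n, ∀ x ∈ symPow 𝒱 m, (D ^ n) x = 0 := by
    intro n
    induction n with
    | zero => intro m hm; omega
    | succ n ih =>
      intro m hm x hx
      rw [pow_succ, Module.End.mul_apply]
      have hDx := hstep m x hx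
      revert hDx
      generalize D x = y
      intro hDx
      induction hDx using Submodule.iSup_induction' with
      | mem k x hx => exact ih k (by omega) x hx
      | zero => simp
      | add x y _ _ hx hy => rw [map_add, hx, hy, add_zero]
  have hnil : ∀ x, ∃ n, (D ^ n) x = 0 := by
    intro x
    have hx : x ∈ ⨆ n, symPow 𝒱 n := by
      rw [iSup_wgr_eq_top]
      trivial
    induction hx using Submodule.iSup_induction' with
    | mem n x hx => exact ⟨n + 1, hpow _ n (by omega) x hx⟩
    | zero => exact ⟨0, by simp⟩
    | add x y _ _ hx hy =>
      obtain ⟨m, hm⟩ := hx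
      obtain ⟨n, hn⟩ := hy
      refine ⟨m + n, ?_⟩
      rw [map_add]
      nth_rewrite 1 [add_comm m n]
      rw [pow_add, pow_add, Module.End.mul_apply, Module.End.mul_apply, hm, hn]
      simp
  have hφD : φ = 1 - D := by rw [hD, sub_sub_cancel]
  constructor
  · refine (injective_iff_map_eq_zero φ).2 fun x hx => ?_
    have hDx : D x = x := by simp [hD, hx]
    obtain ⟨n, hn⟩ := hnil x
    have : ∀ n, (D ^ n) x = x := fun n => by
      induction n with
      | zero => rfl
      | succ n ih => rw [pow_succ, Module.End.mul_apply, hDx, ih]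
    rw [← this n, hn]
  · intro y
    obtain ⟨n, hn⟩ := hnil y
    refine ⟨(∑ i ∈ Finset.range n, D ^ i) y, ?_⟩
    rw [hφD, ← Module.End.mul_apply, mul_neg_geom_sum, LinearMap.sub_apply, hn, sub_zero]
    rfl

end CoalgHom

end SymAlg

/-! ### From the reduced coalgebra to the full symmetric coalgebra -/

namespace SymCoalg

variable {K : Type u} [Field K] {V : Type v} [AddCommGroup V] [Module K V]
variable {𝒱 : ℤ → Submodule K V}

open KoszulBraces.SymAlg WithConv

theorem coe_reduce (x : SymAlg 𝒱) : (reduce 𝒱 x : SymAlg 𝒱) = x - counit 𝒱 x • 1 := by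
  rw [← Algebra.algebraMap_eq_smul_one]
  rfl

theorem counit_coe (x : SymCoalg 𝒱) : counit 𝒱 (x : SymAlg 𝒱) = 0 := x.2

@[simp] theorem reduce_coe (x : SymCoalg 𝒱) : reduce 𝒱 (x : SymAlg 𝒱) = x :=
  Subtype.ext <| by rw [coe_reduce, counit_coe, zero_smul, sub_zero]

@[simp] theorem reduce_one : reduce 𝒱 (1 : SymAlg 𝒱) = 0 :=
  Subtype.ext <| by rw [coe_reduce, map_one, one_smul, sub_self]; rfl

theorem monomial_apply (k : ℕ) (a : Fin k → V) :
    monomial 𝒱 k a = reduce 𝒱 (mono 𝒱 (List.ofFn a)) := by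
  simp [monomial, mono, List.map_ofFn, Function.comp_def]

/-- An endomorphism of `S^c V`, extended by zero to `S(V)`. -/
def extend (θ : SymCoalg 𝒱 →ₗ[K] SymCoalg 𝒱) : SymAlg 𝒱 →ₗ[K] SymAlg 𝒱 :=
  (SymCoalg 𝒱).subtype ∘ₗ θ ∘ₗ reduce 𝒱

theorem extend_apply (θ : SymCoalg 𝒱 →ₗ[K] SymCoalg 𝒱) (x : SymAlg 𝒱) :
    extend θ x = θ (reduce 𝒱 x) := rfl

theorem component_apply (θ : SymCoalg 𝒱 →ₗ[K] SymCoalg 𝒱) (k : ℕ) (a : Fin k → V) :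
    component 𝒱 θ k a = proj 𝒱 (extend θ (mono 𝒱 (List.ofFn a))) := by
  change proj 𝒱 (θ (monomial 𝒱 k a)) = _
  rw [monomial_apply, extend_apply]

variable [DirectSum.Decomposition 𝒱]

theorem diag_apply (x : SymCoalg 𝒱) :
    diag 𝒱 x = TensorProduct.map (reduce 𝒱) (reduce 𝒱) (comulₗ 𝒱 x) := rfl

theorem diag_reduce (x : SymAlg 𝒱) :
    diag 𝒱 (reduce 𝒱 x) = TensorProduct.map (reduce 𝒱) (reduce 𝒱) (comulₗ 𝒱 x) := by
  have hx : x = (reduce 𝒱 x : SymAlg 𝒱) + counit 𝒱 x • 1 := by rw [coe_reduce, sub_add_cancel]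
  conv_rhs => rw [hx]
  rw [diag_apply, map_add, map_add, map_smul, comulₗ_one, map_smul, TensorProduct.map_tmul,
    reduce_one, TensorProduct.zero_tmul, smul_zero, add_zero]

/-- The coproduct of `S(V)` in terms of the diagonal of `S^c V`. -/
theorem comulₗ_eq_diag (x : SymAlg 𝒱) :
    comulₗ 𝒱 x = x ⊗ₜ 1 + 1 ⊗ₜ x - counit 𝒱 x • (1 ⊗ₜ 1) +
      TensorProduct.map (SymCoalg 𝒱).subtype (SymCoalg 𝒱).subtype (diag 𝒱 (reduce 𝒱 x)) := by
  set η : K →ₗ[K] SymAlg 𝒱 := Algebra.linearMap K (SymAlg 𝒱) with hη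
  have hred : (SymCoalg 𝒱).subtype ∘ₗ reduce 𝒱 =
      LinearMap.id - η ∘ₗ (counit 𝒱).toLinearMap := rfl
  have hl : TensorProduct.map (η ∘ₗ (counit 𝒱).toLinearMap) LinearMap.id (comulₗ 𝒱 x) =
      1 ⊗ₜ x := by
    have := congrArg (TensorProduct.map η LinearMap.id) (Coalgebra.rTensor_counit_comul (R := K) x)
    rw [LinearMap.rTensor, TensorProduct.map_map, TensorProduct.map_tmul] at this
    refine this.trans ?_
    simp [hη]
  have hr : TensorProduct.map LinearMap.id (η ∘ₗ (counit 𝒱).toLinearMap) (comulₗ 𝒱 x) =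
      x ⊗ₜ 1 := by
    have := congrArg (TensorProduct.map LinearMap.id η) (Coalgebra.lTensor_counit_comul (R := K) x)
    rw [LinearMap.lTensor, TensorProduct.map_map, TensorProduct.map_tmul] at this
    refine this.trans ?_
    simp [hη]
  have hlr : TensorProduct.map (η ∘ₗ (counit 𝒱).toLinearMap) (η ∘ₗ (counit 𝒱).toLinearMap)
      (comulₗ 𝒱 x) = counit 𝒱 x • (1 ⊗ₜ 1) := by
    have := congrArg (TensorProduct.map LinearMap.id (η ∘ₗ (counit 𝒱).toLinearMap)) hl
    rw [TensorProduct.map_map, TensorProduct.map_tmul] at this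
    refine this.trans ?_
    simp [hη, Algebra.algebraMap_eq_smul_one]
  have hsub : ∀ (e : SymAlg 𝒱 →ₗ[K] SymAlg 𝒱) (t : SymAlg 𝒱 ⊗[K] SymAlg 𝒱),
      TensorProduct.map (LinearMap.id - e) (LinearMap.id - e) t =
        t - TensorProduct.map e LinearMap.id t - TensorProduct.map LinearMap.id e t +
          TensorProduct.map e e t := by
    intro e t
    induction t using TensorProduct.induction_on with
    | zero => simp
    | add s t hs ht => simp only [map_add, hs, ht]; abel
    | tmul y z =>
      simp only [TensorProduct.map_tmul, LinearMap.sub_apply, LinearMap.id_apply,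
        TensorProduct.sub_tmul, TensorProduct.tmul_sub]
      abel
  rw [diag_reduce, TensorProduct.map_map, hred, hsub, hl, hr, hlr]
  abel

/-! ### Automorphisms -/

section Aut

/-- The extension of an automorphism of `S^c V` to a coalgebra endomorphism of `S(V)`. -/
def Aut.hom (ψ : Aut 𝒱) : SymAlg 𝒱 →ₗ[K] SymAlg 𝒱 :=
  extend ψ.toEquiv.toLinearMap + Algebra.linearMap K (SymAlg 𝒱) ∘ₗ (counit 𝒱).toLinearMap

theorem Aut.hom_apply (ψ : Aut 𝒱) (x : SymAlg 𝒱) :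
    ψ.hom x = ψ.toEquiv (reduce 𝒱 x) + counit 𝒱 x • 1 := by
  rw [← Algebra.algebraMap_eq_smul_one]
  rfl

theorem Aut.isCoalgHom_hom (ψ : Aut 𝒱) : IsCoalgHom ψ.hom := by
  have hc : ∀ x, counit 𝒱 (ψ.hom x) = counit 𝒱 x := fun x => by
    rw [Aut.hom_apply, map_add, counit_coe, zero_add, map_smul, map_one, smul_eq_mul, mul_one]
  have h1 : ψ.hom 1 = 1 := by simp [Aut.hom_apply]
  have hr : ∀ x, reduce 𝒱 (ψ.hom x) = ψ.toEquiv (reduce 𝒱 x) := fun x => by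
    rw [Aut.hom_apply, map_add, map_smul, reduce_one, smul_zero, add_zero, reduce_coe]
  have hs : ψ.hom ∘ₗ (SymCoalg 𝒱).subtype = (SymCoalg 𝒱).subtype ∘ₗ ψ.toEquiv.toLinearMap :=
    LinearMap.ext fun x => by
      rw [LinearMap.comp_apply, Aut.hom_apply, Submodule.subtype_apply, reduce_coe, counit_coe,
        zero_smul, add_zero]
      rfl
  refine ⟨fun x => ?_, hc⟩
  have hd := LinearMap.congr_fun ψ.diag_comp (reduce 𝒱 x)
  simp only [LinearMap.comp_apply, LinearEquiv.coe_coe] at hd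
  rw [comulₗ_eq_diag, hc, hr, hd, comulₗ_eq_diag x]
  simp only [map_add, map_sub, map_smul, TensorProduct.map_tmul, h1, TensorProduct.map_map, hs]

theorem Aut.proj_hom (ψ : Aut 𝒱) (k : ℕ) (a : Fin k → V) :
    proj 𝒱 (ψ.hom (mono 𝒱 (List.ofFn a))) = component 𝒱 ψ.toEquiv.toLinearMap k a := by
  rw [component_apply, Aut.hom_apply, map_add, map_smul, proj_one, smul_zero, add_zero]
  rfl

/-- An automorphism of `S^c V` is determined by its components. -/
theorem Aut.ext_component [CharZero K] {ψ ψ' : Aut 𝒱}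
    (h : ∀ k, 1 ≤ k → component 𝒱 ψ.toEquiv.toLinearMap k =
      component 𝒱 ψ'.toEquiv.toLinearMap k) : ψ = ψ' := by
  have : ψ.hom = ψ'.hom := by
    refine ψ.isCoalgHom_hom.ext ψ'.isCoalgHom_hom (linearMap_ext_mono fun l => ?_)
    rw [LinearMap.comp_apply, LinearMap.comp_apply, ← List.ofFn_get l, Aut.proj_hom, Aut.proj_hom]
    match l with
    | [] =>
      rw [component_apply, component_apply]
      simp [extend_apply]
    | a :: l => rw [h _ (by simp)]
  have he : ψ.toEquiv = ψ'.toEquiv := LinearEquiv.ext fun x => Subtype.ext <| by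
    have := LinearMap.congr_fun this (x : SymAlg 𝒱)
    simpa [Aut.hom_apply, counit_coe] using this
  cases ψ
  cases ψ'
  cases he
  rfl

variable [CharZero K] (f : SymAlg 𝒱 →ₗ[K] V) (h1 : f 1 = 0) (hι : ∀ a, f (ι 𝒱 a) = a)
  (h0 : ∀ (i : ℤ) (x : SymAlg 𝒱), x ∈ gr 𝒱 i → f x ∈ 𝒱 i)

/-- The automorphism of `S^c V` whose projection to the generators is `f`. -/
def expAut : Aut 𝒱 where
  toEquiv := LinearEquiv.ofBijective
    ((expHom f h1).restrict (p := SymCoalg 𝒱) (q := SymCoalg 𝒱) fun x hx =>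
      (counit_expHom f h1 x).trans hx)
    ⟨fun x y hxy => Subtype.ext <| (expHom_bijective f h1 hι).1 <| congrArg Subtype.val hxy,
      fun y => by
        obtain ⟨x, hx⟩ := (expHom_bijective f h1 hι).2 y
        refine ⟨⟨x, ?_⟩, Subtype.ext hx⟩
        change counit 𝒱 x = 0
        rw [← counit_expHom f h1, hx]
        exact y.2⟩
  hasDegree n x hx := by
    rw [add_zero]
    exact expHom_mem_gr f h1 h0 hx
  diag_comp := by
    have hr : ∀ x, reduce 𝒱 (expHom f h1 x) =
        (expHom f h1).restrict (p := SymCoalg 𝒱) (q := SymCoalg 𝒱)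
          (fun x hx => (counit_expHom f h1 x).trans hx) (reduce 𝒱 x) := fun x =>
      Subtype.ext <| by
        change _ = expHom f h1 (reduce 𝒱 x)
        rw [coe_reduce, coe_reduce, map_sub, map_smul, counit_expHom]
        congr 2
        symm
        refine (lsum_apply_eq_of_forall_ne (locNilp_ι_comp f h1).dpow 0 fun k hk => ?_).trans ?_
        · obtain ⟨k, rfl⟩ := Nat.exists_eq_succ_of_ne_zero hk
          simp only [SymAlg.dpow, ofConv_smul, LinearMap.smul_apply, pow_succ', conv_apply_one,
            LinearMap.comp_apply, h1, map_zero, zero_mul, smul_zero]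
        · simp only [SymAlg.dpow, ofConv_smul, LinearMap.smul_apply, pow_zero, convOne_apply, map_one]
          simp
    refine LinearMap.ext fun x => ?_
    rw [LinearMap.comp_apply, LinearMap.comp_apply, diag_apply, diag_apply, TensorProduct.map_map]
    refine (congrArg _ ((isCoalgHom_expHom f h1 h0).comul_apply x)).trans ?_
    rw [TensorProduct.map_map]
    congr 2 <;> exact LinearMap.ext hr

theorem proj_expAut (x : SymCoalg 𝒱) :
    proj 𝒱 ((expAut f h1 hι h0).toEquiv x : SymAlg 𝒱) = f x :=
  proj_expHom f h1 x

theorem component_expAut (k : ℕ) (a : Fin k → V) :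
    component 𝒱 (expAut f h1 hι h0).toEquiv.toLinearMap k a = f (mono 𝒱 (List.ofFn a)) := by
  rw [component_apply, extend_apply]
  refine (proj_expAut f h1 hι h0 _).trans ?_
  rw [coe_reduce, map_sub, map_smul, h1, smul_zero, sub_zero]

end Aut

/-! ### Coderivations -/

variable (𝒱) in
/-- A degree `1` coderivation of `S(V)` that vanishes at `1`. -/
structure IsCoder (D : SymAlg 𝒱 →ₗ[K] SymAlg 𝒱) : Prop where
  comul_apply : ∀ x, comulₗ 𝒱 (D x) = TensorProduct.map D LinearMap.id (comulₗ 𝒱 x) +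
    TensorProduct.map (twist (gr 𝒱) 1) D (comulₗ 𝒱 x)
  counit_apply : ∀ x, counit 𝒱 (D x) = 0
  proj_mem : ∀ (i : ℤ) (x : SymAlg 𝒱), x ∈ gr 𝒱 i → proj 𝒱 (D x) ∈ 𝒱 (i + 1)

theorem sign_apply (x : SymCoalg 𝒱) : (sign 𝒱 x : SymAlg 𝒱) = twist (gr 𝒱) 1 x := by
  change (reduce 𝒱 (parity (gr 𝒱) x) : SymAlg 𝒱) = _
  rw [← twist_one, coe_reduce, counit_twist, counit_coe, zero_smul, sub_zero]

omit [DirectSum.Decomposition 𝒱] in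
theorem counit_apply_of_mem_gr {n : ℤ} (hn : n ≠ 0) {x : SymAlg 𝒱} (hx : x ∈ gr 𝒱 n) :
    counit 𝒱 x = 0 := by
  induction hx using Submodule.span_induction with
  | zero => simp
  | add x y _ _ hx hy => rw [map_add, hx, hy, add_zero]
  | smul c x _ hx => rw [map_smul, hx, smul_zero]
  | mem x hx =>
    obtain ⟨l, hl, rfl, rfl⟩ := hx
    match l with
    | [] => simp at hn
    | p :: l =>
      simp only [List.map_cons, List.prod_cons]
      rw [counit_ι_mul]

omit [DirectSum.Decomposition 𝒱] in
theorem reduce_mem_gr {n : ℤ} {x : SymAlg 𝒱} (hx : x ∈ gr 𝒱 n) :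
    (reduce 𝒱 x : SymAlg 𝒱) ∈ gr 𝒱 n := by
  rw [coe_reduce]
  refine sub_mem hx ?_
  by_cases hn : n = 0
  · subst hn
    exact Submodule.smul_mem _ _ (SetLike.GradedOne.one_mem (A := gr 𝒱))
  · rw [counit_apply_of_mem_gr hn hx, zero_smul]
    exact zero_mem _

theorem IsCoderivation.isCoder_extend {θ : SymCoalg 𝒱 →ₗ[K] SymCoalg 𝒱}
    (hθ : IsCoderivation 𝒱 θ) : IsCoder 𝒱 (extend θ) := by
  have h1 : extend θ 1 = 0 := by simp [extend_apply]
  have hs : extend θ ∘ₗ (SymCoalg 𝒱).subtype = (SymCoalg 𝒱).subtype ∘ₗ θ :=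
    LinearMap.ext fun x => by simp [extend_apply]
  have ht : twist (gr 𝒱) 1 ∘ₗ (SymCoalg 𝒱).subtype = (SymCoalg 𝒱).subtype ∘ₗ sign 𝒱 :=
    LinearMap.ext fun x => (sign_apply x).symm
  refine ⟨fun x => ?_, fun x => counit_coe _, fun i x hx => ?_⟩
  · have hd := LinearMap.congr_fun hθ.diag_comp (reduce 𝒱 x)
    simp only [LinearMap.comp_apply, LinearMap.add_apply] at hd
    have hr : reduce 𝒱 (extend θ x) = θ (reduce 𝒱 x) := reduce_coe _
    have hc : counit 𝒱 (extend θ x) = 0 := counit_coe _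
    rw [comulₗ_eq_diag, hc, hr, hd, comulₗ_eq_diag x]
    simp only [map_add, map_sub, map_smul, TensorProduct.map_tmul, h1, TensorProduct.map_map, hs,
      ht, LinearMap.id_comp, twist_one_apply, LinearMap.id_apply, TensorProduct.tmul_zero,
      TensorProduct.zero_tmul, zero_smul, sub_zero, smul_zero, add_zero, zero_add]
    simp only [LinearMap.comp_id]
    abel
  · exact proj_mem (hθ.hasDegree i _ (reduce_mem_gr hx))

section Coder

variable {B : Type*} [Ring B] [Algebra K B] {D : SymAlg 𝒱 →ₗ[K] SymAlg 𝒱}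

/-- Precomposition with a coderivation is a derivation of the convolution algebra, up to Koszul
signs. -/
theorem IsCoder.conv_comp (hD : IsCoder 𝒱 D) (f g : Conv 𝒱 B) :
    toConv ((f * g).ofConv ∘ₗ D) = toConv (f.ofConv ∘ₗ D) * g +
      toConv (f.ofConv ∘ₗ twist (gr 𝒱) 1) * toConv (g.ofConv ∘ₗ D) := by
  ext x
  change (f * g).ofConv (D x) = (toConv (f.ofConv ∘ₗ D) * g).ofConv x +
    (toConv (f.ofConv ∘ₗ twist (gr 𝒱) 1) * toConv (g.ofConv ∘ₗ D)).ofConv x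
  simp only [conv_apply, hD.comul_apply, map_add, TensorProduct.map_map, LinearMap.comp_id]

variable {r : V →ₗ[K] B}
  (hr : ∀ (i j : ℤ) (a b : V), a ∈ 𝒱 i → b ∈ 𝒱 j → r a * r b = ksign K (i * j) • (r b * r a))

/-- The projection to the generators of a coderivation, with values in an algebra. -/
abbrev coderProj (r : V →ₗ[K] B) (D : SymAlg 𝒱 →ₗ[K] SymAlg 𝒱) : Conv 𝒱 B :=
  toConv (r ∘ₗ proj 𝒱 ∘ₗ D)

include hr in
theorem IsCoder.extendZero_pow_comp (hD : IsCoder 𝒱 D) (n : ℕ) :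
    toConv ((extendZero 𝒱 r ^ (n + 1)).ofConv ∘ₗ D) =
      (n + 1 : K) • (coderProj r D * extendZero 𝒱 r ^ n) := by
  have hswap : toConv ((extendZero 𝒱 r).ofConv ∘ₗ twist (gr 𝒱) 1) * coderProj r D =
      coderProj r D * extendZero 𝒱 r :=
    conv_comm_of_swap fun i j x y hx hy => by
      have := hr i (j + 1) _ _ (SymAlg.proj_mem hx) (hD.proj_mem j y hy)
      simp only [extendZero, LinearMap.comp_apply, twist_of_mem _ _ hx, map_smul,
        smul_mul_assoc, one_mul]
      rw [this, smul_smul, mul_add, mul_one, ksign_add, mul_left_comm, ksign_mul_self, mul_one]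
  induction n with
  | zero =>
    rw [zero_add, pow_one, pow_zero, mul_one, Nat.cast_zero, zero_add, one_smul]
    rfl
  | succ n ih =>
    rw [pow_succ', hD.conv_comp, ih, mul_smul_comm, ← mul_assoc, hswap, mul_assoc, ← pow_succ']
    change coderProj r D * extendZero 𝒱 r ^ (n + 1) + _ = _
    push_cast
    module

theorem IsCoder.convOne_comp (hD : IsCoder 𝒱 D) : (1 : Conv 𝒱 B).ofConv ∘ₗ D = 0 :=
  LinearMap.ext fun x => by
    rw [LinearMap.comp_apply, convOne_apply, hD.counit_apply, map_zero, LinearMap.zero_apply]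

theorem conv_lsum (g : SymAlg 𝒱 →ₗ[K] B) {T : ℕ → SymAlg 𝒱 →ₗ[K] B} (hT : LocFin T)
    (hU : LocFin fun n => (toConv g * toConv (T n)).ofConv) :
    toConv g * toConv (lsum T hT) = toConv (lsum _ hU) := by
  classical
  have hS : LocFin fun n : ℕ => if n = 0 then g else 0 :=
    fun x => ⟨1, fun k hk => by simp [show k ≠ 0 by omega]⟩
  have hg : lsum _ hS = g := LinearMap.ext fun x => by
    rw [lsum_apply_eq_of_forall_ne hS 0 fun k hk => by simp [hk]]
    rfl
  rw [← lsum_conv_lsum hS hT hU fun n => ?_, hg]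
  rw [Finset.sum_eq_single (0, n)]
  · simp
  · intro p hp hp0
    rw [Finset.HasAntidiagonal.mem_antidiagonal] at hp
    have : p.1 ≠ 0 := fun h => hp0 (Prod.ext h (by simp only; omega))
    simp [this]
  · intro h
    exact absurd (Finset.HasAntidiagonal.mem_antidiagonal.2 (zero_add n)) h

include hr in
/-- The chain rule: substituting `π` in a power series `f` and composing with a coderivation with
projection `Q` to the generators gives `Q * f'(π)`. -/
theorem IsCoder.psum_comp (hD : IsCoder 𝒱 D) (h : LocNilp (extendZero 𝒱 r)) (f : PowerSeries K) :
    toConv ((psum _ h f).ofConv ∘ₗ D) =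
      coderProj r D * psum _ h (PowerSeries.derivative K f) := by
  have hT := h.smul fun n => PowerSeries.coeff n (PowerSeries.derivative K f)
  have heq : ∀ n, (coderProj r D * toConv (PowerSeries.coeff n (PowerSeries.derivative K f) •
      (extendZero 𝒱 r ^ n).ofConv)).ofConv =
      PowerSeries.coeff (n + 1) f • (extendZero 𝒱 r ^ (n + 1)).ofConv ∘ₗ D := fun n => by
    have h1 := congrArg ofConv (hD.extendZero_pow_comp hr n)
    rw [ofConv_toConv] at h1
    have h2 : toConv (PowerSeries.coeff n (PowerSeries.derivative K f) •
        (extendZero 𝒱 r ^ n).ofConv) =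
        (PowerSeries.coeff (n + 1) f * (n + 1)) • extendZero 𝒱 r ^ n := by
      rw [PowerSeries.coeff_derivative]
      rfl
    rw [h1, h2, mul_smul_comm, mul_smul]
    rfl
  have hU : LocFin fun n => (coderProj r D * toConv (PowerSeries.coeff n
      (PowerSeries.derivative K f) • (extendZero 𝒱 r ^ n).ofConv)).ofConv := fun x => by
    obtain ⟨n, hn⟩ := h (D x)
    refine ⟨n, fun k hk => ?_⟩
    have := hn (k + 1) (by omega)
    simp only at this
    simp only [heq, LinearMap.smul_apply, LinearMap.comp_apply, this, smul_zero]
  refine Eq.trans ?_ (conv_lsum _ hT hU).symm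
  ext x
  obtain ⟨n, hn⟩ := h (D x)
  refine (psum_apply_eq_sum _ h f (n := n + 1) fun k hk => hn k (by omega)).trans ?_
  rw [Finset.sum_range_succ']
  have h0 : ((extendZero 𝒱 r) ^ 0).ofConv (D x) = 0 := by
    rw [pow_zero]
    exact LinearMap.congr_fun hD.convOne_comp x
  rw [h0, smul_zero, add_zero]
  refine Eq.trans ?_ (lsum_apply hU (n := n) fun k hk => ?_).symm
  · simp only [heq]
    rfl
  · have := hn (k + 1) (by omega)
    simp only at this
    simp only [heq, LinearMap.smul_apply, LinearMap.comp_apply, this, smul_zero]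

end Coder

end SymCoalg

/-! ### Constructions of algebras with a differential -/

section Decomposition

variable {K : Type u} [Field K] {M : Type v} [AddCommGroup M] [Module K M]

/-- A grading from a family of projections. -/
abbrev decompositionOfProj (𝒱 : ℤ → Submodule K M) (p : ℤ → M →ₗ[K] M)
    (h1 : ∀ n, ∀ x ∈ 𝒱 n, p n x = x) (h2 : ∀ m n, m ≠ n → ∀ x ∈ 𝒱 m, p n x = 0)
    (h3 : ⨆ n, 𝒱 n = ⊤) : DirectSum.Decomposition 𝒱 :=
  DirectSum.IsInternal.chooseDecomposition _ <|
    DirectSum.isInternal_submodule_of_iSupIndep_of_iSup_eq_top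
      (fun n => Submodule.disjoint_def.2 fun x hx hx' => by
        have : ⨆ (m) (_ : m ≠ n), 𝒱 m ≤ LinearMap.ker (p n) :=
          iSup₂_le fun m hm y hy => h2 m n hm y hy
        rw [← h1 n x hx]
        exact this hx') h3

variable (𝒱 : ℤ → Submodule K M) [DirectSum.Decomposition 𝒱]

/-- The projection of a graded space to its part of degree `n`. -/
def grProj (n : ℤ) : M →ₗ[K] M :=
  (𝒱 n).subtype ∘ₗ DirectSum.component K ℤ (fun i => 𝒱 i) n ∘ₗ
    (DirectSum.decomposeLinearEquiv 𝒱).toLinearMap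

theorem grProj_of_mem {n : ℤ} {x : M} (hx : x ∈ 𝒱 n) : grProj 𝒱 n x = x :=
  DirectSum.decompose_of_mem_same 𝒱 hx

theorem grProj_of_mem_ne {m n : ℤ} (hmn : m ≠ n) {x : M} (hx : x ∈ 𝒱 m) : grProj 𝒱 n x = 0 :=
  DirectSum.decompose_of_mem_ne 𝒱 hx hmn

end Decomposition

namespace DiffCommAlg

variable {K : Type u} [Field K]

theorem twist_mul (A : DiffCommAlg K) (m : ℤ) (a b : A) :
    twist A.gr m (a * b) = twist A.gr m a * twist A.gr m b := by
  have : (twist A.gr m) ∘ₗ LinearMap.mul' K A = LinearMap.mul' K A ∘ₗ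
      TensorProduct.map (twist A.gr m) (twist A.gr m) :=
    tensor_ext_homogeneous A.gr fun i j x y hx hy => by
      simp only [LinearMap.comp_apply, LinearMap.mul'_apply, TensorProduct.map_tmul,
        twist_of_mem A.gr m hx, twist_of_mem A.gr m hy,
        twist_of_mem A.gr m (A.mul_mem hx hy), mul_add, ksign_add, smul_mul_smul_comm]
  exact LinearMap.congr_fun this (a ⊗ₜ b)

/-! #### Adjoining a constant -/

/-- The underlying space `A ⊕ c (K ⊕ A)` of the extension of `A` by a square zero constant `c` of
degree `m`; the triple `(a, b, s)` stands for `a + c (b + s)`. -/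
def ConstExt (A : DiffCommAlg K) (_m : ℤ) : Type u := A × A × K

namespace ConstExt

variable (A : DiffCommAlg K) (m : ℤ)

instance : AddCommGroup (ConstExt A m) := inferInstanceAs (AddCommGroup (A × A × K))

instance : Module K (ConstExt A m) := inferInstanceAs (Module K (A × A × K))

variable {A m}

theorem ext {x y : ConstExt A m} (h1 : x.1 = y.1) (h2 : x.2.1 = y.2.1) (h3 : x.2.2 = y.2.2) :
    x = y := Prod.ext h1 (Prod.ext h2 h3)

theorem fst_add (x y : ConstExt A m) : (x + y).1 = x.1 + y.1 := rfl
theorem snd_add (x y : ConstExt A m) : (x + y).2.1 = x.2.1 + y.2.1 := rfl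
theorem thd_add (x y : ConstExt A m) : (x + y).2.2 = x.2.2 + y.2.2 := rfl
theorem fst_zero : (0 : ConstExt A m).1 = 0 := rfl
theorem snd_zero : (0 : ConstExt A m).2.1 = 0 := rfl
theorem thd_zero : (0 : ConstExt A m).2.2 = 0 := rfl
theorem fst_smul (c : K) (x : ConstExt A m) : (c • x).1 = c • x.1 := rfl
theorem snd_smul (c : K) (x : ConstExt A m) : (c • x).2.1 = c • x.2.1 := rfl
theorem thd_smul (c : K) (x : ConstExt A m) : (c • x).2.2 = c • x.2.2 := rfl

instance : Mul (ConstExt A m) where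
  mul x y := (x.1 * y.1, x.2.1 * y.1 + x.2.2 • y.1 + twist A.gr m x.1 * y.2.1 +
    y.2.2 • twist A.gr m x.1, 0)

theorem fst_mul (x y : ConstExt A m) : (x * y).1 = x.1 * y.1 := rfl
theorem snd_mul (x y : ConstExt A m) : (x * y).2.1 = x.2.1 * y.1 + x.2.2 • y.1 +
    twist A.gr m x.1 * y.2.1 + y.2.2 • twist A.gr m x.1 := rfl
theorem thd_mul (x y : ConstExt A m) : (x * y).2.2 = 0 := rfl

instance : NonUnitalRing (ConstExt A m) where
  left_distrib x y z := ext (mul_add _ _ _) (by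
    simp only [snd_mul, fst_add, snd_add, thd_add, mul_add, smul_add, add_smul]; abel)
    (add_zero (0 : K)).symm
  right_distrib x y z := ext (add_mul _ _ _) (by
    simp only [snd_mul, fst_add, snd_add, thd_add, add_mul, smul_add, add_smul, map_add]; abel)
    (add_zero (0 : K)).symm
  zero_mul x := ext (zero_mul _) (by
    simp only [snd_mul, fst_zero, snd_zero, thd_zero, map_zero, zero_mul, zero_smul, smul_zero,
      add_zero]) rfl
  mul_zero x := ext (mul_zero _) (by
    simp only [snd_mul, fst_zero, snd_zero, thd_zero, mul_zero, zero_smul, smul_zero,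
      add_zero]) rfl
  mul_assoc x y z := ext (mul_assoc _ _ _) (by
    simp only [snd_mul, fst_mul, thd_mul, twist_mul, zero_smul, add_mul, mul_add, smul_mul_assoc,
      mul_smul_comm, mul_assoc]
    abel) rfl

instance : IsScalarTower K (ConstExt A m) (ConstExt A m) where
  smul_assoc c x y := ext (smul_mul_assoc _ _ _) (by
    simp only [smul_eq_mul, snd_mul, fst_smul, snd_smul, thd_smul, smul_add, smul_mul_assoc,
      map_smul, mul_smul, smul_comm c]) (smul_zero c).symm

instance : SMulCommClass K (ConstExt A m) (ConstExt A m) where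
  smul_comm c x y := ext (mul_smul_comm _ _ _).symm (by
    simp only [smul_eq_mul, snd_mul, fst_smul, snd_smul, thd_smul, smul_add, mul_smul_comm,
      mul_smul, smul_comm c]) (smul_zero c)

variable (A m)

/-- The part `A_n ⊕ c A_{n-m}`, with the line of `c` added in degree `m`. -/
def gr (n : ℤ) : Submodule K (ConstExt A m) where
  carrier := {x | x.1 ∈ A.gr n ∧ x.2.1 ∈ A.gr (n - m) ∧ (n ≠ m → x.2.2 = 0)}
  add_mem' := fun {x y} hx hy => ⟨add_mem hx.1 hy.1, add_mem hx.2.1 hy.2.1, fun h => by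
    rw [thd_add, hx.2.2 h, hy.2.2 h, add_zero]⟩
  zero_mem' := ⟨zero_mem _, zero_mem _, fun _ => rfl⟩
  smul_mem' c x hx := ⟨Submodule.smul_mem _ _ hx.1, Submodule.smul_mem _ _ hx.2.1, fun h => by
    rw [thd_smul, hx.2.2 h, smul_zero]⟩

/-- The projection to the part of degree `n`. -/
def proj (n : ℤ) : ConstExt A m →ₗ[K] ConstExt A m :=
  LinearMap.prodMap (grProj A.gr n) (LinearMap.prodMap (grProj A.gr (n - m))
    (if n = m then LinearMap.id else 0))

theorem thd_proj (n : ℤ) (x : ConstExt A m) :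
    (proj A m n x).2.2 = (if n = m then LinearMap.id else 0 : K →ₗ[K] K) x.2.2 := rfl

/-- The inclusion of `A`. -/
def incl : A →ₗ[K] ConstExt A m := LinearMap.inl K A (A × K)

theorem fst_incl (a : A) : (incl A m a).1 = a := rfl
theorem snd_incl (a : A) : (incl A m a).2.1 = 0 := rfl
theorem thd_incl (a : A) : (incl A m a).2.2 = 0 := rfl

/-- The linear map `a ↦ c a`. -/
def inclConst : A →ₗ[K] ConstExt A m := LinearMap.inr K A (A × K) ∘ₗ LinearMap.inl K A K

theorem fst_inclConst (a : A) : (inclConst A m a).1 = 0 := rfl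
theorem snd_inclConst (a : A) : (inclConst A m a).2.1 = a := rfl
theorem thd_inclConst (a : A) : (inclConst A m a).2.2 = 0 := rfl

/-- The adjoined constant. -/
def const : ConstExt A m := (0, 0, 1)

theorem fst_const : (const A m).1 = 0 := rfl
theorem snd_const : (const A m).2.1 = 0 := rfl
theorem thd_const : (const A m).2.2 = 1 := rfl

theorem incl_mem {n : ℤ} {a : A} (ha : a ∈ A.gr n) : incl A m a ∈ gr A m n :=
  ⟨ha, zero_mem _, fun _ => rfl⟩

theorem inclConst_mem {n : ℤ} {a : A} (ha : a ∈ A.gr n) : inclConst A m a ∈ gr A m (m + n) :=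
  ⟨zero_mem _, by rwa [add_sub_cancel_left], fun _ => rfl⟩

theorem const_mem : const A m ∈ gr A m m := ⟨zero_mem _, zero_mem _, fun h => (h rfl).elim⟩

instance : DirectSum.Decomposition (gr A m) :=
  decompositionOfProj (gr A m) (proj A m)
    (fun n x hx => ext (grProj_of_mem _ hx.1) (grProj_of_mem _ hx.2.1) (by
      rw [thd_proj]
      split_ifs with h
      · rfl
      · rw [hx.2.2 h, map_zero]))
    (fun k n hkn x hx => ext (grProj_of_mem_ne _ hkn hx.1)
      (grProj_of_mem_ne _ (by omega) hx.2.1) (by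
      rw [thd_proj]
      split_ifs with h
      · rw [hx.2.2 (by omega)]; rfl
      · rfl)) (by
    refine eq_top_iff.2 fun x _ => ?_
    have hx : x = incl A m x.1 + inclConst A m x.2.1 + x.2.2 • const A m := by
      refine ext ?_ ?_ ?_
      · rw [fst_add, fst_add, fst_smul, fst_incl, fst_inclConst, fst_const, add_zero, smul_zero,
          add_zero]
      · rw [snd_add, snd_add, snd_smul, snd_incl, snd_inclConst, snd_const, zero_add, smul_zero,
          add_zero]
      · rw [thd_add, thd_add, thd_smul, thd_incl, thd_inclConst, thd_const, add_zero, zero_add,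
          smul_eq_mul, mul_one]
    rw [hx]
    refine add_mem (add_mem ?_ ?_)
      (Submodule.smul_mem _ _ (Submodule.mem_iSup_of_mem m (const_mem A m)))
    · induction x.1 using DirectSum.Decomposition.inductionOn A.gr with
      | zero => simp
      | add a b ha hb => rw [map_add]; exact add_mem ha hb
      | @homogeneous i a => exact Submodule.mem_iSup_of_mem i (incl_mem A m a.2)
    · induction x.2.1 using DirectSum.Decomposition.inductionOn A.gr with
      | zero => simp
      | add a b ha hb => rw [map_add]; exact add_mem ha hb
      | @homogeneous i a => exact Submodule.mem_iSup_of_mem (m + i) (inclConst_mem A m a.2))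

end ConstExt

open ConstExt in
/-- The algebra `A ⊕ c (K ⊕ A)` obtained from `A` by adjoining a constant `c` of degree `m` with
`c² = 0`. It provides constants even if `A` has none. -/
def constExt (A : DiffCommAlg K) (m : ℤ) : DiffCommAlg K where
  carrier := ConstExt A m
  gr := ConstExt.gr A m
  mul_mem := by
    intro i j x y hx hy
    refine ⟨A.mul_mem hx.1 hy.1, add_mem (add_mem (add_mem ?_ ?_) ?_) ?_, fun _ => rfl⟩
    · have := A.mul_mem hx.2.1 hy.1
      rwa [show i - m + j = i + j - m by ring] at this
    · by_cases h : i = m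
      · rw [show i + j - m = j by omega]
        exact Submodule.smul_mem _ _ hy.1
      · rw [hx.2.2 h, zero_smul]
        exact zero_mem _
    · have := A.mul_mem (twist_mem A.gr m hx.1) hy.2.1
      rwa [show i + (j - m) = i + j - m by ring] at this
    · by_cases h : j = m
      · rw [show i + j - m = i by omega]
        exact Submodule.smul_mem _ _ (twist_mem A.gr m hx.1)
      · rw [hy.2.2 h, zero_smul]
        exact zero_mem _
  mul_comm := by
    intro i j x y hx hy
    have e1 : x.2.1 * y.1 = ksign K (i * j) • ksign K (m * j) • (y.1 * x.2.1) := by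
      rw [A.mul_comm hx.2.1 hy.1, smul_smul, ← ksign_add]
      congr 1
      exact ksign_congr ⟨-(m * j), by ring⟩
    have e2 : ksign K (m * i) • (x.1 * y.2.1) = ksign K (i * j) • (y.2.1 * x.1) := by
      rw [A.mul_comm hx.1 hy.2.1, smul_smul, ← ksign_add]
      congr 1
      exact ksign_congr ⟨0, by ring⟩
    have e3 : x.2.2 • y.1 = ksign K (i * j) • x.2.2 • ksign K (m * j) • y.1 := by
      by_cases h : i = m
      · rw [h, smul_comm (ksign K (m * j)) x.2.2, smul_smul (ksign K (m * j)), ksign_mul_self,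
          one_smul]
      · simp [hx.2.2 h]
    have e4 : y.2.2 • ksign K (m * i) • x.1 = ksign K (i * j) • y.2.2 • x.1 := by
      by_cases h : j = m
      · rw [h, smul_comm y.2.2, _root_.mul_comm m i]
      · simp [hy.2.2 h]
    refine ConstExt.ext (A.mul_comm hx.1 hy.1) ?_ (smul_zero _).symm
    rw [snd_smul, snd_mul, snd_mul, twist_of_mem A.gr m hx.1, twist_of_mem A.gr m hy.1,
      smul_mul_assoc, smul_mul_assoc, e1, e2, e3, e4]
    simp only [smul_add]
    abel
  Δ := LinearMap.prodMap A.Δ (LinearMap.prodMap (ksign K m • A.Δ) 0)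
  Δ_mem := by
    intro i x hx
    refine ⟨A.Δ_mem hx.1, Submodule.smul_mem _ _ ?_, fun _ => rfl⟩
    have := A.Δ_mem hx.2.1
    rwa [show i - m + 1 = i + 1 - m by ring] at this
  Δ_Δ x := ConstExt.ext (A.Δ_Δ _) (by
    change ksign K m • A.Δ (ksign K m • A.Δ x.2.1) = 0
    rw [map_smul, A.Δ_Δ, smul_zero, smul_zero]) rfl

/-- The inclusion `A → A ⊕ c (K ⊕ A)`. -/
def toConstExt (A : DiffCommAlg K) (m : ℤ) : A →ₗ[K] constExt A m := ConstExt.incl A m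

theorem isMorphism_of_mem {A B : DiffCommAlg K} (f : A →ₗ[K] B)
    (hmul : ∀ a a' : A, f (a * a') = f a * f a') (hΔ : ∀ a : A, f (A.Δ a) = B.Δ (f a))
    (hgr : ∀ (i : ℤ) (a : A), a ∈ A.gr i → f a ∈ B.gr i) : IsMorphism f where
  map_mul := hmul
  map_Δ := hΔ
  parity i a ha := by
    refine Submodule.mem_iSup_of_mem 0 ?_
    simpa using hgr i a ha

theorem toConstExt_mem (A : DiffCommAlg K) (m : ℤ) (i : ℤ) (a : A) (ha : a ∈ A.gr i) :
    toConstExt A m a ∈ (constExt A m).gr i := ConstExt.incl_mem A m ha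

theorem isMorphism_toConstExt (A : DiffCommAlg K) (m : ℤ) : IsMorphism (toConstExt A m) :=
  isMorphism_of_mem _
    (fun a a' => ConstExt.ext (m := m) rfl (by
      refine Eq.trans ?_ (ConstExt.snd_mul (ConstExt.incl A m a) (ConstExt.incl A m a')).symm
      simp only [ConstExt.fst_incl, ConstExt.snd_incl, ConstExt.thd_incl, zero_mul, mul_zero,
        zero_smul, add_zero]
      rfl) rfl)
    (fun a => ConstExt.ext (m := m) rfl (by
      change (0 : A) = ksign K m • A.Δ 0
      rw [map_zero, smul_zero]) rfl)
    (toConstExt_mem A m)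

/-- The adjoined constant. -/
def adjoined (A : DiffCommAlg K) (m : ℤ) : constExt A m := ConstExt.const A m

theorem adjoined_mul (A : DiffCommAlg K) (m : ℤ) (x : constExt A m) :
    adjoined A m * x = ConstExt.inclConst A m x.1 := by
  refine ConstExt.ext (zero_mul _) ?_ rfl
  refine (ConstExt.snd_mul _ _).trans ?_
  change (0 : A) * x.1 + (1 : K) • x.1 + twist A.gr m 0 * x.2.1 + x.2.2 • twist A.gr m 0 = x.1
  simp

theorem isConstant_adjoined (A : DiffCommAlg K) (m : ℤ) :
    (constExt A m).IsConstant m (adjoined A m) := by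
  refine ⟨ConstExt.const_mem A m, fun x => ?_⟩
  rw [adjoined_mul, adjoined_mul]
  refine ConstExt.ext (m := m) ?_ rfl ?_
  · change A.Δ 0 = ksign K m • (0 : A)
    rw [map_zero, smul_zero]
  · change (0 : K) = ksign K m • 0
    rw [smul_zero]

theorem adjoined_mul_toConstExt_eq_zero {A : DiffCommAlg K} {m : ℤ} {a : A}
    (h : adjoined A m * toConstExt A m a = 0) : a = 0 := by
  rw [adjoined_mul] at h
  exact congrArg (fun x : ConstExt A m => x.2.1) h

/-! #### Products -/

/-- The product of two algebras. -/
def prod (A B : DiffCommAlg K) : DiffCommAlg K where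
  carrier := A × B
  gr n := (A.gr n).prod (B.gr n)
  decomposition := decompositionOfProj _
    (fun n => LinearMap.prodMap (grProj A.gr n) (grProj B.gr n))
    (fun n x hx => Prod.ext (grProj_of_mem _ hx.1) (grProj_of_mem _ hx.2))
    (fun m n hmn x hx => Prod.ext (grProj_of_mem_ne _ hmn hx.1) (grProj_of_mem_ne _ hmn hx.2)) (by
    refine eq_top_iff.2 fun x _ => ?_
    have hx : x = LinearMap.inl K A B x.1 + LinearMap.inr K A B x.2 := by simp
    rw [hx]
    refine add_mem ?_ ?_
    · induction x.1 using DirectSum.Decomposition.inductionOn A.gr with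
      | zero => rw [map_zero]; exact zero_mem _
      | add a b ha hb => rw [map_add]; exact add_mem ha hb
      | @homogeneous i a => exact Submodule.mem_iSup_of_mem i ⟨a.2, zero_mem _⟩
    · induction x.2 using DirectSum.Decomposition.inductionOn B.gr with
      | zero => rw [map_zero]; exact zero_mem _
      | add a b ha hb => rw [map_add]; exact add_mem ha hb
      | @homogeneous i a => exact Submodule.mem_iSup_of_mem i ⟨zero_mem _, a.2⟩)
  mul_mem hx hy := ⟨A.mul_mem hx.1 hy.1, B.mul_mem hx.2 hy.2⟩
  mul_comm hx hy := Prod.ext (A.mul_comm hx.1 hy.1) (B.mul_comm hx.2 hy.2)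
  Δ := LinearMap.prodMap A.Δ B.Δ
  Δ_mem hx := ⟨A.Δ_mem hx.1, B.Δ_mem hx.2⟩
  Δ_Δ x := Prod.ext (A.Δ_Δ x.1) (B.Δ_Δ x.2)

theorem isMorphism_fst (A B : DiffCommAlg K) :
    IsMorphism (A := prod A B) (B := A) (LinearMap.fst K A B) :=
  isMorphism_of_mem _ (fun _ _ => rfl) (fun _ => rfl) fun _ _ h => h.1

theorem isMorphism_snd (A B : DiffCommAlg K) :
    IsMorphism (A := prod A B) (B := B) (LinearMap.snd K A B) :=
  isMorphism_of_mem _ (fun _ _ => rfl) (fun _ => rfl) fun _ _ h => h.2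

/-! #### Graded subalgebras -/

section Sub

variable (A : DiffCommAlg K) (H : ℤ → Submodule K A) (hH : ∀ n, H n ≤ A.gr n)
  (hmul : ∀ i j, ∀ a ∈ H i, ∀ b ∈ H j, a * b ∈ H (i + j))
  (hΔ : ∀ i, ∀ a ∈ H i, A.Δ a ∈ H (i + 1))

/-- The subalgebra `⨁ H n`. -/
def subCarrier : NonUnitalSubalgebra K A where
  toSubmodule := ⨆ n, H n
  mul_mem' := by
    intro x y hx hy
    change x * y ∈ ⨆ n, H n
    induction hx using Submodule.iSup_induction' with
    | zero => simp
    | add x x' _ _ hx hx' => rw [add_mul]; exact add_mem hx hx'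
    | mem i x hx =>
      induction hy using Submodule.iSup_induction' with
      | zero => simp
      | add y y' _ _ hy hy' => rw [mul_add]; exact add_mem hy hy'
      | mem j y hy => exact Submodule.mem_iSup_of_mem (i + j) (hmul i j x hx y hy)

include hH in
theorem grProj_mem_of_mem_iSup {x : A} (hx : x ∈ ⨆ n, H n) (n : ℤ) : grProj A.gr n x ∈ H n := by
  induction hx using Submodule.iSup_induction' with
  | zero => simp
  | add x y _ _ hx hy => rw [map_add]; exact add_mem hx hy
  | mem i x hx =>
    by_cases h : i = n
    · subst h
      rwa [grProj_of_mem _ (hH i hx)]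
    · rw [grProj_of_mem_ne _ h (hH i hx)]
      exact zero_mem _

include hΔ in
theorem Δ_mem_iSup {x : A} (hx : x ∈ ⨆ n, H n) : A.Δ x ∈ ⨆ n, H n := by
  induction hx using Submodule.iSup_induction' with
  | zero => simp
  | add x y _ _ hx hy => rw [map_add]; exact add_mem hx hy
  | mem i x hx => exact Submodule.mem_iSup_of_mem (i + 1) (hΔ i x hx)

/-- The subalgebra `⨁ H n` of `A`, for subspaces `H n ⊆ A_n` that are closed under the product and
the differential. -/
def sub : DiffCommAlg K where
  carrier := subCarrier A H hmul
  gr n := (H n).comap (subCarrier A H hmul).toSubmodule.subtype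
  decomposition := decompositionOfProj _
    (fun n => (grProj A.gr n).restrict (p := (subCarrier A H hmul).toSubmodule)
      (q := (subCarrier A H hmul).toSubmodule)
      fun x hx => Submodule.mem_iSup_of_mem n (grProj_mem_of_mem_iSup A H hH hx n))
    (fun n x hx => Subtype.ext (grProj_of_mem _ (hH n hx)))
    (fun m n hmn x hx => Subtype.ext (grProj_of_mem_ne _ hmn (hH m hx))) (by
    refine eq_top_iff.2 fun x _ => ?_
    exact Submodule.iSup_induction' H
      (motive := fun x hx => (⟨x, hx⟩ : subCarrier A H hmul) ∈
        ⨆ n, (H n).comap (subCarrier A H hmul).toSubmodule.subtype)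
      (fun i x hx => Submodule.mem_iSup_of_mem i hx) (zero_mem _)
      (fun x y hx hy h h' => add_mem h h') x.2)
  mul_mem hx hy := hmul _ _ _ hx _ hy
  mul_comm hx hy := Subtype.ext (A.mul_comm (hH _ hx) (hH _ hy))
  Δ := A.Δ.restrict (p := (subCarrier A H hmul).toSubmodule)
      (q := (subCarrier A H hmul).toSubmodule) fun x hx => Δ_mem_iSup A H hΔ hx
  Δ_mem hx := hΔ _ _ hx
  Δ_Δ x := Subtype.ext (A.Δ_Δ x)

theorem isMorphism_subtype : IsMorphism (A := sub A H hH hmul hΔ) (B := A)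
    (subCarrier A H hmul).toSubmodule.subtype :=
  isMorphism_of_mem _ (fun _ _ => rfl) (fun _ => rfl) fun i _ h => hH i h

end Sub

end DiffCommAlg

/-! ### Functoriality and divided powers of degree zero elements -/

namespace SymAlg

open WithConv

section Map

variable {K : Type u} [Field K] {V W : Type v} [AddCommGroup V] [Module K V] [AddCommGroup W]
  [Module K W] {𝒱 : ℤ → Submodule K V} {𝒲 : ℤ → Submodule K W}
  (f : V →ₗ[K] W) (hf : ∀ i, ∀ a ∈ 𝒱 i, f a ∈ 𝒲 i)

/-- The map of symmetric algebras induced by a linear map of degree zero. -/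
def map : SymAlg 𝒱 →ₐ[K] SymAlg 𝒲 :=
  lift 𝒱 (ι 𝒲 ∘ₗ f) fun i j a b ha hb => ι_swap 𝒲 (hf i a ha) (hf j b hb)

theorem map_ι (a : V) : map f hf (ι 𝒱 a) = ι 𝒲 (f a) := lift_ι _ _ _ _

theorem map_mono (l : List V) : map f hf (mono 𝒱 l) = mono 𝒲 (l.map f) := by
  induction l with
  | nil => exact map_one _
  | cons a l ih => rw [mono_cons, map_mul, ih, map_ι, List.map_cons, mono_cons]

variable [DirectSum.Decomposition 𝒱]

theorem proj_map (x : SymAlg 𝒱) : proj 𝒲 (map f hf x) = f (proj 𝒱 x) :=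
  LinearMap.congr_fun (f := proj 𝒲 ∘ₗ (map f hf).toLinearMap) (g := f ∘ₗ proj 𝒱)
    (linearMap_ext_mono fun l => by
      cases l with
      | nil => simp [proj_one]
      | cons a l =>
        have hc : counit 𝒲 (mono 𝒲 (l.map f)) = counit 𝒱 (mono 𝒱 l) := by
          cases l with
          | nil => simp
          | cons b l => simp [mono_cons, counit_ι]
        rw [LinearMap.comp_apply, AlgHom.toLinearMap_apply, map_mono, List.map_cons, mono_cons,
          proj_ι_mul, hc, LinearMap.comp_apply, mono_cons, proj_ι_mul, map_smul]) x

omit [DirectSum.Decomposition 𝒱] in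
theorem map_mem_gr {n : ℤ} {x : SymAlg 𝒱} (hx : x ∈ gr 𝒱 n) : map f hf x ∈ gr 𝒲 n := by
  induction hx using Submodule.span_induction with
  | zero => simp
  | add x y _ _ hx hy => rw [map_add]; exact add_mem hx hy
  | smul c x _ hx => rw [map_smul]; exact Submodule.smul_mem _ _ hx
  | mem x hx =>
    obtain ⟨l, hl, rfl, rfl⟩ := hx
    refine Submodule.subset_span ⟨l.map fun p => (p.1, f p.2), ?_, ?_, ?_⟩
    · intro q hq
      obtain ⟨p, hp, rfl⟩ := List.mem_map.1 hq
      exact hf _ _ (hl p hp)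
    · simp [Function.comp_def]
    · rw [map_list_prod]
      simp [Function.comp_def, map_ι]

variable [DirectSum.Decomposition 𝒲]

theorem map_twist (n : ℤ) (x : SymAlg 𝒱) :
    map f hf (twist (gr 𝒱) n x) = twist (gr 𝒲) n (map f hf x) :=
  LinearMap.congr_fun (f := (map f hf).toLinearMap ∘ₗ twist (gr 𝒱) n)
    (g := twist (gr 𝒲) n ∘ₗ (map f hf).toLinearMap)
    (linearMap_ext_homogeneous (gr 𝒱) fun i x hx => by
      simp [twist_of_mem _ _ hx, twist_of_mem _ _ (map_mem_gr f hf hx)]) x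

theorem comulₗ_map (x : SymAlg 𝒱) : comulₗ 𝒲 (map f hf x) =
    TensorProduct.map (map f hf).toLinearMap (map f hf).toLinearMap (comulₗ 𝒱 x) :=
  LinearMap.congr_fun (f := comulₗ 𝒲 ∘ₗ (map f hf).toLinearMap)
    (g := TensorProduct.map (map f hf).toLinearMap (map f hf).toLinearMap ∘ₗ comulₗ 𝒱)
    (linearMap_ext (by simp [comulₗ_one]) fun i a ha x hx => by
      simp only [LinearMap.comp_apply, AlgHom.toLinearMap_apply] at hx ⊢
      rw [map_mul, map_ι, comulₗ_ι_mul _ (hf i a ha), comulₗ_ι_mul _ ha, hx, map_add,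
        TensorProduct.map_map, TensorProduct.map_map, TensorProduct.map_map,
        TensorProduct.map_map]
      have h1 : LinearMap.mulLeft K (ι 𝒲 (f a)) ∘ₗ (map f hf).toLinearMap =
          (map f hf).toLinearMap ∘ₗ LinearMap.mulLeft K (ι 𝒱 a) := by
        ext y
        simp [map_ι]
      have h2 : twist (gr 𝒲) i ∘ₗ (map f hf).toLinearMap =
          (map f hf).toLinearMap ∘ₗ twist (gr 𝒱) i :=
        LinearMap.ext fun y => (map_twist f hf i y).symm
      rw [h1, h2, LinearMap.id_comp, LinearMap.comp_id]) x

variable {B B' : Type*} [Ring B] [Algebra K B] [Ring B'] [Algebra K B']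

theorem conv_natural (F : B →ₐ[K] B') {g h : Conv 𝒱 B} {g' h' : Conv 𝒲 B'}
    (hg : ∀ x, F (g.ofConv x) = g'.ofConv (map f hf x))
    (hh : ∀ x, F (h.ofConv x) = h'.ofConv (map f hf x)) (x : SymAlg 𝒱) :
    F ((g * h).ofConv x) = (g' * h').ofConv (map f hf x) := by
  rw [conv_apply, conv_apply, comulₗ_map]
  induction comulₗ 𝒱 x using TensorProduct.induction_on with
  | zero => simp
  | add s t hs ht => simp only [map_add, hs, ht]
  | tmul y z => simp [hg, hh]

theorem dpow_natural (F : B →ₐ[K] B') {g : Conv 𝒱 B} {g' : Conv 𝒲 B'}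
    (hg : ∀ x, F (g.ofConv x) = g'.ofConv (map f hf x)) (n : ℕ) (x : SymAlg 𝒱) :
    F ((dpow (K := K) g n).ofConv x) = (dpow (K := K) g' n).ofConv (map f hf x) := by
  have : ∀ x, F ((g ^ n).ofConv x) = (g' ^ n).ofConv (map f hf x) := by
    induction n with
    | zero =>
      intro x
      have hc : counit 𝒲 (map f hf x) = counit 𝒱 x := by
        have : (counit 𝒲).comp (map f hf) = counit 𝒱 := hom_ext fun a => by
          simp [map_ι, counit_ι]
        exact DFunLike.congr_fun this x
      rw [pow_zero, pow_zero, convOne_apply, convOne_apply, hc, AlgHom.commutes]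
    | succ n ih =>
      rw [pow_succ, pow_succ]
      exact conv_natural f hf F ih hg
  simp [dpow, this]

end Map

section DividedPowers

variable {K : Type u} [Field K] [CharZero K] {V : Type v} [AddCommGroup V] [Module K V]
  {𝒱 : ℤ → Submodule K V} [DirectSum.Decomposition 𝒱]
  {B : Type*} [Ring B] [Algebra K B] {a : V} (ha : a ∈ 𝒱 0)

include ha in
/-- The divided powers of a generator of degree zero form a group-like sequence. -/
theorem comulₗ_dpow_ι (n : ℕ) : comulₗ 𝒱 (dpow (K := K) (ι 𝒱 a) n) =
    ∑ p ∈ Finset.HasAntidiagonal.antidiagonal n,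
      dpow (K := K) (ι 𝒱 a) p.1 ⊗ₜ[K] dpow (K := K) (ι 𝒱 a) p.2 := by
  set L : Module.End K (SymAlg 𝒱) := LinearMap.mulLeft K (ι 𝒱 a) with hL
  set X : Module.End K (SymAlg 𝒱 ⊗[K] SymAlg 𝒱) := TensorProduct.map L 1 with hX
  set Y : Module.End K (SymAlg 𝒱 ⊗[K] SymAlg 𝒱) := TensorProduct.map 1 L with hY
  have hXY : Commute X Y := by
    change X * Y = Y * X
    rw [hX, hY, ← TensorProduct.map_mul, ← TensorProduct.map_mul, one_mul, mul_one]
  have hpow : ∀ k : ℕ, (L ^ k) 1 = ι 𝒱 a ^ k := fun k => by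
    rw [hL, LinearMap.pow_mulLeft, LinearMap.mulLeft_apply, mul_one]
  have hone : ∀ x : SymAlg 𝒱, (1 : Module.End K (SymAlg 𝒱)) x = x := fun _ => rfl
  have hcomul : ∀ k : ℕ, comulₗ 𝒱 (ι 𝒱 a ^ k) = ((X + Y) ^ k) (1 ⊗ₜ 1) := fun k => by
    induction k with
    | zero => rw [pow_zero, pow_zero, comulₗ_one]; rfl
    | succ k ih =>
      rw [pow_succ', comulₗ_ι_mul 𝒱 ha, twist_zero, ih, pow_succ', Module.End.mul_apply,
        LinearMap.add_apply]
      rfl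
  have hdpow : comulₗ 𝒱 (dpow (K := K) (ι 𝒱 a) n) = dpow (K := K) (X + Y) n (1 ⊗ₜ 1) := by
    rw [dpow, map_smul, hcomul]
    rfl
  rw [hdpow, dpow_add_of_commute hXY, LinearMap.sum_apply]
  refine Finset.sum_congr rfl fun p _ => ?_
  rw [dpow, dpow, hX, hY, TensorProduct.map_pow, TensorProduct.map_pow, one_pow, one_pow,
    Module.End.mul_apply, LinearMap.smul_apply, LinearMap.smul_apply, TensorProduct.map_tmul,
    map_smul, TensorProduct.map_tmul, hone, hone, hpow, hpow, dpow, dpow,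
    TensorProduct.smul_tmul_smul, smul_smul]

include ha in
theorem conv_apply_dpow_ι (f g : Conv 𝒱 B) (n : ℕ) :
    (f * g).ofConv (dpow (K := K) (ι 𝒱 a) n) =
      ∑ p ∈ Finset.HasAntidiagonal.antidiagonal n,
        f.ofConv (dpow (K := K) (ι 𝒱 a) p.1) * g.ofConv (dpow (K := K) (ι 𝒱 a) p.2) := by
  rw [conv_apply, comulₗ_dpow_ι ha, map_sum, map_sum]
  exact Finset.sum_congr rfl fun p _ => by simp

omit [CharZero K] [DirectSum.Decomposition 𝒱] in
theorem mono_replicate (n : ℕ) : mono 𝒱 (List.replicate n a) = ι 𝒱 a ^ n := by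
  simp [mono]

theorem dpow_extendZero_dpow_ι {r : V →ₗ[K] B}
    (hr : ∀ (i j : ℤ) (a b : V), a ∈ 𝒱 i → b ∈ 𝒱 j → r a * r b = ksign K (i * j) • (r b * r a))
    (k n : ℕ) : (dpow (K := K) (extendZero 𝒱 r) k).ofConv (dpow (K := K) (ι 𝒱 a) n) =
      if n = k then dpow (K := K) (r a) k else 0 := by
  rw [dpow.eq_1 (ι 𝒱 a), map_smul, ← mono_replicate, dpow_extendZero_mono hr, List.length_replicate]
  split_ifs with h
  · simp [h, dpow]
  · simp

end DividedPowers

end SymAlg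

/-! ### The components of the universal operations -/

namespace DiffCommAlg

open KoszulBraces.SymAlg WithConv

variable {K : Type u} [Field K] (A : DiffCommAlg K)

/-- The inclusion of `A` in its unitization. -/
abbrev toUnit : A →ₗ[K] Unitization K A := Unitization.inrHom K K A

theorem toUnit_swap (i j : ℤ) (a b : A) (ha : a ∈ A.gr i) (hb : b ∈ A.gr j) :
    A.toUnit a * A.toUnit b = ksign K (i * j) • (A.toUnit b * A.toUnit a) := by
  change (a : Unitization K A) * b = ksign K (i * j) • ((b : Unitization K A) * a)
  rw [← Unitization.inr_mul, A.mul_comm ha hb, Unitization.inr_smul, Unitization.inr_mul]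

/-- The differential of the unitization of `A`, which vanishes on the unit. -/
def ΔUnit : Unitization K A →ₗ[K] Unitization K A :=
  A.toUnit ∘ₗ A.Δ ∘ₗ Unitization.sndHom K K A

/-- The linear map `S(A) → K ⊕ A` that is the product on the `k`-th symmetric power of `A` and zero
on the other ones. -/
def prodMap (k : ℕ) : Conv A.gr (Unitization K A) := dpow (K := K) (extendZero A.gr A.toUnit) k

/-- The operation `a₁ ⋯ a_{i+j} ↦ ∑ ± Δ(a_{σ(1)} ⋯ a_{σ(j)}) a_{σ(j+1)} ⋯ a_{σ(j+i)}`, where the sum is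
over all unshuffles; it is zero on the other symmetric powers. -/
def koszulOp (i j : ℕ) : Conv A.gr (Unitization K A) :=
  toConv (A.ΔUnit ∘ₗ (A.prodMap j).ofConv) * A.prodMap i

section Natural

variable {A} {B : DiffCommAlg K} {f : A →ₗ[K] B} (hf : IsMorphism f)
  (hgr : ∀ i, ∀ a ∈ A.gr i, f a ∈ B.gr i)

/-- The unital map induced by a multiplicative map. -/
def unitMap (hf : IsMorphism f) : Unitization K A →ₐ[K] Unitization K B :=
  Unitization.lift
    { toFun := fun a => (f a : Unitization K B)
      map_smul' := fun c a => by simp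
      map_zero' := by simp
      map_add' := fun a b => by simp
      map_mul' := fun a b => by simp [hf.map_mul] }

theorem unitMap_inr (a : A) : unitMap hf (a : Unitization K A) = (f a : Unitization K B) := by
  simp [unitMap]

theorem snd_unitMap (u : Unitization K A) : (unitMap hf u).snd = f u.snd := by
  induction u using Unitization.ind with
  | inl_add_inr s a =>
    have h : unitMap hf (Unitization.inl s) = Unitization.inl s := (unitMap hf).commutes s
    rw [map_add, unitMap_inr, h]
    simp

theorem unitMap_ΔUnit (u : Unitization K A) : unitMap hf (A.ΔUnit u) = B.ΔUnit (unitMap hf u) := by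
  change unitMap hf (A.Δ u.snd : Unitization K A) = (B.Δ (unitMap hf u).snd : Unitization K B)
  rw [unitMap_inr, snd_unitMap, hf.map_Δ]

theorem prodMap_natural (k : ℕ) (x : SymAlg A.gr) :
    unitMap hf ((A.prodMap k).ofConv x) = (B.prodMap k).ofConv (SymAlg.map f hgr x) :=
  dpow_natural f hgr _ (fun x => by
    change unitMap hf (proj A.gr x : Unitization K A) =
      (proj B.gr (SymAlg.map f hgr x) : Unitization K B)
    rw [unitMap_inr, proj_map]) k x

theorem koszulOp_natural (i j : ℕ) (x : SymAlg A.gr) :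
    unitMap hf ((A.koszulOp i j).ofConv x) = (B.koszulOp i j).ofConv (SymAlg.map f hgr x) :=
  conv_natural f hgr _ (fun x => by
    change unitMap hf (A.ΔUnit ((A.prodMap j).ofConv x)) =
      B.ΔUnit ((B.prodMap j).ofConv (SymAlg.map f hgr x))
    rw [unitMap_ΔUnit, prodMap_natural]) (prodMap_natural hf hgr i) x

end Natural

theorem snd_prod_map_toUnit (l : List (ℤ × A)) (hl : ∀ p ∈ l, p.2 ∈ A.gr p.1) :
    (l.map fun p => A.toUnit p.2).prod.snd ∈ A.gr (l.map Prod.fst).sum := by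
  induction l with
  | nil => simp
  | cons p l ih =>
    have hp := hl p List.mem_cons_self
    have ih := ih fun q hq => hl q (List.mem_cons_of_mem _ hq)
    have hs : ∀ u : Unitization K A, (A.toUnit p.2 * u).snd = u.fst • p.2 + p.2 * u.snd := by
      intro u
      change (0 : K) • u.snd + u.fst • p.2 + p.2 * u.snd = _
      rw [zero_smul, zero_add]
    rw [List.map_cons, List.map_cons, List.prod_cons, List.sum_cons, hs]
    refine add_mem ?_ (A.mul_mem hp ih)
    cases l with
    | nil => simpa using hp
    | cons q l =>
      have : ((q :: l).map fun p => A.toUnit p.2).prod.fst = 0 := by simp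
      rw [this, zero_smul]
      exact zero_mem _

theorem prodMap_zero_ι_mul (a : A) (x : SymAlg A.gr) :
    (A.prodMap 0).ofConv (ι A.gr a * x) = 0 := dpow_extendZero_zero_ι_mul a x

theorem toUnit_mul_eq_inr (a : A) (u : Unitization K A) :
    A.toUnit a * u = A.toUnit (u.fst • a + a * u.snd) := by
  refine Unitization.ext ?_ ?_
  · simp
  · simp

variable {A} in
theorem ΔUnit_const_mul {n : ℤ} {c : A} (hc : A.IsConstant n c) (a : A) (u : Unitization K A) :
    A.ΔUnit (A.toUnit (c * a) * u) =
      ksign K n • (A.toUnit c * A.ΔUnit (A.toUnit a * u)) := by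
  have h : A.toUnit (c * a) * u = A.toUnit (c * (u.fst • a + a * u.snd)) := by
    rw [toUnit_mul_eq_inr, mul_add, mul_smul_comm, mul_assoc]
  rw [h, toUnit_mul_eq_inr A a u]
  change A.toUnit (A.Δ (c * (u.fst • a + a * u.snd))) =
    ksign K n • (A.toUnit c * A.toUnit (A.Δ (u.fst • a + a * u.snd)))
  rw [hc.2, map_smul]
  congr 1
  exact Unitization.inr_mul K _ _

variable [CharZero K]

theorem prodMap_mono (k : ℕ) (l : List A) :
    (A.prodMap k).ofConv (mono A.gr l) = if l.length = k then (l.map A.toUnit).prod else 0 :=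
  dpow_extendZero_mono A.toUnit_swap k l

theorem prodMap_ι_mul (k : ℕ) (a : A) (x : SymAlg A.gr) :
    (A.prodMap (k + 1)).ofConv (ι A.gr a * x) = A.toUnit a * (A.prodMap k).ofConv x :=
  dpow_extendZero_ι_mul A.toUnit_swap k a x

theorem snd_prodMap_mem (k : ℕ) {n : ℤ} {x : SymAlg A.gr} (hx : x ∈ SymAlg.gr A.gr n) :
    ((A.prodMap k).ofConv x).snd ∈ A.gr n := by
  induction hx using Submodule.span_induction with
  | zero => simp
  | add x y _ _ hx hy => rw [map_add]; exact add_mem hx hy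
  | smul c x _ hx => rw [map_smul]; exact Submodule.smul_mem _ _ hx
  | mem x hx =>
    obtain ⟨l, hl, rfl, rfl⟩ := hx
    have : (l.map fun p => ι A.gr p.2).prod = mono A.gr (l.map Prod.snd) := by
      simp [mono, Function.comp_def]
    rw [this, prodMap_mono, List.map_map]
    split_ifs with h
    · exact A.snd_prod_map_toUnit l hl
    · exact zero_mem _

theorem prodMap_apply_eq_zero {k n : ℕ} (h : n ≠ k) {x : SymAlg A.gr} (hx : x ∈ symPow A.gr n) :
    (A.prodMap k).ofConv x = 0 :=
  apply_eq_of_mem_symPow (g := 0) (fun l hl => by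
    rw [prodMap_mono, if_neg (by omega), LinearMap.zero_apply]) hx

theorem koszulOp_apply_eq_zero {i j n : ℕ} (h : n ≠ i + j) {x : SymAlg A.gr}
    (hx : x ∈ symPow A.gr n) : (A.koszulOp i j).ofConv x = 0 := by
  have := conv_mem (f := toConv (A.ΔUnit ∘ₗ (A.prodMap j).ofConv)) (g := A.prodMap i) ⊥
    (fun p q hpq y hy z hz => ?_) hx
  · exact this
  · rw [Submodule.mem_bot]
    by_cases hq : q = i
    · have hp : p ≠ j := by omega
      change A.ΔUnit ((A.prodMap j).ofConv y) * _ = 0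
      rw [A.prodMap_apply_eq_zero hp hy, map_zero, zero_mul]
    · rw [A.prodMap_apply_eq_zero hq hz, mul_zero]

variable {A} in
/-- The universal operations are graded linear over constants. -/
theorem koszulOp_const_mul {n m : ℤ} {c a : A} (hc : A.IsConstant n c) (ha : a ∈ A.gr m)
    (i j : ℕ) (x : SymAlg A.gr) :
    (A.koszulOp i j).ofConv (ι A.gr (c * a) * x) =
      ksign K n • (A.toUnit c * (A.koszulOp i j).ofConv (ι A.gr a * x)) := by
  set r := A.toUnit with hr
  set f := A.ΔUnit ∘ₗ (A.prodMap j).ofConv with hf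
  have hmul : r (c * a) = r c * r a := Unitization.inr_mul K c a
  have h1 : f ∘ₗ LinearMap.mulLeft K (ι A.gr (c * a)) =
      ksign K n • (LinearMap.mulLeft K (r c) ∘ₗ f ∘ₗ LinearMap.mulLeft K (ι A.gr a)) := by
    refine LinearMap.ext fun x => ?_
    simp only [hf, LinearMap.comp_apply, LinearMap.mulLeft_apply, LinearMap.smul_apply]
    cases j with
    | zero => simp only [prodMap_zero_ι_mul, map_zero, mul_zero, smul_zero]
    | succ j => rw [prodMap_ι_mul, prodMap_ι_mul, ΔUnit_const_mul hc]
  have h2 : (A.prodMap i).ofConv ∘ₗ LinearMap.mulLeft K (ι A.gr (c * a)) =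
      LinearMap.mulLeft K (r c) ∘ₗ (A.prodMap i).ofConv ∘ₗ LinearMap.mulLeft K (ι A.gr a) := by
    refine LinearMap.ext fun x => ?_
    simp only [LinearMap.comp_apply, LinearMap.mulLeft_apply]
    cases i with
    | zero => simp only [prodMap_zero_ι_mul, mul_zero]
    | succ i => rw [prodMap_ι_mul, prodMap_ι_mul, ← hr, hmul, mul_assoc]
  have h3 : toConv (f ∘ₗ twist (SymAlg.gr A.gr) (n + m)) *
      toConv (LinearMap.mulLeft K (r c) ∘ₗ (A.prodMap i).ofConv ∘ₗ
        LinearMap.mulLeft K (ι A.gr a)) =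
      toConv ((ksign K n • (LinearMap.mulLeft K (r c) ∘ₗ f ∘ₗ twist (SymAlg.gr A.gr) m))) *
        toConv ((A.prodMap i).ofConv ∘ₗ LinearMap.mulLeft K (ι A.gr a)) := by
    refine conv_congr fun p q x y hx hy => ?_
    simp only [LinearMap.comp_apply, LinearMap.smul_apply, LinearMap.mulLeft_apply,
      twist_of_mem _ _ hx, map_smul]
    have hfx : f x * r c = ksign K ((p + 1) * n) • (r c * f x) :=
      A.toUnit_swap _ _ _ _ (A.Δ_mem (A.snd_prodMap_mem j hx)) hc.1
    rw [← mul_assoc, smul_mul_assoc, hfx, smul_smul, smul_smul, smul_mul_assoc, smul_mul_assoc,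
      ← ksign_add, ← ksign_add]
    congr 1
    exact ksign_congr ⟨n * p, by ring⟩
  have h4 : ∀ (g : SymAlg A.gr →ₗ[K] Unitization K A) (h : Conv A.gr (Unitization K A)),
      toConv (ksign K n • (LinearMap.mulLeft K (r c) ∘ₗ g)) * h =
        ksign K n • toConv (LinearMap.mulLeft K (r c) ∘ₗ (toConv g * h).ofConv) := fun g h => by
    rw [← mulLeft_comp_conv, toConv_smul, smul_mul_assoc]
  rw [koszulOp, conv_apply_ι_mul _ _ (A.mul_mem hc.1 ha), conv_apply_ι_mul _ _ ha,
    ofConv_toConv, h1, h2, h3, h4, h4, mul_add, smul_add]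
  rfl

/-- The values of the universal operations on the powers of an element of degree zero. -/
theorem koszulOp_dpow_ι {a : A} (ha : a ∈ A.gr 0) (i j n : ℕ) :
    (A.koszulOp i j).ofConv (dpow (K := K) (ι A.gr a) n) = if n = i + j then
      A.ΔUnit (dpow (K := K) (A.toUnit a) j) * dpow (K := K) (A.toUnit a) i else 0 := by
  have hp : ∀ k n, (A.prodMap k).ofConv (dpow (K := K) (ι A.gr a) n) =
      if n = k then dpow (K := K) (A.toUnit a) k else 0 :=
    fun k n => dpow_extendZero_dpow_ι A.toUnit_swap k n
  rw [koszulOp, conv_apply_dpow_ι ha]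
  simp only [LinearMap.comp_apply, hp]
  split_ifs with h
  · rw [Finset.sum_eq_single (j, i)]
    · simp
    · rintro ⟨p, q⟩ _ hpq
      by_cases hp : p = j
      · have hq : q ≠ i := fun hq => hpq (by rw [hp, hq])
        simp [hq]
      · simp [hp]
    · intro hne
      exact (hne (Finset.HasAntidiagonal.mem_antidiagonal.2 (by simp only; omega))).elim
  · refine Finset.sum_eq_zero fun p hpq => ?_
    rw [Finset.HasAntidiagonal.mem_antidiagonal] at hpq
    by_cases hp : p.1 = j
    · have hq : p.2 ≠ i := by omega
      simp [hq]
    · simp [hp]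

end DiffCommAlg

namespace DiffCommAlg

open KoszulBraces.SymAlg WithConv

/-! ### Exterior algebras on two generators -/

section Exterior

open Quaternion QuaternionAlgebra

variable {K : Type u} [Field K] {R : Type u} [CommRing R] [Algebra K R]

/-- The projection of the exterior algebra `R⟨e, f⟩` to its part of degree `n`. -/
def extProj (K : Type u) [Field K] (R : Type u) [CommRing R] [Algebra K R] (n : ℤ) :
    ℍ[R,0,0,0] →ₗ[K] ℍ[R,0,0,0] where
  toFun x := ⟨if n = 0 then x.re else 0, if n = 1 then x.imI else 0, if n = 1 then x.imJ else 0,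
    if n = 2 then x.imK else 0⟩
  map_add' x y := by ext <;> simp <;> split_ifs <;> simp
  map_smul' c x := by ext <;> simp

/-- The part of degree `n` of the exterior algebra `R⟨e, f⟩`. -/
def extGr (K : Type u) [Field K] (R : Type u) [CommRing R] [Algebra K R] (n : ℤ) :
    Submodule K ℍ[R,0,0,0] where
  carrier := {x | (n ≠ 0 → x.re = 0) ∧ (n ≠ 1 → x.imI = 0) ∧ (n ≠ 1 → x.imJ = 0) ∧
    (n ≠ 2 → x.imK = 0)}
  add_mem' hx hy := ⟨fun h => by simp [hx.1 h, hy.1 h], fun h => by simp [hx.2.1 h, hy.2.1 h],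
    fun h => by simp [hx.2.2.1 h, hy.2.2.1 h], fun h => by simp [hx.2.2.2 h, hy.2.2.2 h]⟩
  zero_mem' := ⟨fun _ => rfl, fun _ => rfl, fun _ => rfl, fun _ => rfl⟩
  smul_mem' c x hx := ⟨fun h => by simp [hx.1 h], fun h => by simp [hx.2.1 h],
    fun h => by simp [hx.2.2.1 h], fun h => by simp [hx.2.2.2 h]⟩

theorem mem_extGr {n : ℤ} {x : ℍ[R,0,0,0]} : x ∈ extGr K R n ↔ (n ≠ 0 → x.re = 0) ∧
    (n ≠ 1 → x.imI = 0) ∧ (n ≠ 1 → x.imJ = 0) ∧ (n ≠ 2 → x.imK = 0) := Iff.rfl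

instance : DirectSum.Decomposition (extGr K R) :=
  decompositionOfProj (extGr K R) (extProj K R)
    (fun n x hx => by
      obtain ⟨h0, h1, h1', h2⟩ := hx
      ext <;> simp only [extProj, LinearMap.coe_mk, AddHom.coe_mk] <;> split_ifs with h
      exacts [rfl, (h0 h).symm, rfl, (h1 h).symm, rfl, (h1' h).symm, rfl, (h2 h).symm])
    (fun m n hmn x hx => by
      obtain ⟨h0, h1, h1', h2⟩ := hx
      ext <;> simp only [extProj, LinearMap.coe_mk, AddHom.coe_mk] <;> split_ifs with h
      exacts [h0 (by omega), rfl, h1 (by omega), rfl, h1' (by omega), rfl, h2 (by omega), rfl])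
    (eq_top_iff.2 fun x _ => by
      have hx : x = ⟨x.re, 0, 0, 0⟩ + ⟨0, x.imI, x.imJ, 0⟩ + ⟨0, 0, 0, x.imK⟩ := by ext <;> simp
      rw [hx]
      refine add_mem (add_mem (Submodule.mem_iSup_of_mem 0 ?_) (Submodule.mem_iSup_of_mem 1 ?_))
        (Submodule.mem_iSup_of_mem 2 ?_) <;> rw [mem_extGr] <;> simp)

/-- The exterior algebra `R⟨e, f⟩` on two generators of degree one over a commutative algebra `R`
in degree zero, encoded as a degenerate quaternion algebra with `i = e`, `j = f`, `k = e f`. The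
differential is `r ↦ D r e + E r f` in degree zero and `r e + s f ↦ N r e f` in degree one. -/
def exterior (D E N : R →ₗ[K] R) (h : ∀ r, N (D r) = 0) : DiffCommAlg K where
  carrier := ℍ[R,0,0,0]
  gr := extGr K R
  mul_mem := by
    intro i j x y hx hy
    obtain ⟨h0, h1, h1', h2⟩ := hx
    obtain ⟨g0, g1, g1', g2⟩ := hy
    have hi : i = 0 ∨ i = 1 ∨ i = 2 ∨ i ≠ 0 ∧ i ≠ 1 ∧ i ≠ 2 := by omega
    have hj : j = 0 ∨ j = 1 ∨ j = 2 ∨ j ≠ 0 ∧ j ≠ 1 ∧ j ≠ 2 := by omega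
    rcases hi with rfl | rfl | rfl | ⟨hi0, hi1, hi2⟩ <;>
      rcases hj with rfl | rfl | rfl | ⟨hj0, hj1, hj2⟩ <;>
      simp_all [mem_extGr]
  mul_comm := by
    intro i j x y hx hy
    obtain ⟨h0, h1, h1', h2⟩ := hx
    obtain ⟨g0, g1, g1', g2⟩ := hy
    have hi : i = 0 ∨ i = 1 ∨ i = 2 ∨ i ≠ 0 ∧ i ≠ 1 ∧ i ≠ 2 := by omega
    have hj : j = 0 ∨ j = 1 ∨ j = 2 ∨ j ≠ 0 ∧ j ≠ 1 ∧ j ≠ 2 := by omega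
    have e1 : ksign K 1 = -1 := by simp [ksign]
    have e2 : ksign K 2 = 1 := by simp [ksign, Int.negOnePow_def]
    rcases hi with rfl | rfl | rfl | ⟨hi0, hi1, hi2⟩ <;>
      rcases hj with rfl | rfl | rfl | ⟨hj0, hj1, hj2⟩ <;>
      ext <;> simp_all [ksign_zero, _root_.mul_comm]
  Δ :=
    { toFun := fun x => ⟨0, D x.re, E x.re, N x.imI⟩
      map_add' := fun x y => by ext <;> simp
      map_smul' := fun c x => by ext <;> simp }
  Δ_mem := by
    intro i x hx
    obtain ⟨h0, h1, h1', h2⟩ := hx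
    exact ⟨fun _ => rfl, fun h => by simp [h0 (by omega)], fun h => by simp [h0 (by omega)],
      fun h => by simp [h1 (by omega)]⟩
  Δ_Δ x := by
    ext <;> simp [h]

variable (D E N : R →ₗ[K] R) (h : ∀ r, N (D r) = 0)

/-- The elements of degree zero. -/
def scalar (r : R) : exterior D E N h := (r : ℍ[R,0,0,0])

theorem scalar_mem (r : R) : scalar D E N h r ∈ (exterior D E N h).gr 0 :=
  ⟨fun h => (h rfl).elim, fun _ => rfl, fun _ => rfl, fun _ => rfl⟩

end Exterior

end DiffCommAlg

namespace DiffCommAlg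

open KoszulBraces.SymAlg WithConv

/-! ### Generating functions -/

section Series

variable {K : Type u} [Field K] (A : DiffCommAlg K)

/-- The map `S(A) → K ⊕ A` that is `n! f_n` times the product on `S^n A`, for a power series
`f = ∑ f_n X^n`: the substitution of the projection `S(A) → A` in `f`. -/
def series (f : PowerSeries K) : Conv A.gr (Unitization K A) :=
  psum (extendZero A.gr A.toUnit) (locNilp (extendZero_apply_one _)) f

theorem series_mul (f g : PowerSeries K) : A.series (f * g) = A.series f * A.series g :=
  psum_mul _ _ f g

variable [CharZero K]

theorem extendZero_toUnit_pow_dpow_ι (a : A) (k n : ℕ) :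
    (extendZero A.gr A.toUnit ^ k).ofConv (dpow (K := K) (ι A.gr a) n) =
      if n = k then A.toUnit a ^ n else 0 := by
  have h := dpow_extendZero_dpow_ι (K := K) (𝒱 := A.gr) (a := a) A.toUnit_swap k n
  have hk : (k.factorial : K) ≠ 0 := Nat.cast_ne_zero.2 k.factorial_ne_zero
  rw [dpow.eq_1 (extendZero A.gr A.toUnit), ofConv_smul, LinearMap.smul_apply,
    inv_smul_eq_iff₀ hk] at h
  rw [h]
  split_ifs with hnk
  · rw [dpow, smul_smul, mul_inv_cancel₀ hk, one_smul, hnk]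
  · rw [smul_zero]

theorem series_dpow_ι (f : PowerSeries K) (a : A) (n : ℕ) :
    (A.series f).ofConv (dpow (K := K) (ι A.gr a) n) =
      PowerSeries.coeff n f • A.toUnit a ^ n := by
  refine (lsum_apply_eq_of_forall_ne ((locNilp (F := extendZero A.gr A.toUnit)
    (extendZero_apply_one _)).smul fun k => PowerSeries.coeff k f) n fun k hk => ?_).trans ?_
  · rw [LinearMap.smul_apply, extendZero_toUnit_pow_dpow_ι, if_neg (Ne.symm hk), smul_zero]
  · rw [LinearMap.smul_apply, extendZero_toUnit_pow_dpow_ι, if_pos rfl]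

end Series

/-! ### Evaluation in exterior algebras -/

section Evaluation

open Quaternion QuaternionAlgebra PowerSeries

variable {K : Type u} [Field K] {R : Type u} [CommRing R] [Algebra K R]
  (D E N : R →ₗ[K] R) (h : ∀ r, N (D r) = 0)

/-- The unit of the unitization of the exterior algebra is identified with the one it already
has. -/
def toExterior : Unitization K (exterior D E N h) →ₐ[K] ℍ[R,0,0,0] :=
  Unitization.lift (A := exterior D E N h) (C := ℍ[R,0,0,0]) (NonUnitalAlgHom.id K ℍ[R,0,0,0])

theorem toExterior_inr (a : exterior D E N h) :
    toExterior D E N h (a : Unitization K (exterior D E N h)) = a := by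
  change algebraMap K ℍ[R,0,0,0] 0 + (show ℍ[R,0,0,0] from a) = a
  rw [map_zero, zero_add]

/-- The value of `g` on the divided power `x^n / n!` of the degree zero generator given by `x : R`. -/
def extValue (x : R) (g : Conv (exterior D E N h).gr (Unitization K (exterior D E N h))) (n : ℕ) :
    ℍ[R,0,0,0] :=
  toExterior D E N h (g.ofConv (dpow (K := K) (ι (exterior D E N h).gr (scalar D E N h x)) n))

/-- The generating function `∑ σ (g (x^n / n!)) X^n` of the values of `g` on the divided powers of
the degree zero generator given by `x : R`. -/
def evalExterior (x : R) (σ : R →ₐ[K] K)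
    (g : Conv (exterior D E N h).gr (Unitization K (exterior D E N h))) : ℍ[K⟦X⟧,0,0,0] :=
  ⟨PowerSeries.mk fun n => σ (extValue D E N h x g n).re,
    PowerSeries.mk fun n => σ (extValue D E N h x g n).imI,
    PowerSeries.mk fun n => σ (extValue D E N h x g n).imJ,
    PowerSeries.mk fun n => σ (extValue D E N h x g n).imK⟩

variable {D E N h} (x : R) (σ : R →ₐ[K] K)

theorem extValue_add
    (f g : Conv (exterior D E N h).gr (Unitization K (exterior D E N h))) (n : ℕ) :
    extValue D E N h x (f + g) n = extValue D E N h x f n + extValue D E N h x g n := by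
  simp [extValue]

theorem evalExterior_add
    (f g : Conv (exterior D E N h).gr (Unitization K (exterior D E N h))) :
    evalExterior D E N h x σ (f + g) = evalExterior D E N h x σ f + evalExterior D E N h x σ g := by
  ext n <;> simp [evalExterior, extValue_add]

variable [CharZero K]

theorem extValue_mul
    (f g : Conv (exterior D E N h).gr (Unitization K (exterior D E N h))) (n : ℕ) :
    extValue D E N h x (f * g) n = ∑ p ∈ Finset.HasAntidiagonal.antidiagonal n,
      extValue D E N h x f p.1 * extValue D E N h x g p.2 := by
  rw [extValue, conv_apply_dpow_ι (scalar_mem D E N h x), map_sum]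
  simp only [map_mul, extValue]

theorem evalExterior_mul
    (f g : Conv (exterior D E N h).gr (Unitization K (exterior D E N h))) :
    evalExterior D E N h x σ (f * g) = evalExterior D E N h x σ f * evalExterior D E N h x σ g := by
  have hre : ∀ (s : Finset (ℕ × ℕ)) (v : ℕ × ℕ → ℍ[R,0,0,0]),
      (∑ p ∈ s, v p).re = ∑ p ∈ s, (v p).re := fun s v => map_sum (reₗ (0 : R) 0 0) v s
  have hI : ∀ (s : Finset (ℕ × ℕ)) (v : ℕ × ℕ → ℍ[R,0,0,0]),
      (∑ p ∈ s, v p).imI = ∑ p ∈ s, (v p).imI := fun s v => map_sum (imIₗ (0 : R) 0 0) v s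
  have hJ : ∀ (s : Finset (ℕ × ℕ)) (v : ℕ × ℕ → ℍ[R,0,0,0]),
      (∑ p ∈ s, v p).imJ = ∑ p ∈ s, (v p).imJ := fun s v => map_sum (imJₗ (0 : R) 0 0) v s
  have hK : ∀ (s : Finset (ℕ × ℕ)) (v : ℕ × ℕ → ℍ[R,0,0,0]),
      (∑ p ∈ s, v p).imK = ∑ p ∈ s, (v p).imK := fun s v => map_sum (imKₗ (0 : R) 0 0) v s
  ext n
  · simp [evalExterior, extValue_mul, hre, PowerSeries.coeff_mul]
  · simp [evalExterior, extValue_mul, hI, PowerSeries.coeff_mul, Finset.sum_add_distrib]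
  · simp [evalExterior, extValue_mul, hJ, PowerSeries.coeff_mul, Finset.sum_add_distrib]
  · simp [evalExterior, extValue_mul, hK, PowerSeries.coeff_mul, Finset.sum_add_distrib]

theorem extValue_series (f : K⟦X⟧) (n : ℕ) :
    extValue D E N h x ((exterior D E N h).series f) n = ((coeff n f • x ^ n : R) : ℍ[R,0,0,0]) := by
  have hpow : ∀ k : ℕ, toExterior D E N h ((exterior D E N h).toUnit (scalar D E N h x) ^ k) =
      (x ^ k : R) := fun k => by
    induction k with
    | zero => rw [pow_zero, pow_zero, map_one, QuaternionAlgebra.coe_one]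
    | succ k ih =>
      rw [pow_succ, map_mul, ih, pow_succ, QuaternionAlgebra.coe_mul]
      congr 1
      exact toExterior_inr D E N h _
  rw [extValue, series_dpow_ι, map_smul, hpow, QuaternionAlgebra.coe_smul]

theorem evalExterior_series (f : K⟦X⟧) :
    evalExterior D E N h x σ ((exterior D E N h).series f) = (rescale (σ x) f : K⟦X⟧) := by
  ext n <;> simp only [evalExterior, extValue_series, re_coe, imI_coe, imJ_coe, imK_coe, coeff_mk,
    coeff_rescale, map_smul, map_pow, smul_eq_mul, map_zero]
  rw [_root_.mul_comm]

end Evaluation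

end DiffCommAlg

namespace DiffCommAlg

open KoszulBraces.SymAlg WithConv

/-! ### Natural operations are determined by their values on powers in degree zero -/

section Determination

variable {K : Type u} [Field K]

/-- The coefficients of a vector-valued polynomial function on an infinite field are unique. -/
theorem eq_zero_of_sum_pow_smul_eq_zero [Infinite K] {N : Type*} [AddCommGroup N] [Module K N]
    (v : ℕ → N) (n : ℕ) (h : ∀ t : K, ∑ i ∈ Finset.range n, t ^ i • v i = 0) {i : ℕ} (hi : i < n) :
    v i = 0 := by
  refine (Module.forall_dual_apply_eq_zero_iff K (v i)).1 fun φ => ?_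
  set p : Polynomial K := ∑ j ∈ Finset.range n, Polynomial.monomial j (φ (v j)) with hp
  have h0 : p = 0 := Polynomial.funext fun t => by
    have := congrArg φ (h t)
    simp only [map_sum, map_smul, smul_eq_mul, map_zero] at this
    rw [hp, Polynomial.eval_finsetSum, Polynomial.eval_zero, ← this]
    exact Finset.sum_congr rfl fun j _ => by rw [Polynomial.eval_monomial, _root_.mul_comm]
  have := congrArg (fun q => Polynomial.coeff q i) h0
  simpa [hp, Polynomial.finsetSum_coeff, Polynomial.coeff_monomial, hi] using this

/-- The families of linear maps `S(A) → A` whose restrictions to `S^k A` are natural for the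
morphisms of degree zero and graded linear over constants, for operations of degree `d`. -/
def universal (K : Type u) [Field K] (k : ℕ) (d : ℤ) :
    Submodule K ((A : DiffCommAlg K) → SymAlg A.gr →ₗ[K] A) where
  carrier := {Γ |
    (∀ (A B : DiffCommAlg K) (f : A →ₗ[K] B), IsMorphism f →
      (∀ i, ∀ a ∈ A.gr i, f a ∈ B.gr i) → ∀ l : List A, l.length = k →
        f (Γ A (mono A.gr l)) = Γ B (mono B.gr (l.map f))) ∧
    ∀ (A : DiffCommAlg K) (n m : ℤ) (c a : A), A.IsConstant n c → a ∈ A.gr m →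
      ∀ l : List A, l.length + 1 = k →
        Γ A (ι A.gr (c * a) * mono A.gr l) =
          ksign K (d * n) • (c * Γ A (ι A.gr a * mono A.gr l))}
  add_mem' := fun {Γ Γ'} h h' => ⟨fun A B f hf hgr l hl => by
      simp only [Pi.add_apply, LinearMap.add_apply, map_add, h.1 A B f hf hgr l hl,
        h'.1 A B f hf hgr l hl],
    fun A n m c a hc ha l hl => by
      simp only [Pi.add_apply, LinearMap.add_apply, mul_add, smul_add, h.2 A n m c a hc ha l hl,
        h'.2 A n m c a hc ha l hl]⟩
  zero_mem' := ⟨fun _ _ _ _ _ _ _ => by simp, fun _ _ _ _ _ _ _ _ _ => by simp⟩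
  smul_mem' := fun s Γ h => ⟨fun A B f hf hgr l hl => by
      simp only [Pi.smul_apply, LinearMap.smul_apply, map_smul, h.1 A B f hf hgr l hl],
    fun A n m c a hc ha l hl => by
      simp only [Pi.smul_apply, LinearMap.smul_apply, h.2 A n m c a hc ha l hl, mul_smul_comm,
        smul_comm s]⟩

variable {k : ℕ} {d : ℤ} {Γ : (A : DiffCommAlg K) → SymAlg A.gr →ₗ[K] A}

theorem commute_ι_of_mem_zero {A : DiffCommAlg K} {a b : A} (ha : a ∈ A.gr 0) {i : ℤ}
    (hb : b ∈ A.gr i) : Commute (ι A.gr a) (ι A.gr b) := by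
  change _ * _ = _ * _
  rw [ι_swap A.gr ha hb, zero_mul, ksign_zero, one_smul]

theorem commute_ι_mono {A : DiffCommAlg K} {a : A} {i : ℤ} (ha : a ∈ A.gr i) (l : List A)
    (hl : ∀ b ∈ l, b ∈ A.gr 0) : Commute (ι A.gr a) (mono A.gr l) := by
  induction l with
  | nil => exact Commute.one_right _
  | cons b l ih =>
    rw [mono_cons]
    exact (commute_ι_of_mem_zero (hl b List.mem_cons_self) ha).symm.mul_right
      (ih fun c hc => hl c (List.mem_cons_of_mem _ hc))

/-- Polarization: the coefficient of `t` in `(a + t b)^{n+1}` is `(n + 1) a^n b`. -/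
theorem apply_mono_mul_pow_eq_zero [CharZero K] {A : DiffCommAlg K} (γ : SymAlg A.gr →ₗ[K] A)
    (hγ : ∀ a ∈ A.gr 0, γ (ι A.gr a ^ k) = 0) (l : List A) (hl : ∀ b ∈ l, b ∈ A.gr 0) (n : ℕ)
    (hn : l.length + n = k) (a : A) (ha : a ∈ A.gr 0) : γ (mono A.gr l * ι A.gr a ^ n) = 0 := by
  induction l generalizing n a with
  | nil =>
    rw [mono_nil, one_mul, ← hγ a ha, ← hn, List.length_nil, zero_add]
  | cons b l ih =>
    have hb : b ∈ A.gr 0 := hl b List.mem_cons_self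
    have hl' : ∀ c ∈ l, c ∈ A.gr 0 := fun c hc => hl c (List.mem_cons_of_mem _ hc)
    rw [List.length_cons] at hn
    have hsum : ∀ t : K, ∑ i ∈ Finset.range (n + 1 + 1), t ^ i • γ (mono A.gr l *
        (ι A.gr b ^ i * ι A.gr a ^ (n + 1 - i) * ((n + 1).choose i : SymAlg A.gr))) = 0 := by
      intro t
      have hab : Commute (t • ι A.gr b) (ι A.gr a) :=
        (commute_ι_of_mem_zero hb ha).smul_left t
      have := ih hl' (n + 1) (by omega) (t • b + a)
        (add_mem (Submodule.smul_mem _ _ hb) ha)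
      rw [map_add, map_smul, hab.add_pow, Finset.mul_sum, map_sum] at this
      rw [← this]
      refine Finset.sum_congr rfl fun i _ => ?_
      rw [smul_pow, smul_mul_assoc, smul_mul_assoc, mul_smul_comm, map_smul]
    have h1 := eq_zero_of_sum_pow_smul_eq_zero _ _ hsum (show 1 < n + 1 + 1 by omega)
    have hcast : ((n + 1 : ℕ) : SymAlg A.gr) = algebraMap K _ ((n + 1 : ℕ) : K) :=
      (map_natCast _ _).symm
    rw [pow_one, Nat.choose_one_right, Nat.add_sub_cancel, hcast, ← Algebra.commutes,
      ← Algebra.smul_def, mul_smul_comm, map_smul, smul_eq_zero] at h1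
    rw [mono_cons, (commute_ι_mono hb l hl').eq, mul_assoc]
    exact h1.resolve_left (Nat.cast_ne_zero.2 n.succ_ne_zero)

/-- A factor of degree `i` is made a factor of degree zero by multiplying it by an adjoined constant
of degree `-i`. -/
theorem apply_mono_mul_mono_eq_zero [CharZero K] (hΓ : Γ ∈ universal K k d)
    (h : ∀ (A : DiffCommAlg K), ∀ a ∈ A.gr 0, Γ A (ι A.gr a ^ k) = 0) (l' : List ℤ)
    (A : DiffCommAlg K) (l₁ : List A) (hl₁ : ∀ b ∈ l₁, b ∈ A.gr 0) (l₂ : List (ℤ × A))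
    (hl₂ : ∀ p ∈ l₂, p.2 ∈ A.gr p.1) (hl' : l₂.map Prod.fst = l')
    (hk : l₁.length + l₂.length = k) :
    Γ A (mono A.gr l₁ * mono A.gr (l₂.map Prod.snd)) = 0 := by
  induction l' generalizing A l₁ l₂ with
  | nil =>
    rw [List.map_eq_nil_iff] at hl'
    subst hl'
    have := apply_mono_mul_pow_eq_zero (Γ A) (h A) l₁ hl₁ 0 hk 0 (zero_mem _)
    simpa using this
  | cons i l' ih =>
    cases l₂ with
    | nil => simp at hl'
    | cons p l₂ =>
      obtain ⟨i, a⟩ := p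
      rw [List.map_cons, List.cons.injEq] at hl'
      have ha : a ∈ A.gr i := hl₂ (i, a) List.mem_cons_self
      set T := constExt A (-i) with hT
      set j := toConstExt A (-i) with hj
      set c := adjoined A (-i) with hc
      have hjm := isMorphism_toConstExt A (-i)
      have hjgr := toConstExt_mem A (-i)
      have hca : c * j a ∈ T.gr 0 := by
        have := T.mul_mem (isConstant_adjoined A (-i)).1 (hjgr i a ha)
        rwa [neg_add_cancel] at this
      set rest := l₁ ++ l₂.map Prod.snd with hrest
      have hmono : ∀ b : T, mono T.gr (b :: l₁.map j) * mono T.gr ((l₂.map Prod.snd).map j) =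
          ι T.gr b * mono T.gr (rest.map j) := fun b => by
        rw [mono_cons, mul_assoc, hrest, List.map_append]
        simp [mono]
      have hlen : rest.length + 1 = k := by
        rw [hrest, ← hk]
        simp only [List.length_append, List.length_map, List.length_cons]
        omega
      have key := ih T (c * j a :: l₁.map j) (by
          intro b hb
          rcases List.mem_cons.1 hb with rfl | hb
          · exact hca
          · obtain ⟨b, hb', rfl⟩ := List.mem_map.1 hb
            exact hjgr 0 b (hl₁ b hb'))
        (l₂.map fun p => (p.1, j p.2)) (by
          intro q hq
          obtain ⟨p, hp, rfl⟩ := List.mem_map.1 hq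
          exact hjgr p.1 p.2 (hl₂ p (List.mem_cons_of_mem _ hp)))
        (by rw [← hl'.2]; simp [Function.comp_def]) (by
          rw [← hk]
          simp only [List.length_map, List.length_cons]
          omega)
      have hmap : (l₂.map fun p => (p.1, j p.2)).map Prod.snd = (l₂.map Prod.snd).map j := by
        simp [Function.comp_def]
      rw [hmap, hmono, hΓ.2 T _ _ c (j a) (isConstant_adjoined A (-i)) (hjgr i a ha) _
        (by rw [List.length_map, hlen]), smul_eq_zero] at key
      have key := key.resolve_left (ksign_ne_zero _)
      have hnat := hΓ.1 A T j hjm hjgr (a :: rest) hlen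
      rw [List.map_cons, mono_cons, mono_cons] at hnat
      rw [← hnat] at key
      have hfin := adjoined_mul_toConstExt_eq_zero key
      rw [← hfin, List.map_cons, mono_cons, ← mul_assoc, ← (commute_ι_mono ha l₁ hl₁).eq,
        mul_assoc, hrest]
      simp [mono]

/-- A natural operation is zero if it vanishes on the powers of elements of degree zero. -/
theorem universal_apply_mono_eq_zero [CharZero K] (hΓ : Γ ∈ universal K k d)
    (h : ∀ (A : DiffCommAlg K), ∀ a ∈ A.gr 0, Γ A (ι A.gr a ^ k) = 0) (A : DiffCommAlg K)
    {l : List A} (hl : l.length = k) : Γ A (mono A.gr l) = 0 :=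
  apply_mono_eq_zero (Γ A) (fun l hl hlk => by
    have := apply_mono_mul_mono_eq_zero hΓ h _ A [] (by simp) l hl rfl (by simpa using hlk)
    rwa [mono_nil, one_mul] at this) hl

theorem mem_universal_of_isNatural
    {β : (A : DiffCommAlg K) → MultilinearMap K (fun _ : Fin k => A) A} (hβ : IsNatural k d β)
    (hΓ : ∀ A a, β A a = Γ A (mono A.gr (List.ofFn a))) : Γ ∈ universal K k d := by
  refine ⟨fun A B f hf _ l hl => ?_, fun A n m c a hc _ l hl => ?_⟩
  · subst hl
    have := hβ.natural A B f hf l.get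
    rw [hΓ, hΓ, List.ofFn_get] at this
    rw [this]
    congr 2
    conv_rhs => rw [← List.ofFn_get l, List.map_ofFn]
    rfl
  · subst hl
    have := hβ.linear_const A n c hc (Fin.cons a l.get) 0 rfl
    rw [hΓ, hΓ, Fin.cons_zero, Fin.update_cons_zero, List.ofFn_cons, List.ofFn_cons,
      List.ofFn_get, mono_cons, mono_cons] at this
    exact this

end Determination

end DiffCommAlg

namespace DiffCommAlg

open KoszulBraces.SymAlg WithConv

/-! ### The universal operations on powers -/

section Diagonal

variable {K : Type u} [Field K] (A : DiffCommAlg K)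

/-- The power `a^{j+1}`. -/
def powSucc (a : A) (j : ℕ) : A := (LinearMap.mulLeft K a ^ j) a

/-- The element `a^i Δ(a^{j+1})`. -/
def powMulΔ (a : A) (p : ℕ × ℕ) : A := (LinearMap.mulLeft K a ^ p.1) (A.Δ (A.powSucc a p.2))

variable {A}

theorem mulLeft_pow_mul (a y z : A) (j : ℕ) :
    (LinearMap.mulLeft K a ^ j) y * z = (LinearMap.mulLeft K a ^ j) (y * z) := by
  induction j with
  | zero => rfl
  | succ j ih =>
    rw [pow_succ', Module.End.mul_apply, Module.End.mul_apply, LinearMap.mulLeft_apply,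
      LinearMap.mulLeft_apply, mul_assoc, ih]

theorem powSucc_mul (a z : A) (j : ℕ) :
    A.powSucc a j * z = (LinearMap.mulLeft K a ^ (j + 1)) z := by
  rw [powSucc, mulLeft_pow_mul, pow_succ, Module.End.mul_apply, LinearMap.mulLeft_apply]

theorem mulLeft_pow_mem {a : A} (ha : a ∈ A.gr 0) {i : ℤ} {z : A} (hz : z ∈ A.gr i) (j : ℕ) :
    (LinearMap.mulLeft K a ^ j) z ∈ A.gr i := by
  induction j with
  | zero => exact hz
  | succ j ih =>
    rw [pow_succ', Module.End.mul_apply, LinearMap.mulLeft_apply]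
    simpa using A.mul_mem ha ih

theorem powSucc_mem {a : A} (ha : a ∈ A.gr 0) (j : ℕ) : A.powSucc a j ∈ A.gr 0 :=
  mulLeft_pow_mem ha ha j

theorem powMulΔ_mem {a : A} (ha : a ∈ A.gr 0) (p : ℕ × ℕ) : A.powMulΔ a p ∈ A.gr 1 :=
  mulLeft_pow_mem ha (by simpa using A.Δ_mem (powSucc_mem ha p.2)) p.1

theorem map_mulLeft_pow {B : DiffCommAlg K} {f : A →ₗ[K] B} (hf : IsMorphism f) (a z : A) (j : ℕ) :
    f ((LinearMap.mulLeft K a ^ j) z) = (LinearMap.mulLeft K (f a) ^ j) (f z) := by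
  induction j with
  | zero => rfl
  | succ j ih =>
    rw [pow_succ', Module.End.mul_apply, LinearMap.mulLeft_apply, hf.map_mul, ih, pow_succ',
      Module.End.mul_apply, LinearMap.mulLeft_apply]

theorem map_powSucc {B : DiffCommAlg K} {f : A →ₗ[K] B} (hf : IsMorphism f) (a : A) (j : ℕ) :
    f (A.powSucc a j) = B.powSucc (f a) j := map_mulLeft_pow hf a a j

theorem map_powMulΔ {B : DiffCommAlg K} {f : A →ₗ[K] B} (hf : IsMorphism f) (a : A) (p : ℕ × ℕ) :
    f (A.powMulΔ a p) = B.powMulΔ (f a) p := by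
  rw [powMulΔ, map_mulLeft_pow hf, hf.map_Δ, map_powSucc hf]
  rfl

theorem mulLeft_smul_pow (a z : A) (t : K) (j : ℕ) :
    (LinearMap.mulLeft K (t • a) ^ j) z = t ^ j • (LinearMap.mulLeft K a ^ j) z := by
  induction j with
  | zero => simp
  | succ j ih =>
    rw [pow_succ', Module.End.mul_apply, ih, map_smul, LinearMap.mulLeft_apply, smul_mul_assoc,
      smul_smul, pow_succ' (LinearMap.mulLeft K a), Module.End.mul_apply, LinearMap.mulLeft_apply,
      pow_succ]

theorem powSucc_smul (a : A) (t : K) (j : ℕ) :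
    A.powSucc (t • a) j = t ^ (j + 1) • A.powSucc a j := by
  rw [powSucc, mulLeft_smul_pow, map_smul, smul_smul, pow_succ]
  rfl

theorem powMulΔ_smul (a : A) (t : K) (p : ℕ × ℕ) :
    A.powMulΔ (t • a) p = t ^ (p.1 + p.2 + 1) • A.powMulΔ a p := by
  rw [powMulΔ, powSucc_smul, mulLeft_smul_pow, map_smul, map_smul, smul_smul, ← pow_add,
    add_assoc]
  rfl

/-- The subspaces spanned by the `a^{j+1}` in degree `0` and by the `a^i Δ(a^{j+1})` in degree `1`,
with all elements in higher degrees. They form the smallest subalgebra containing `a` that need not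
be small in degrees greater than one. -/
def genGr (a : A) (n : ℤ) : Submodule K A :=
  if n < 0 then ⊥ else if n = 0 then Submodule.span K (Set.range (A.powSucc a)) else
    if n = 1 then Submodule.span K (Set.range (A.powMulΔ a)) else A.gr n

theorem genGr_of_neg (a : A) {n : ℤ} (hn : n < 0) : genGr a n = ⊥ := if_pos hn
theorem genGr_zero (a : A) : genGr a 0 = Submodule.span K (Set.range (A.powSucc a)) := by
  simp [genGr]
theorem genGr_one (a : A) : genGr a 1 = Submodule.span K (Set.range (A.powMulΔ a)) := by
  simp [genGr]
theorem genGr_of_one_lt (a : A) {n : ℤ} (hn : 1 < n) : genGr a n = A.gr n := by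
  rw [genGr, if_neg (by omega), if_neg (by omega), if_neg (by omega)]

variable {a : A} (ha : a ∈ A.gr 0)

include ha

theorem genGr_le (n : ℤ) : genGr a n ≤ A.gr n := by
  rcases lt_or_ge n 0 with hn | hn
  · rw [genGr_of_neg a hn]
    exact bot_le
  · obtain rfl | rfl | hn : n = 0 ∨ n = 1 ∨ 1 < n := by omega
    · rw [genGr_zero, Submodule.span_le]
      rintro _ ⟨j, rfl⟩
      exact powSucc_mem ha j
    · rw [genGr_one, Submodule.span_le]
      rintro _ ⟨p, rfl⟩
      exact powMulΔ_mem ha p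
    · rw [genGr_of_one_lt a hn]

omit ha in
theorem genGr_zero_mul {n : ℤ} (hn : n = 0 ∨ n = 1) {x y : A} (hx : x ∈ genGr a 0)
    (hy : y ∈ genGr a n) : x * y ∈ genGr a n := by
  rw [genGr_zero] at hx
  induction hx using Submodule.span_induction with
  | zero => rw [zero_mul]; exact zero_mem _
  | add x x' _ _ hx hx' => rw [add_mul]; exact add_mem hx hx'
  | smul c x _ hx => rw [smul_mul_assoc]; exact Submodule.smul_mem _ c hx
  | mem x hx =>
    obtain ⟨j, rfl⟩ := hx
    rw [powSucc_mul]
    rcases hn with rfl | rfl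
    · rw [genGr_zero] at hy ⊢
      induction hy using Submodule.span_induction with
      | zero => rw [map_zero]; exact zero_mem _
      | add x x' _ _ hx hx' => rw [map_add]; exact add_mem hx hx'
      | smul c x _ hx => rw [map_smul]; exact Submodule.smul_mem _ c hx
      | mem y hy =>
        obtain ⟨i, rfl⟩ := hy
        refine Submodule.subset_span ⟨j + 1 + i, ?_⟩
        rw [powSucc, pow_add, Module.End.mul_apply]
        rfl
    · rw [genGr_one] at hy ⊢
      induction hy using Submodule.span_induction with
      | zero => rw [map_zero]; exact zero_mem _
      | add x x' _ _ hx hx' => rw [map_add]; exact add_mem hx hx'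
      | smul c x _ hx => rw [map_smul]; exact Submodule.smul_mem _ c hx
      | mem y hy =>
        obtain ⟨p, rfl⟩ := hy
        refine Submodule.subset_span ⟨(j + 1 + p.1, p.2), ?_⟩
        rw [powMulΔ, pow_add, Module.End.mul_apply]
        rfl

theorem genGr_mul (i j : ℤ) : ∀ x ∈ genGr a i, ∀ y ∈ genGr a j, x * y ∈ genGr a (i + j) := by
  intro x hx y hy
  rcases lt_or_ge i 0 with hi | hi
  · rw [genGr_of_neg a hi, Submodule.mem_bot] at hx
    rw [hx, zero_mul]
    exact zero_mem _
  rcases lt_or_ge j 0 with hj | hj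
  · rw [genGr_of_neg a hj, Submodule.mem_bot] at hy
    rw [hy, mul_zero]
    exact zero_mem _
  rcases lt_or_ge 1 (i + j) with hij | hij
  · rw [genGr_of_one_lt a hij]
    exact A.mul_mem (genGr_le ha i hx) (genGr_le ha j hy)
  · obtain rfl | ⟨rfl, rfl⟩ : i = 0 ∨ i = 1 ∧ j = 0 := by omega
    · rw [zero_add]
      exact genGr_zero_mul (by omega) hx hy
    · rw [A.mul_comm (genGr_le ha 1 hx) (genGr_le ha 0 hy), mul_zero, ksign_zero, one_smul,
        add_zero]
      exact genGr_zero_mul (Or.inr rfl) hy hx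

theorem Δ_genGr (i : ℤ) : ∀ x ∈ genGr a i, A.Δ x ∈ genGr a (i + 1) := by
  intro x hx
  rcases lt_or_ge i 0 with hi | hi
  · rw [genGr_of_neg a hi, Submodule.mem_bot] at hx
    rw [hx, map_zero]
    exact zero_mem _
  obtain rfl | hi : i = 0 ∨ 0 < i := by omega
  · rw [genGr_zero] at hx
    rw [zero_add, genGr_one]
    induction hx using Submodule.span_induction with
    | zero => rw [map_zero]; exact zero_mem _
    | add x x' _ _ hx hx' => rw [map_add]; exact add_mem hx hx'
    | smul c x _ hx => rw [map_smul]; exact Submodule.smul_mem _ c hx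
    | mem x hx =>
      obtain ⟨j, rfl⟩ := hx
      exact Submodule.subset_span ⟨(0, j), rfl⟩
  · rw [genGr_of_one_lt a (by omega)]
    exact A.Δ_mem (genGr_le ha i hx)

/-- By naturality, the value of a natural operation at `(a, …, a)` lies in the subalgebra generated
by `a`, up to elements of degree greater than one. -/
theorem apply_const_mem_genGr {k : ℕ} {d : ℤ}
    {β : (A : DiffCommAlg K) → MultilinearMap K (fun _ : Fin k => A) A} (hβ : IsNatural k d β) :
    β A (fun _ => a) ∈ genGr a d := by
  have hmem : a ∈ genGr a 0 := by
    rw [genGr_zero]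
    exact Submodule.subset_span ⟨0, rfl⟩
  set S := sub A (genGr a) (genGr_le ha) (genGr_mul ha) (Δ_genGr ha) with hS
  set b : S := ⟨a, Submodule.mem_iSup_of_mem (p := genGr a) 0 hmem⟩ with hb
  have hb0 : b ∈ S.gr 0 := hmem
  have h1 := hβ.degree S (fun _ => 0) (fun _ => b) fun _ => hb0
  have h2 := hβ.natural S A _
    (isMorphism_subtype A (genGr a) (genGr_le ha) (genGr_mul ha) (Δ_genGr ha)) fun _ => b
  rw [Finset.sum_const_zero, zero_add] at h1
  have h3 : β A (fun _ => a) = (β S fun _ => b).1 := h2.symm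
  rw [h3]
  exact h1

end Diagonal

/-- Universality of the coefficients. If the value of a natural operation at `(a, …, a)` is always a
linear combination of certain natural expressions `E a i` in `a`, and the `E x i` are linearly
independent for some element `x` of some algebra `W`, then the coefficients do not depend on
`a`. -/
theorem exists_coeff {K : Type u} [Field K] [CharZero K] {k : ℕ} {d : ℤ}
    {β : (A : DiffCommAlg K) → MultilinearMap K (fun _ : Fin k => A) A} (hβ : IsNatural k d β)
    {I : Type*} [DecidableEq I] (E : (A : DiffCommAlg K) → A → I → A) (w : I → ℕ)
    (hE : ∀ (A B : DiffCommAlg K) (f : A →ₗ[K] B), IsMorphism f → ∀ a i, f (E A a i) = E B (f a) i)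
    (hw : ∀ (A : DiffCommAlg K) (t : K) (a : A) (i : I), E A (t • a) i = t ^ w i • E A a i)
    (hmem : ∀ (A : DiffCommAlg K), ∀ a ∈ A.gr 0,
      β A (fun _ => a) ∈ Submodule.span K (Set.range (E A a)))
    (W : DiffCommAlg K) (x : W) (hx : x ∈ W.gr 0) (χ : I → W →ₗ[K] K)
    (hχ : ∀ i j, χ i (E W x j) = if i = j then 1 else 0) :
    ∃ c : I →₀ K, (∀ i, c i ≠ 0 → w i = k) ∧
      ∀ (A : DiffCommAlg K), ∀ a ∈ A.gr 0, β A (fun _ => a) = c.sum fun i s => s • E A a i := by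
  have hχsum : ∀ (c : I →₀ K) (i : I), χ i (c.sum fun j s => s • E W x j) = c i := fun c i => by
    rw [Finsupp.sum, map_sum]
    simp only [map_smul, hχ, smul_eq_mul, mul_ite, mul_one, mul_zero, Finset.sum_ite_eq]
    split_ifs with h
    · rfl
    · exact (Finsupp.notMem_support_iff.1 h).symm
  -- The coefficients for `a` and for `x` agree, since both are the ones for `(a, x)` in `A × W`.
  obtain ⟨c, hc⟩ := Finsupp.mem_span_range_iff_exists_finsupp.1 (hmem W x hx)
  have hall : ∀ (A : DiffCommAlg K), ∀ a ∈ A.gr 0,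
      β A (fun _ => a) = c.sum fun i s => s • E A a i := by
    intro A a ha
    obtain ⟨P, p, q, y, hp, hq, hy, rfl, rfl⟩ : ∃ (P : DiffCommAlg K) (p : P →ₗ[K] A)
        (q : P →ₗ[K] W) (y : P), IsMorphism p ∧ IsMorphism q ∧ y ∈ P.gr 0 ∧ p y = a ∧ q y = x :=
      ⟨prod A W, LinearMap.fst K A W, LinearMap.snd K A W, (a, x), isMorphism_fst A W,
        isMorphism_snd A W, ⟨ha, hx⟩, rfl, rfl⟩
    obtain ⟨c', hc'⟩ := Finsupp.mem_span_range_iff_exists_finsupp.1 (hmem P y hy)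
    have h1 := hβ.natural _ _ _ hp fun _ => y
    have h2 := hβ.natural _ _ _ hq fun _ => y
    have hcc : c' = c := by
      ext i
      rw [← hχsum c', ← hχsum c, hc, ← h2, ← hc', Finsupp.sum, Finsupp.sum, map_sum q]
      simp only [map_smul, hE _ _ _ hq]
    rw [← h1, ← hc', hcc, Finsupp.sum, Finsupp.sum, map_sum]
    simp only [map_smul, hE _ _ _ hp]
  refine ⟨c, fun i hi => ?_, hall⟩
  -- Homogeneity: replace `x` by `2 x`.
  have h2 := hall W ((2 : K) • x) (Submodule.smul_mem _ _ hx)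
  have h3 : β W (fun _ => (2 : K) • x) = (2 : K) ^ k • β W fun _ => x := by
    have := (β W).map_smul_univ (fun _ => (2 : K)) fun _ => x
    simpa using this
  rw [h3, hall W x hx] at h2
  have h4 := congrArg (χ i) h2
  rw [map_smul, hχsum] at h4
  have h5 : χ i (c.sum fun j s => s • E W ((2 : K) • x) j) = c i * 2 ^ w i := by
    rw [Finsupp.sum, map_sum]
    simp only [hw, map_smul, hχ, smul_eq_mul, mul_ite, mul_one, mul_zero, Finset.sum_ite_eq]
    split_ifs with h
    · rfl
    · exact (h (Finsupp.mem_support_iff.2 hi)).elim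
  rw [h5, smul_eq_mul, _root_.mul_comm] at h4
  have h6 : (2 : K) ^ k = 2 ^ w i := mul_left_cancel₀ hi h4
  exact_mod_cast (Nat.pow_right_injective le_rfl (by exact_mod_cast h6 : 2 ^ k = 2 ^ w i)).symm

end DiffCommAlg

namespace DiffCommAlg

open KoszulBraces.SymAlg WithConv

/-! ### An algebra with independent universal expressions -/

section Independent

open Quaternion QuaternionAlgebra

variable {K : Type u} [Field K] {R : Type u} [CommRing R] [Algebra K R]
  (D E N : R →ₗ[K] R) (h : ∀ r, N (D r) = 0)

/-- The component in `R`. -/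
def reMap : exterior D E N h →ₗ[K] R := (reₗ (0 : R) 0 0).restrictScalars K

/-- The coefficient of `e`. -/
def eMap : exterior D E N h →ₗ[K] R := (imIₗ (0 : R) 0 0).restrictScalars K

variable {D E N h}

theorem reMap_scalar_mul_pow (r : R) (z : exterior D E N h) (j : ℕ) :
    reMap D E N h ((LinearMap.mulLeft K (scalar D E N h r) ^ j) z) = r ^ j * reMap D E N h z := by
  induction j with
  | zero => simp
  | succ j ih =>
    have hmul : ∀ z, reMap D E N h (scalar D E N h r * z) = r * reMap D E N h z := fun z => by
      have : ∀ w : ℍ[R,0,0,0], ((r : ℍ[R,0,0,0]) * w).re = r * w.re := fun w => by simp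
      exact this z
    rw [pow_succ', Module.End.mul_apply, LinearMap.mulLeft_apply, hmul, ih, pow_succ', mul_assoc]

theorem eMap_scalar_mul_pow (r : R) (z : exterior D E N h) (j : ℕ) :
    eMap D E N h ((LinearMap.mulLeft K (scalar D E N h r) ^ j) z) = r ^ j * eMap D E N h z := by
  induction j with
  | zero => simp
  | succ j ih =>
    have hmul : ∀ z, eMap D E N h (scalar D E N h r * z) = r * eMap D E N h z := fun z => by
      have : ∀ w : ℍ[R,0,0,0], ((r : ℍ[R,0,0,0]) * w).imI = r * w.imI := fun w => by simp
      exact this z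
    rw [pow_succ', Module.End.mul_apply, LinearMap.mulLeft_apply, hmul, ih, pow_succ', mul_assoc]

theorem reMap_powSucc (r : R) (j : ℕ) :
    reMap D E N h ((exterior D E N h).powSucc (scalar D E N h r) j) = r ^ (j + 1) :=
  (reMap_scalar_mul_pow r _ j).trans (pow_succ r j).symm

theorem eMap_powMulΔ (r : R) (p : ℕ × ℕ) :
    eMap D E N h ((exterior D E N h).powMulΔ (scalar D E N h r) p) =
      r ^ p.1 * D (r ^ (p.2 + 1)) := by
  rw [powMulΔ, eMap_scalar_mul_pow, ← reMap_powSucc (h := h)]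
  rfl

variable (K) in
/-- The linear map `K[x][y] → K[x][y]` with `x^i ↦ y^i` and `y ↦ 0`. -/
def varSwap : Polynomial (Polynomial K) →ₗ[K] Polynomial (Polynomial K) :=
  (Polynomial.aeval (R := K) (Polynomial.X : Polynomial (Polynomial K))).toLinearMap ∘ₗ
    (Polynomial.lcoeff (Polynomial K) 0).restrictScalars K

variable (K) in
/-- The algebra `K[x, y]⟨e, f⟩` with `Δ(x^j) = y^j e`, so that the products `x^i Δ(x^{j+1})` are
linearly independent. -/
def indep : DiffCommAlg K := exterior (varSwap K) 0 0 fun _ => rfl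

variable (K) in
/-- The element `x` of `K[x, y]⟨e, f⟩`. -/
def indepX : indep K := scalar (varSwap K) 0 0 (fun _ => rfl) (Polynomial.C Polynomial.X)

theorem indepX_mem : indepX K ∈ (indep K).gr 0 := scalar_mem _ _ _ _ _

/-- The coefficient functional of `x^{j+1}`. -/
def coeffPow (j : ℕ) : indep K →ₗ[K] K :=
  Polynomial.lcoeff K (j + 1) ∘ₗ (Polynomial.lcoeff (Polynomial K) 0).restrictScalars K ∘ₗ
    reMap (varSwap K) 0 0 fun _ => rfl

theorem coeffPow_powSucc (i j : ℕ) :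
    coeffPow i ((indep K).powSucc (indepX K) j) = if i = j then 1 else 0 := by
  have : reMap (varSwap K) 0 0 (fun _ => rfl) ((indep K).powSucc (indepX K) j) =
      Polynomial.C Polynomial.X ^ (j + 1) := reMap_powSucc _ j
  change ((reMap (varSwap K) 0 0 (fun _ => rfl) ((indep K).powSucc (indepX K) j)).coeff 0).coeff
    (i + 1) = _
  rw [this, ← Polynomial.C_pow, Polynomial.coeff_C_zero, Polynomial.coeff_X_pow]
  simp

/-- The coefficient functional of `x^i Δ(x^{j+1})`. -/
def coeffPowMulΔ (p : ℕ × ℕ) : indep K →ₗ[K] K :=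
  Polynomial.lcoeff K p.1 ∘ₗ (Polynomial.lcoeff (Polynomial K) (p.2 + 1)).restrictScalars K ∘ₗ
    eMap (varSwap K) 0 0 fun _ => rfl

theorem coeffPowMulΔ_powMulΔ (p q : ℕ × ℕ) :
    coeffPowMulΔ p ((indep K).powMulΔ (indepX K) q) = if p = q then 1 else 0 := by
  have h1 : eMap (varSwap K) 0 0 (fun _ => rfl) ((indep K).powMulΔ (indepX K) q) =
      Polynomial.C Polynomial.X ^ q.1 * varSwap K (Polynomial.C Polynomial.X ^ (q.2 + 1)) :=
    eMap_powMulΔ _ q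
  have h2 : varSwap K (Polynomial.C Polynomial.X ^ (q.2 + 1)) = Polynomial.X ^ (q.2 + 1) := by
    rw [← Polynomial.C_pow]
    change Polynomial.aeval _ ((Polynomial.C (Polynomial.X ^ (q.2 + 1))).coeff 0) = _
    rw [Polynomial.coeff_C_zero, map_pow, Polynomial.aeval_X]
  rw [h2, ← Polynomial.C_pow] at h1
  change ((eMap (varSwap K) 0 0 (fun _ => rfl) ((indep K).powMulΔ (indepX K) q)).coeff
    (p.2 + 1)).coeff p.1 = _
  rw [h1, Polynomial.coeff_C_mul, Polynomial.coeff_X_pow]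
  by_cases h3 : p.2 = q.2
  · simp [h3, Polynomial.coeff_X_pow, Prod.ext_iff]
  · have : p ≠ q := fun hpq => h3 (by rw [hpq])
    simp [h3, this]

end Independent

/-! ### Classification of natural operations of degrees zero and one -/

section Classification

variable {K : Type u} [Field K]

theorem conv_fst_eq_zero {A : DiffCommAlg K} {f g : Conv A.gr (Unitization K A)}
    (hf : ∀ x, (f.ofConv x).fst = 0) (x : SymAlg A.gr) : ((f * g).ofConv x).fst = 0 := by
  rw [conv_apply]
  induction comulₗ A.gr x using TensorProduct.induction_on with
  | zero => simp
  | add s t hs ht => rw [map_add, map_add, Unitization.fst_add, hs, ht, add_zero]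
  | tmul y z => simp [hf]

theorem koszulOp_fst (A : DiffCommAlg K) (i j : ℕ) (x : SymAlg A.gr) :
    ((A.koszulOp i j).ofConv x).fst = 0 := conv_fst_eq_zero (fun _ => rfl) x

theorem toUnit_snd {A : DiffCommAlg K} {u : Unitization K A} (hu : u.fst = 0) :
    A.toUnit u.snd = u := Unitization.ext hu.symm rfl

theorem snd_toUnit_mul {A : DiffCommAlg K} (c : A) {u : Unitization K A} (hu : u.fst = 0) :
    (A.toUnit c * u).snd = c * u.snd := by
  rw [toUnit_mul_eq_inr, hu, zero_smul, zero_add]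
  rfl

theorem toUnit_powSucc (A : DiffCommAlg K) (a : A) (j : ℕ) :
    A.toUnit (A.powSucc a j) = A.toUnit a ^ (j + 1) := by
  induction j with
  | zero => rw [zero_add, pow_one]; rfl
  | succ j ih =>
    have : A.powSucc a (j + 1) = a * A.powSucc a j := by
      rw [powSucc, pow_succ', Module.End.mul_apply]
      rfl
    rw [this, pow_succ', ← ih]
    exact Unitization.inr_mul K _ _

theorem toUnit_mulLeft_pow {A : DiffCommAlg K} {a z : A} (ha : a ∈ A.gr 0) {i : ℤ} (hz : z ∈ A.gr i)
    (j : ℕ) : A.toUnit ((LinearMap.mulLeft K a ^ j) z) = A.toUnit z * A.toUnit a ^ j := by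
  induction j with
  | zero => simp
  | succ j ih =>
    rw [pow_succ', Module.End.mul_apply, LinearMap.mulLeft_apply,
      A.mul_comm ha (mulLeft_pow_mem ha hz j), zero_mul, ksign_zero, one_smul, pow_succ, ← mul_assoc,
      ← ih]
    exact Unitization.inr_mul K _ _

variable [CharZero K]

theorem koszulOp_mem_universal (i j : ℕ) :
    (fun A : DiffCommAlg K => Unitization.sndHom K K A ∘ₗ (A.koszulOp i j).ofConv) ∈ universal K (i + j) 1 := by
  refine ⟨fun A B f hf hgr l _ => ?_, fun A n m c a hc ha l _ => ?_⟩
  · have := congrArg (Unitization.sndHom K K B) (koszulOp_natural hf hgr i j (mono A.gr l))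
    rw [Unitization.sndHom_apply, snd_unitMap, map_mono] at this
    exact this
  · have := congrArg (Unitization.sndHom K K A) (koszulOp_const_mul hc ha i j (mono A.gr l))
    rw [map_smul, Unitization.sndHom_apply, Unitization.sndHom_apply,
      snd_toUnit_mul _ (koszulOp_fst A i j _)] at this
    rw [one_mul]
    exact this

theorem prodMap_succ_fst (A : DiffCommAlg K) (k : ℕ) (a : A) (x : SymAlg A.gr) :
    ((A.prodMap (k + 1)).ofConv (ι A.gr a * x)).fst = 0 := by
  rw [prodMap_ι_mul, toUnit_mul_eq_inr]
  rfl

theorem prodMap_mem_universal (k : ℕ) :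
    (fun A : DiffCommAlg K => Unitization.sndHom K K A ∘ₗ (A.prodMap (k + 1)).ofConv) ∈
      universal K (k + 1) 0 := by
  refine ⟨fun A B f hf hgr l _ => ?_, fun A n m c a _ _ l _ => ?_⟩
  · have := congrArg (Unitization.sndHom K K B) (prodMap_natural hf hgr (k + 1) (mono A.gr l))
    rw [Unitization.sndHom_apply, snd_unitMap, map_mono] at this
    exact this
  · have h : (A.prodMap (k + 1)).ofConv (ι A.gr (c * a) * mono A.gr l) =
        A.toUnit c * (A.prodMap (k + 1)).ofConv (ι A.gr a * mono A.gr l) := by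
      rw [prodMap_ι_mul, prodMap_ι_mul, ← mul_assoc]
      congr 1
      exact Unitization.inr_mul K _ _
    rw [zero_mul, ksign_zero, one_smul]
    exact (congrArg (Unitization.sndHom K K A) h).trans (snd_toUnit_mul _ (prodMap_succ_fst A k a _))

theorem koszulOp_zero (A : DiffCommAlg K) (i : ℕ) : A.koszulOp i 0 = 0 := by
  have : A.ΔUnit ∘ₗ (A.prodMap 0).ofConv = 0 := linearMap_ext_mono fun l => by
    rw [LinearMap.comp_apply, prodMap_mono, LinearMap.zero_apply]
    cases l with
    | nil =>
      change A.toUnit (A.Δ (1 : Unitization K A).snd) = 0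
      rw [Unitization.snd_one, map_zero, map_zero]
    | cons a l => simp
  rw [koszulOp, this, toConv_zero, zero_mul]

theorem ι_pow_eq (A : DiffCommAlg K) (a : A) (k : ℕ) :
    ι A.gr a ^ k = (k.factorial : K) • dpow (K := K) (ι A.gr a) k := by
  rw [dpow, smul_smul, mul_inv_cancel₀ (Nat.cast_ne_zero.2 k.factorial_ne_zero), one_smul]

theorem koszulOp_ι_pow {A : DiffCommAlg K} {a : A} (ha : a ∈ A.gr 0) (i j : ℕ) :
    (A.koszulOp i (j + 1)).ofConv (ι A.gr a ^ (i + (j + 1))) =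
      (((i + (j + 1)).factorial : K) * ((j + 1).factorial : K)⁻¹ * (i.factorial : K)⁻¹) •
        A.toUnit (A.powMulΔ a (i, j)) := by
  rw [ι_pow_eq, map_smul, koszulOp_dpow_ι A ha, if_pos rfl, dpow, dpow, map_smul, powMulΔ,
    toUnit_mulLeft_pow ha (A.Δ_mem (powSucc_mem ha j)), ← toUnit_powSucc, smul_mul_smul_comm,
    smul_smul, ← mul_assoc]
  rfl

variable {Γ : (A : DiffCommAlg K) → SymAlg A.gr →ₗ[K] A}

omit [CharZero K] in
theorem apply_ι_pow_eq {k : ℕ}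
    {β : (A : DiffCommAlg K) → MultilinearMap K (fun _ : Fin k => A) A}
    (hΓ : ∀ A a, β A a = Γ A (mono A.gr (List.ofFn a))) (A : DiffCommAlg K) (a : A) :
    Γ A (ι A.gr a ^ k) = β A fun _ => a := by
  rw [hΓ, List.ofFn_const, mono_replicate]

/-- A natural operation of degree zero is a multiple of the product. -/
theorem exists_eq_smul_prodMap {k : ℕ}
    {β : (A : DiffCommAlg K) → MultilinearMap K (fun _ : Fin (k + 1) => A) A}
    (hβ : IsNatural (k + 1) 0 β) (hΓ : ∀ A a, β A a = Γ A (mono A.gr (List.ofFn a))) :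
    ∃ s : K, ∀ (A : DiffCommAlg K) (l : List A), l.length = k + 1 →
      A.toUnit (Γ A (mono A.gr l)) = s • (A.prodMap (k + 1)).ofConv (mono A.gr l) := by
  obtain ⟨c, hc, hβc⟩ := exists_coeff hβ (fun A => A.powSucc) (fun j => j + 1)
    (fun _ _ _ hf a j => map_powSucc hf a j) (fun A t a j => powSucc_smul a t j)
    (fun A a ha => by rw [← genGr_zero]; exact apply_const_mem_genGr ha hβ) (indep K) (indepX K)
    indepX_mem coeffPow coeffPow_powSucc
  refine ⟨c k, fun A l hl => ?_⟩
  have hmem := sub_mem (mem_universal_of_isNatural hβ hΓ)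
    ((universal K (k + 1) 0).smul_mem (c k) (prodMap_mem_universal k))
  have h := universal_apply_mono_eq_zero hmem (fun A a ha => ?_) A hl
  · have h' : Γ A (mono A.gr l) = c k • ((A.prodMap (k + 1)).ofConv (mono A.gr l)).snd :=
      sub_eq_zero.1 h
    cases l with
    | nil => simp at hl
    | cons a l =>
      rw [h', map_smul, toUnit_snd]
      rw [mono_cons, prodMap_succ_fst]
  · have h1 : (A.prodMap (k + 1)).ofConv (ι A.gr a ^ (k + 1)) = A.toUnit (A.powSucc a k) := by
      rw [← mono_replicate, prodMap_mono, if_pos (List.length_replicate ..), List.map_replicate,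
        List.prod_replicate, toUnit_powSucc]
    have h2 : Γ A (ι A.gr a ^ (k + 1)) = c k • A.powSucc a k := by
      rw [apply_ι_pow_eq hΓ, hβc A a ha]
      refine (Finsupp.sum_of_support_subset (s := {k}) c (fun j hj => Finset.mem_singleton.2 (by
        have := hc j (Finsupp.mem_support_iff.1 hj)
        omega)) _ fun j _ => zero_smul K (A.powSucc a j)).trans (Finset.sum_singleton _ _)
    change Γ A (ι A.gr a ^ (k + 1)) - c k • ((A.prodMap (k + 1)).ofConv (ι A.gr a ^ (k + 1))).snd = 0
    rw [h1, h2]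
    exact sub_self _

/-- A natural operation of degree one is a linear combination of the universal operations. -/
theorem exists_eq_sum_koszulOp {k : ℕ}
    {β : (A : DiffCommAlg K) → MultilinearMap K (fun _ : Fin (k + 1) => A) A}
    (hβ : IsNatural (k + 1) 1 β) (hΓ : ∀ A a, β A a = Γ A (mono A.gr (List.ofFn a))) :
    ∃ m : ℕ × ℕ → K, ∀ (A : DiffCommAlg K) (l : List A), l.length = k + 1 →
      A.toUnit (Γ A (mono A.gr l)) = ∑ p ∈ Finset.HasAntidiagonal.antidiagonal (k + 1),
        m p • (A.koszulOp p.1 p.2).ofConv (mono A.gr l) := by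
  obtain ⟨c, hc, hβc⟩ := exists_coeff hβ (fun A => A.powMulΔ) (fun p => p.1 + p.2 + 1)
    (fun _ _ _ hf a p => map_powMulΔ hf a p) (fun A t a p => powMulΔ_smul a t p)
    (fun A a ha => by rw [← genGr_one]; exact apply_const_mem_genGr ha hβ) (indep K) (indepX K)
    indepX_mem coeffPowMulΔ coeffPowMulΔ_powMulΔ
  -- The denominators come from the multiplicities of the terms of `koszulOp` on `a ⋯ a`.
  set m : ℕ × ℕ → K := fun p => c (p.1, p.2 - 1) *
    (((k + 1).factorial : K)⁻¹ * (p.2.factorial : K) * (p.1.factorial : K)) with hm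
  refine ⟨m, fun A l hl => ?_⟩
  have hmem := sub_mem (mem_universal_of_isNatural hβ hΓ)
    ((universal K (k + 1) 1).sum_mem (t := Finset.HasAntidiagonal.antidiagonal (k + 1))
      (f := fun p => m p • fun A : DiffCommAlg K => Unitization.sndHom K K A ∘ₗ (A.koszulOp p.1 p.2).ofConv)
      fun p hp => Submodule.smul_mem _ _ (by
        rw [← Finset.HasAntidiagonal.mem_antidiagonal.1 hp]
        exact koszulOp_mem_universal p.1 p.2))
  have hsum : ∀ (A : DiffCommAlg K) (x : SymAlg A.gr),
      (Γ - ∑ p ∈ Finset.HasAntidiagonal.antidiagonal (k + 1), m p • fun A : DiffCommAlg K =>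
        Unitization.sndHom K K A ∘ₗ (A.koszulOp p.1 p.2).ofConv) A x =
      Γ A x - (∑ p ∈ Finset.HasAntidiagonal.antidiagonal (k + 1),
        m p • (A.koszulOp p.1 p.2).ofConv x).snd := fun A x => by
    have h1 : (∑ p ∈ Finset.HasAntidiagonal.antidiagonal (k + 1),
        m p • (A.koszulOp p.1 p.2).ofConv x).snd =
        Unitization.sndHom K K A (∑ p ∈ Finset.HasAntidiagonal.antidiagonal (k + 1),
          m p • (A.koszulOp p.1 p.2).ofConv x) := rfl
    rw [h1, map_sum, Pi.sub_apply, LinearMap.sub_apply, Finset.sum_apply, LinearMap.sum_apply]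
    rfl
  have h := universal_apply_mono_eq_zero hmem (fun A a ha => ?_) A hl
  · rw [hsum, sub_eq_zero] at h
    rw [h, toUnit_snd]
    have h1 : (∑ p ∈ Finset.HasAntidiagonal.antidiagonal (k + 1),
        m p • (A.koszulOp p.1 p.2).ofConv (mono A.gr l)).fst =
        Unitization.fstHom K A (∑ p ∈ Finset.HasAntidiagonal.antidiagonal (k + 1),
          m p • (A.koszulOp p.1 p.2).ofConv (mono A.gr l)) := rfl
    rw [h1, map_sum]
    refine Finset.sum_eq_zero fun p _ => ?_
    rw [map_smul]
    exact (congrArg (m p • ·) (koszulOp_fst A p.1 p.2 _)).trans (smul_zero _)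
  · rw [hsum, sub_eq_zero, apply_ι_pow_eq hΓ, hβc A a ha,
      Finset.Nat.sum_antidiagonal_succ', koszulOp_zero]
    have hterm : ∀ p ∈ Finset.HasAntidiagonal.antidiagonal k,
        m (p.1, p.2 + 1) • (A.koszulOp p.1 (p.2 + 1)).ofConv (ι A.gr a ^ (k + 1)) =
          A.toUnit (c p • A.powMulΔ a p) := fun p hp => by
      rw [Finset.HasAntidiagonal.mem_antidiagonal] at hp
      have hk : k + 1 = p.1 + (p.2 + 1) := by omega
      rw [hk, koszulOp_ι_pow ha, ← hk, smul_smul, map_smul]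
      congr 1
      simp only [hm, Nat.add_sub_cancel]
      have f1 : ((k + 1).factorial : K) ≠ 0 := Nat.cast_ne_zero.2 (Nat.factorial_ne_zero _)
      have f2 : ((p.2 + 1).factorial : K) ≠ 0 := Nat.cast_ne_zero.2 (Nat.factorial_ne_zero _)
      have f3 : (p.1.factorial : K) ≠ 0 := Nat.cast_ne_zero.2 (Nat.factorial_ne_zero _)
      field_simp
    rw [Finset.sum_congr rfl hterm, ← map_sum]
    have hcsum : (c.sum fun p s => s • A.powMulΔ a p) =
        ∑ p ∈ Finset.HasAntidiagonal.antidiagonal k, c p • A.powMulΔ a p :=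
      Finsupp.sum_of_support_subset _ (fun p hp => Finset.HasAntidiagonal.mem_antidiagonal.2 (by
        have := hc p (Finsupp.mem_support_iff.1 hp)
        omega)) _ fun p _ => zero_smul _ _
    rw [hcsum, ofConv_zero, LinearMap.zero_apply, smul_zero, zero_add]
    rfl

end Classification

end DiffCommAlg

/-! ### Generating functions of the universal operations -/

namespace SymAlg

theorem apply_lsum_apply {K : Type u} [Field K] {M N N' : Type*} [AddCommGroup M] [Module K M]
    [AddCommGroup N] [Module K N] [AddCommGroup N'] [Module K N'] {T : ℕ → M →ₗ[K] N}
    (hT : LocFin T) (F : N →ₗ[K] N') {x : M} (s : Finset ℕ) (hs : ∀ k ∉ s, F (T k x) = 0) :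
    F (lsum T hT x) = ∑ k ∈ s, F (T k x) := by
  obtain ⟨n, hn⟩ := hT x
  rw [lsum_apply hT hn, map_sum, Finset.sum_subset Finset.subset_union_left fun k _ hk => ?_,
    Finset.sum_subset (Finset.subset_union_right (s₁ := Finset.range n)) fun k _ hk => hs k hk]
  rw [hn k (not_lt.1 fun h => hk (Finset.mem_range.2 h)), map_zero]

theorem locFin_of_mono {K : Type u} [Field K] {V : Type v} [AddCommGroup V] [Module K V]
    {𝒱 : ℤ → Submodule K V} [DirectSum.Decomposition 𝒱] {N : Type*} [AddCommGroup N] [Module K N]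
    {T : ℕ → SymAlg 𝒱 →ₗ[K] N} (h : ∀ l, ∃ n, ∀ k, n ≤ k → T k (mono 𝒱 l) = 0) : LocFin T := by
  intro x
  have hx : x ∈ Submodule.span K (Set.range (mono 𝒱)) := span_mono_eq_top 𝒱 ▸ Submodule.mem_top
  induction hx using Submodule.span_induction with
  | zero => exact ⟨0, fun k _ => map_zero _⟩
  | mem x hx => obtain ⟨l, rfl⟩ := hx; exact h l
  | add x y _ _ hx hy =>
    obtain ⟨m, hm⟩ := hx
    obtain ⟨n, hn⟩ := hy
    exact ⟨max m n, fun k hk => by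
      rw [map_add, hm k (le_trans (le_max_left _ _) hk), hn k (le_trans (le_max_right _ _) hk),
        add_zero]⟩
  | smul c x _ hx =>
    obtain ⟨n, hn⟩ := hx
    exact ⟨n, fun k hk => by rw [map_smul, hn k hk, smul_zero]⟩

theorem mono_mem_symPow {K : Type u} [Field K] {V : Type v} [AddCommGroup V] [Module K V]
    {𝒱 : ℤ → Submodule K V} [DirectSum.Decomposition 𝒱] (l : List V) :
    mono 𝒱 l ∈ symPow 𝒱 l.length := by
  induction l with
  | nil => exact one_mem_wgr 𝒱 fun _ => 1
  | cons a l ih =>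
    rw [mono_cons, List.length_cons, add_comm]
    exact mul_mem_wgr 𝒱 _ (ι_mem_symPow a) ih

end SymAlg

namespace DiffCommAlg

open KoszulBraces.SymAlg WithConv

section KoszulSum

variable {K : Type u} [Field K] [CharZero K] (A : DiffCommAlg K)

theorem extendZero_toUnit_pow (k : ℕ) :
    extendZero A.gr A.toUnit ^ k = (k.factorial : K) • A.prodMap k := by
  rw [prodMap, dpow, smul_smul, mul_inv_cancel₀ (Nat.cast_ne_zero.2 k.factorial_ne_zero), one_smul]

theorem series_mono (f : PowerSeries K) (l : List A) :
    (A.series f).ofConv (mono A.gr l) =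
      ((l.length.factorial : K) * PowerSeries.coeff l.length f) • (l.map A.toUnit).prod := by
  refine (lsum_apply_eq_of_forall_ne ((locNilp (F := extendZero A.gr A.toUnit)
    (extendZero_apply_one _)).smul fun k => PowerSeries.coeff k f) l.length
      fun k hk => ?_).trans ?_
  · rw [LinearMap.smul_apply, extendZero_toUnit_pow, ofConv_smul, LinearMap.smul_apply,
      prodMap_mono, if_neg (Ne.symm hk), smul_zero, smul_zero]
  · rw [LinearMap.smul_apply, extendZero_toUnit_pow, ofConv_smul, LinearMap.smul_apply,
      prodMap_mono, if_pos rfl, smul_smul, _root_.mul_comm]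

theorem koszulOp_mono_eq_zero {i j : ℕ} {l : List A} (h : l.length ≠ i + j) :
    (A.koszulOp i j).ofConv (mono A.gr l) = 0 :=
  A.koszulOp_apply_eq_zero h (mono_mem_symPow l)

theorem sum_koszulOp_mono_eq_zero (c : ℕ × ℕ → K) {n : ℕ} {l : List A} (h : n ≠ l.length) :
    (∑ p ∈ Finset.HasAntidiagonal.antidiagonal n, c p • (A.koszulOp p.1 p.2).ofConv)
      (mono A.gr l) = 0 := by
  rw [LinearMap.sum_apply]
  refine Finset.sum_eq_zero fun p hp => ?_
  rw [Finset.HasAntidiagonal.mem_antidiagonal] at hp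
  rw [LinearMap.smul_apply, koszulOp_mono_eq_zero A (by omega), smul_zero]

theorem locFin_koszulOp (c : ℕ × ℕ → K) : LocFin fun n => ∑ p ∈ Finset.HasAntidiagonal.antidiagonal n,
    c p • (A.koszulOp p.1 p.2).ofConv :=
  locFin_of_mono fun l => ⟨l.length + 1, fun k hk => A.sum_koszulOp_mono_eq_zero c (by omega)⟩

/-- The linear combination of the universal operations with coefficients `c`. -/
def koszulSum (c : ℕ × ℕ → K) : Conv A.gr (Unitization K A) :=
  toConv (lsum _ (A.locFin_koszulOp c))

theorem koszulSum_mono (c : ℕ × ℕ → K) (l : List A) :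
    (A.koszulSum c).ofConv (mono A.gr l) =
      ∑ p ∈ Finset.HasAntidiagonal.antidiagonal l.length,
        c p • (A.koszulOp p.1 p.2).ofConv (mono A.gr l) := by
  refine (lsum_apply_eq_of_forall_ne (A.locFin_koszulOp c) l.length fun k hk =>
    A.sum_koszulOp_mono_eq_zero c hk).trans ?_
  rw [LinearMap.sum_apply]
  rfl

/-- The composition of the differential with the generating function of `f`. -/
def dSeries (f : PowerSeries K) : Conv A.gr (Unitization K A) :=
  toConv (A.ΔUnit ∘ₗ (A.series f).ofConv)

/-- A convolution product of `Δ f(π)` and `g(π)` has coefficients of rank one. -/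
theorem dSeries_mul_series (f g : PowerSeries K) : A.dSeries f * A.series g =
    A.koszulSum fun p => ((p.1.factorial : K) * PowerSeries.coeff p.1 g) *
      ((p.2.factorial : K) * PowerSeries.coeff p.2 f) := by
  have hF := locNilp (F := extendZero A.gr A.toUnit) (extendZero_apply_one _)
  have h1 : A.dSeries f = toConv (lsum _ ((hF.smul fun n => PowerSeries.coeff n f).comp_left
      A.ΔUnit)) := congrArg toConv
    (comp_lsum (hF.smul fun n => PowerSeries.coeff n f) A.ΔUnit)
  rw [h1]
  refine lsum_conv_lsum _ _ _ fun n => ?_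
  rw [← Finset.Nat.sum_antidiagonal_swap]
  refine Finset.sum_congr rfl fun p _ => ?_
  simp only [Prod.fst_swap, Prod.snd_swap]
  have h2 : toConv (A.ΔUnit ∘ₗ (PowerSeries.coeff p.1 f • (extendZero A.gr A.toUnit ^ p.1).ofConv)) =
      ((p.1.factorial : K) * PowerSeries.coeff p.1 f) •
        toConv (A.ΔUnit ∘ₗ (A.prodMap p.1).ofConv) := by
    rw [extendZero_toUnit_pow, ofConv_smul, smul_smul, LinearMap.comp_smul, _root_.mul_comm]
    rfl
  have h3 : toConv (PowerSeries.coeff p.2 g • (extendZero A.gr A.toUnit ^ p.2).ofConv) =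
      ((p.2.factorial : K) * PowerSeries.coeff p.2 g) • A.prodMap p.2 := by
    rw [extendZero_toUnit_pow, ofConv_smul, smul_smul, _root_.mul_comm]
    rfl
  rw [h2, h3, smul_mul_smul_comm, _root_.mul_comm (_ * _)]
  rfl

end KoszulSum

/-! ### The test algebras -/

section Evaluation

open Quaternion QuaternionAlgebra PowerSeries

variable {K : Type u} [Field K] {R : Type u} [CommRing R] [Algebra K R]
  {D E N : R →ₗ[K] R} {h : ∀ r, N (D r) = 0} (x : R) (σ : R →ₐ[K] K)

/-- The powers of `x` have degree zero, so Koszul signs play no role in the evaluation. -/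
theorem evalExterior_comp_twist
    (g : Conv (exterior D E N h).gr (Unitization K (exterior D E N h))) :
    evalExterior D E N h x σ (toConv (g.ofConv ∘ₗ twist (SymAlg.gr (exterior D E N h).gr) 1)) =
      evalExterior D E N h x σ g := by
  have : ∀ n, twist (SymAlg.gr (exterior D E N h).gr) 1
      (dpow (K := K) (ι (exterior D E N h).gr (scalar D E N h x)) n) =
        dpow (K := K) (ι (exterior D E N h).gr (scalar D E N h x)) n := fun n => by
    have hmem : dpow (K := K) (ι (exterior D E N h).gr (scalar D E N h x)) n ∈
        SymAlg.gr (exterior D E N h).gr 0 := by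
      refine Submodule.smul_mem _ _ ?_
      have := SetLike.pow_mem_graded n (ι_mem_gr (exterior D E N h).gr (scalar_mem D E N h x))
      rwa [smul_zero] at this
    rw [twist_of_mem _ _ hmem, mul_zero, ksign_zero, one_smul]
  have hv : ∀ n, extValue D E N h x
      (toConv (g.ofConv ∘ₗ twist (SymAlg.gr (exterior D E N h).gr) 1)) n =
      extValue D E N h x g n := fun n => by
    rw [extValue, extValue, ofConv_toConv, LinearMap.comp_apply, this]
  ext n <;> simp [evalExterior, hv]

theorem extValue_ΔUnit_comp (hD : D 1 = 0) (hE : E 1 = 0)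
    (g : Conv (exterior D E N h).gr (Unitization K (exterior D E N h))) (n : ℕ) :
    extValue D E N h x (toConv ((exterior D E N h).ΔUnit ∘ₗ g.ofConv)) n =
      ⟨0, D (extValue D E N h x g n).re, E (extValue D E N h x g n).re,
        N (extValue D E N h x g n).imI⟩ := by
  have : ∀ u, toExterior D E N h ((exterior D E N h).ΔUnit u) =
      ⟨0, D (toExterior D E N h u).re, E (toExterior D E N h u).re,
        N (toExterior D E N h u).imI⟩ := fun u => by
    induction u using Unitization.ind with
    | inl_add_inr s a =>
      have h1 : (exterior D E N h).ΔUnit (Unitization.inl s + (a : Unitization K _)) =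
          ((exterior D E N h).Δ a : Unitization K (exterior D E N h)) := by
        change (exterior D E N h).toUnit ((exterior D E N h).Δ (0 + a)) = _
        rw [zero_add]
        rfl
      have h2 : toExterior D E N h (Unitization.inl s) = algebraMap K ℍ[R,0,0,0] s :=
        (toExterior D E N h).commutes s
      have h3 : ((algebraMap K ℍ[R,0,0,0] s).re) = s • 1 := by
        rw [Algebra.algebraMap_eq_smul_one]; rfl
      have h4 : ((algebraMap K ℍ[R,0,0,0] s).imI) = 0 := by
        rw [Algebra.algebraMap_eq_smul_one]; simp
      have h5 : ∀ b : ℍ[R,0,0,0], (⟨0, D b.re, E b.re, N b.imI⟩ : ℍ[R,0,0,0]) =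
          ⟨0, D (algebraMap K ℍ[R,0,0,0] s + b).re, E (algebraMap K ℍ[R,0,0,0] s + b).re,
            N (algebraMap K ℍ[R,0,0,0] s + b).imI⟩ := fun b => by
        rw [QuaternionAlgebra.re_add, QuaternionAlgebra.imI_add, h3, h4, map_add, map_add, map_smul,
          map_smul, hD, hE, smul_zero, zero_add, zero_add, zero_add]
      rw [h1, map_add, toExterior_inr, toExterior_inr, h2]
      exact h5 a
  exact this _

theorem apply_extValue_toConv_lsum (F : ℍ[R,0,0,0] →ₗ[K] R) {T : ℕ → SymAlg (exterior D E N h).gr →ₗ[K]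
      Unitization K (exterior D E N h)} (hT : LocFin T) (s : Finset ℕ) (n : ℕ)
    (hs : ∀ k ∉ s, σ (F (extValue D E N h x (toConv (T k)) n)) = 0) :
    σ (F (extValue D E N h x (toConv (lsum T hT)) n)) =
      ∑ k ∈ s, σ (F (extValue D E N h x (toConv (T k)) n)) :=
  apply_lsum_apply hT (σ.toLinearMap ∘ₗ F ∘ₗ (toExterior D E N h).toLinearMap) s hs

variable {T : ℕ → SymAlg (exterior D E N h).gr →ₗ[K] Unitization K (exterior D E N h)}
  (hT : LocFin T) (s : Finset ℕ)

theorem evalExterior_lsum_imI (hs : ∀ k ∉ s, (evalExterior D E N h x σ (toConv (T k))).imI = 0) :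
    (evalExterior D E N h x σ (toConv (lsum T hT))).imI =
      ∑ k ∈ s, (evalExterior D E N h x σ (toConv (T k))).imI := by
  ext n
  rw [map_sum]
  simp only [evalExterior, coeff_mk]
  exact apply_extValue_toConv_lsum x σ ((imIₗ (0 : R) 0 0).restrictScalars K) hT s n fun k hk => by
    simpa [evalExterior] using congrArg (coeff n) (hs k hk)

theorem evalExterior_lsum_imJ (hs : ∀ k ∉ s, (evalExterior D E N h x σ (toConv (T k))).imJ = 0) :
    (evalExterior D E N h x σ (toConv (lsum T hT))).imJ =
      ∑ k ∈ s, (evalExterior D E N h x σ (toConv (T k))).imJ := by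
  ext n
  rw [map_sum]
  simp only [evalExterior, coeff_mk]
  exact apply_extValue_toConv_lsum x σ ((imJₗ (0 : R) 0 0).restrictScalars K) hT s n fun k hk => by
    simpa [evalExterior] using congrArg (coeff n) (hs k hk)

theorem evalExterior_lsum_imK (hs : ∀ k ∉ s, (evalExterior D E N h x σ (toConv (T k))).imK = 0) :
    (evalExterior D E N h x σ (toConv (lsum T hT))).imK =
      ∑ k ∈ s, (evalExterior D E N h x σ (toConv (T k))).imK := by
  ext n
  rw [map_sum]
  simp only [evalExterior, coeff_mk]
  exact apply_extValue_toConv_lsum x σ ((imKₗ (0 : R) 0 0).restrictScalars K) hT s n fun k hk => by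
    simpa [evalExterior] using congrArg (coeff n) (hs k hk)

end Evaluation

end DiffCommAlg

namespace DiffCommAlg

open KoszulBraces.SymAlg WithConv

section Test

open Quaternion QuaternionAlgebra PowerSeries

variable {K : Type u} [Field K]

/-- The linear map `K[x] → K[x]` with `x^m ↦ y` that vanishes on the other powers of `x`. -/
@[irreducible] def coeffMap (y : K) (m : ℕ) : Polynomial K →ₗ[K] Polynomial K :=
  Polynomial.monomial 0 ∘ₗ (y • Polynomial.lcoeff K m)

/-- The linear map `s ↦ z (s - s(0))` of `K[x]`. -/
@[irreducible] def remMap (z : K) : Polynomial K →ₗ[K] Polynomial K :=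
  z • (LinearMap.id - Polynomial.monomial 0 ∘ₗ Polynomial.lcoeff K 0)

theorem remMap_coeffMap (y z : K) (m : ℕ) (p : Polynomial K) : remMap z (coeffMap y m p) = 0 := by
  simp [remMap, coeffMap]

theorem coeffMap_one (y : K) {m : ℕ} (hm : m ≠ 0) : coeffMap y m 1 = 0 := by
  simp [coeffMap, Polynomial.coeff_one, hm]

/-- The algebra `K[x]⟨e, f⟩` with `Δ(x) = e`, `Δ(x^m) = y f` and `Δ(x^n) = 0` for the other `n`
(for `m ≠ 1`), and with `Δ(s e) = z (s - s(0)) e f`. -/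
abbrev testAlg (y z : K) (m : ℕ) : DiffCommAlg K :=
  exterior (coeffMap 1 1) (coeffMap y m) (remMap z) (remMap_coeffMap 1 z 1)

/-- The generating function of the values at `x = c` of a map on the divided powers of `x`. -/
def testEval {y z : K} {m : ℕ} (c : K)
    (g : Conv (testAlg y z m).gr (Unitization K (testAlg y z m))) : ℍ[K⟦X⟧,0,0,0] :=
  evalExterior _ _ _ _ Polynomial.X (Polynomial.aeval c) g

variable {y z : K} {m : ℕ} (c : K)

theorem testEval_comp_ΔUnit_imK (hm : m ≠ 0)
    (g : Conv (testAlg y z m).gr (Unitization K (testAlg y z m))) :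
    (testEval c (toConv ((testAlg y z m).ΔUnit ∘ₗ g.ofConv))).imK =
      z • ((testEval c g).imI - (testEval 0 g).imI) := by
  ext n
  simp only [testEval, evalExterior, coeff_mk, map_smul, map_sub]
  rw [extValue_ΔUnit_comp _ (coeffMap_one 1 one_ne_zero) (coeffMap_one y hm)]
  simp only [remMap, LinearMap.smul_apply, map_smul, LinearMap.sub_apply, LinearMap.id_apply,
    map_sub, LinearMap.comp_apply, Polynomial.lcoeff_apply, Polynomial.aeval_monomial,
    Polynomial.coe_aeval_eq_eval, Polynomial.coeff_zero_eq_eval_zero, pow_zero, mul_one]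
  rfl

theorem testEval_comp_twist (g : Conv (testAlg y z m).gr (Unitization K (testAlg y z m))) :
    testEval c (toConv (g.ofConv ∘ₗ twist (SymAlg.gr (testAlg y z m).gr) 1)) = testEval c g :=
  evalExterior_comp_twist (D := coeffMap 1 1) (E := coeffMap y m) (N := remMap z)
    (h := remMap_coeffMap 1 z 1) Polynomial.X (Polynomial.aeval c) g

variable [CharZero K]

theorem testEval_mul (f g : Conv (testAlg y z m).gr (Unitization K (testAlg y z m))) :
    testEval c (f * g) = testEval c f * testEval c g := 
  evalExterior_mul (D := coeffMap 1 1) (E := coeffMap y m) (N := remMap z)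
    (h := remMap_coeffMap 1 z 1) Polynomial.X (Polynomial.aeval c) f g

theorem testEval_series (f : K⟦X⟧) :
    testEval c ((testAlg y z m).series f) = (rescale c f : K⟦X⟧) := by
  have := evalExterior_series (D := coeffMap 1 1) (E := coeffMap y m) (N := remMap z)
    (h := remMap_coeffMap 1 z 1) Polynomial.X (Polynomial.aeval c) f
  rwa [Polynomial.aeval_X] at this

theorem testEval_dSeries (hm : m ≠ 0) (f : K⟦X⟧) : testEval c ((testAlg y z m).dSeries f) =
    ⟨0, monomial 1 (coeff 1 f), monomial m (y * coeff m f), 0⟩ := by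
  ext n <;> simp only [testEval, evalExterior, coeff_mk, dSeries] <;>
    rw [extValue_ΔUnit_comp _ (coeffMap_one 1 one_ne_zero) (coeffMap_one y hm)] <;>
    simp only [extValue_series, re_coe, imI_coe, map_zero]
  · by_cases hn : n = 1
    · simp [coeffMap, hn]
    · simp [coeffMap, coeff_monomial, Polynomial.coeff_X_pow, hn, Ne.symm hn]
  · by_cases hn : n = m
    · simp [coeffMap, hn, _root_.mul_comm]
    · simp [coeffMap, coeff_monomial, Polynomial.coeff_X_pow, hn, Ne.symm hn]

theorem testEval_dSeries_mul_series (hm : m ≠ 0) (f g : K⟦X⟧) :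
    testEval c ((testAlg y z m).dSeries f * (testAlg y z m).series g) =
      ⟨0, monomial 1 (coeff 1 f) * rescale c g, monomial m (y * coeff m f) * rescale c g, 0⟩ := by
  rw [testEval_mul, testEval_dSeries c hm, testEval_series]
  ext1 <;> simp

end Test

end DiffCommAlg

namespace DiffCommAlg

open KoszulBraces.SymAlg WithConv

/-! ### The structure of natural L∞-algebras -/

section Structure

open PowerSeries

variable {K : Type u} [Field K] [CharZero K]

/-- The coefficients of `koszulOp i 0 = 0` do not matter. -/
theorem koszulSum_congr (A : DiffCommAlg K) {c c' : ℕ × ℕ → K} (h : ∀ p : ℕ × ℕ, p.2 ≠ 0 → c p = c' p) :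
    A.koszulSum c = A.koszulSum c' := by
  refine congrArg toConv (lsum_congr fun n => Finset.sum_congr rfl fun p _ => ?_)
  by_cases hp : p.2 = 0
  · rw [hp, koszulOp_zero, ofConv_zero, smul_zero, smul_zero]
  · rw [h p hp]

/-- The generating function of the coefficients of the operations `koszulOp i j`, for fixed `j`. -/
def column (c : ℕ × ℕ → K) (j : ℕ) : K⟦X⟧ := PowerSeries.mk fun i => (i.factorial : K)⁻¹ * c (i, j)

theorem dSeries_mul_series_column (A : DiffCommAlg K) (c : ℕ × ℕ → K) (j : ℕ) :
    A.dSeries (monomial j (j.factorial : K)⁻¹) * A.series (column c j) =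
      A.koszulSum fun p => if p.2 = j then c p else 0 := by
  rw [dSeries_mul_series]
  congr 1
  funext p
  have h : ∀ n : ℕ, (n.factorial : K) ≠ 0 := fun n => Nat.cast_ne_zero.2 n.factorial_ne_zero
  obtain ⟨i, k⟩ := p
  simp only [column, coeff_mk, coeff_monomial]
  split_ifs with hk
  · subst hk
    rw [mul_inv_cancel_left₀ (h i), mul_inv_cancel₀ (h k), mul_one]
  · rw [mul_zero, mul_zero]

theorem locFin_column (A : DiffCommAlg K) (c : ℕ × ℕ → K) :
    LocFin fun j => (A.dSeries (monomial j (j.factorial : K)⁻¹) * A.series (column c j)).ofConv :=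
  locFin_of_mono fun l => ⟨l.length + 1, fun k hk => by
    rw [dSeries_mul_series_column, koszulSum_mono]
    refine Finset.sum_eq_zero fun p hp => ?_
    rw [Finset.HasAntidiagonal.mem_antidiagonal] at hp
    rw [if_neg (by omega), zero_smul]⟩

/-- A linear combination of the universal operations as the sum of its columns. -/
theorem koszulSum_eq_lsum (A : DiffCommAlg K) (c : ℕ × ℕ → K) :
    A.koszulSum c = toConv (lsum _ (A.locFin_column c)) := by
  refine congrArg toConv (linearMap_ext_mono (f := (A.koszulSum c).ofConv) fun l => ?_)
  rw [lsum_apply (A.locFin_column c) (n := l.length + 1) fun k hk => ?_]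
  · simp only [dSeries_mul_series_column, koszulSum_mono]
    rw [Finset.sum_comm]
    refine Finset.sum_congr rfl fun p hp => ?_
    rw [Finset.HasAntidiagonal.mem_antidiagonal] at hp
    simp only [ite_smul, zero_smul]
    rw [Finset.sum_ite_eq, if_pos (Finset.mem_range.2 (by omega))]
  · rw [dSeries_mul_series_column, koszulSum_mono]
    refine Finset.sum_eq_zero fun p hp => ?_
    rw [Finset.HasAntidiagonal.mem_antidiagonal] at hp
    rw [if_neg (by omega), zero_smul]

section Coder

variable {A : DiffCommAlg K} {D : SymAlg A.gr →ₗ[K] SymAlg A.gr} (hD : SymCoalg.IsCoder A.gr D)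

omit [CharZero K] in
include hD in
theorem series_comp (f : K⟦X⟧) : toConv ((A.series f).ofConv ∘ₗ D) =
    SymCoalg.coderProj A.toUnit D * A.series (derivative K f) :=
  hD.psum_comp A.toUnit_swap _ f

omit [CharZero K] in
include hD in
/-- The Leibniz rule for `Δ f(π) * g(π)` and a coderivation. -/
theorem dSeries_mul_series_comp (f g : K⟦X⟧) :
    toConv ((A.dSeries f * A.series g).ofConv ∘ₗ D) =
      toConv (A.ΔUnit ∘ₗ (SymCoalg.coderProj A.toUnit D * A.series (derivative K f)).ofConv) *
        A.series g +
      toConv ((A.dSeries f).ofConv ∘ₗ twist (SymAlg.gr A.gr) 1) *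
        (SymCoalg.coderProj A.toUnit D * A.series (derivative K g)) := by
  rw [hD.conv_comp, series_comp hD, ← series_comp hD f]
  rfl

end Coder

variable (L : (A : DiffCommAlg K) → LInfinity A.gr)

/-- The structure operations of `L A`, assembled to a map with values in the unitization of `A`. -/
def lProj (A : DiffCommAlg K) : Conv A.gr (Unitization K A) :=
  SymCoalg.coderProj A.toUnit (SymCoalg.extend (L A).l)

omit [CharZero K] in
theorem isCoder_extend (A : DiffCommAlg K) : SymCoalg.IsCoder A.gr (SymCoalg.extend (L A).l) :=
  (L A).isCoderivation.isCoder_extend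

omit [CharZero K] in
/-- The projection of `l² = 0`. -/
theorem lProj_comp (A : DiffCommAlg K) : (lProj L A).ofConv ∘ₗ SymCoalg.extend (L A).l = 0 := by
  refine LinearMap.ext fun x => ?_
  change A.toUnit (proj A.gr ((L A).l (SymCoalg.reduce A.gr
    ((L A).l (SymCoalg.reduce A.gr x) : SymAlg A.gr)))) = 0
  rw [SymCoalg.reduce_coe]
  have := LinearMap.congr_fun (L A).sq_zero (SymCoalg.reduce A.gr x)
  rw [LinearMap.comp_apply] at this
  rw [this]
  simp

omit [CharZero K] in
theorem lProj_mono (A : DiffCommAlg K) {k : ℕ} (a : Fin k → A) :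
    (lProj L A).ofConv (mono A.gr (List.ofFn a)) = A.toUnit ((L A).op k a) := by
  rw [LInfinity.op, SymCoalg.component_apply]
  rfl

theorem exists_lProj_eq_koszulSum (hL : IsNaturalLInfinity L) :
    ∃ c : ℕ × ℕ → K, ∀ A, lProj L A = A.koszulSum c := by
  choose m hm using fun k : ℕ => exists_eq_sum_koszulOp
    (Γ := fun A => proj A.gr ∘ₗ SymCoalg.extend (L A).l) (hL (k + 1) (by omega))
    fun A a => SymCoalg.component_apply _ _ _
  refine ⟨fun p => m (p.1 + p.2 - 1) p, fun A => ?_⟩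
  refine congrArg toConv (linearMap_ext_mono (f := (lProj L A).ofConv)
    (g := (A.koszulSum _).ofConv) fun l => ?_)
  rw [koszulSum_mono]
  match l with
  | [] =>
    have h0 : (lProj L A).ofConv 1 = 0 := by
      change A.toUnit (proj A.gr ((L A).l (SymCoalg.reduce A.gr 1))) = 0
      simp
    rw [mono_nil, h0]
    simp [koszulOp_zero]
  | a :: l =>
    refine (hm l.length A (a :: l) rfl).trans (Finset.sum_congr rfl fun p hp => ?_)
    rw [Finset.HasAntidiagonal.mem_antidiagonal] at hp
    rw [hp, List.length_cons, Nat.add_sub_cancel]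

variable {L} {c : ℕ × ℕ → K} (hc : ∀ A, lProj L A = A.koszulSum c)

include hc in
theorem coeff_zero_one (hΔ : ∀ (A : DiffCommAlg K) (a : A), (L A).op 1 ![a] = A.Δ a) :
    c (0, 1) = 1 := by
  set A := testAlg (K := K) 0 0 2
  set a : A := scalar _ _ _ _ Polynomial.X
  have h := lProj_mono L A ![a]
  have hp0 : A.prodMap 0 = 1 := by rw [prodMap, dpow, pow_zero]; simp
  rw [hΔ, hc, koszulSum_mono] at h
  have h1 : (A.koszulOp 0 1).ofConv (mono A.gr [a]) = A.toUnit (A.Δ a) := by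
    rw [koszulOp, hp0, mul_one, ofConv_toConv, LinearMap.comp_apply, prodMap_mono]
    simp [ΔUnit]
  have h2 : List.ofFn ![a] = [a] := rfl
  rw [h2] at h
  rw [List.length_singleton, Finset.Nat.sum_antidiagonal_succ', Finset.Nat.antidiagonal_zero,
    Finset.sum_singleton, koszulOp_zero, ofConv_zero, LinearMap.zero_apply, smul_zero, zero_add,
    h1] at h
  have h3 : c (0, 1) • A.Δ a = A.Δ a := congrArg (Unitization.sndHom K K A) h
  have h4 : (c (0, 1) • coeffMap (1 : K) 1 Polynomial.X) = coeffMap (1 : K) 1 Polynomial.X :=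
    congrArg QuaternionAlgebra.imI h3
  have := congrArg (fun p : Polynomial K => p.coeff 0) h4
  simpa [coeffMap] using this

end Structure

end DiffCommAlg

namespace DiffCommAlg

open KoszulBraces.SymAlg WithConv

section Relations

open PowerSeries

variable {K : Type u} [Field K] [CharZero K]

/-! ### Relations between the coefficients -/

section Test

variable {y z : K} {m : ℕ} (t : K) (c : ℕ × ℕ → K)

/-- The coefficient of `e`, to which only the column `1` contributes. -/
theorem testEval_koszulSum_imI (hm : m ≠ 0) :
    (testEval t ((testAlg y z m).koszulSum c)).imI = X * rescale t (column c 1) := by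
  rw [koszulSum_eq_lsum]
  refine (evalExterior_lsum_imI _ _ _ {1} fun k hk => ?_).trans ?_
  · refine (congrArg QuaternionAlgebra.imI (testEval_dSeries_mul_series t hm _ _)).trans ?_
    rw [Finset.mem_singleton] at hk
    simp [coeff_monomial, Ne.symm hk]
  · rw [Finset.sum_singleton]
    refine (congrArg QuaternionAlgebra.imI (testEval_dSeries_mul_series t hm _ _)).trans ?_
    simp only [Nat.factorial_one, Nat.cast_one, inv_one, coeff_monomial_same]
    rfl

/-- The coefficient of `f`, to which only the column `m` contributes. -/
theorem testEval_koszulSum_imJ (hm : m ≠ 0) :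
    (testEval t ((testAlg y z m).koszulSum c)).imJ =
      monomial m (y * (m.factorial : K)⁻¹) * rescale t (column c m) := by
  rw [koszulSum_eq_lsum]
  refine (evalExterior_lsum_imJ _ _ _ {m} fun k hk => ?_).trans ?_
  · refine (congrArg QuaternionAlgebra.imJ (testEval_dSeries_mul_series t hm _ _)).trans ?_
    rw [Finset.mem_singleton] at hk
    simp [coeff_monomial, Ne.symm hk]
  · rw [Finset.sum_singleton]
    refine (congrArg QuaternionAlgebra.imJ (testEval_dSeries_mul_series t hm _ _)).trans ?_
    simp

/-- The coefficient of `e f` in `(Δ f(π) * g(π)) D`, for a coderivation `D` with projection `Q`: in the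
first summand `Δ` is applied a second time to the part `e` of `Q * f'(π)`, in the second one `Δ f(π)` is
multiplied with `Q * g'(π)`. -/
theorem testEval_comp_imK (hm : m ≠ 0) {D : SymAlg (testAlg y z m).gr →ₗ[K] SymAlg (testAlg y z m).gr}
    (hD : SymCoalg.IsCoder (testAlg y z m).gr D) (f g : K⟦X⟧)
    {Q : Conv (testAlg y z m).gr (Unitization K (testAlg y z m))}
    (hQ : SymCoalg.coderProj (testAlg y z m).toUnit D = Q) :
    (testEval t (toConv (((testAlg y z m).dSeries f * (testAlg y z m).series g).ofConv ∘ₗ D))).imK =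
      (z • ((testEval t Q).imI * rescale t (derivative K f) -
        (testEval 0 Q).imI * rescale 0 (derivative K f))) * rescale t g +
      (monomial 1 (coeff 1 f) * (testEval t Q).imJ -
        monomial m (y * coeff m f) * (testEval t Q).imI) * rescale t (derivative K g) := by
  have hadd : ∀ f g : Conv (testAlg y z m).gr (Unitization K (testAlg y z m)),
      testEval t (f + g) = testEval t f + testEval t g := fun f g => evalExterior_add _ _ f g
  rw [dSeries_mul_series_comp hD, hadd, QuaternionAlgebra.imK_add, testEval_mul, testEval_mul,
    testEval_comp_twist, testEval_mul, testEval_series, testEval_series, testEval_dSeries t hm, hQ]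
  have h1 : ∀ (q : QuaternionAlgebra K⟦X⟧ 0 0 0) (s : K⟦X⟧),
      (q * (s : QuaternionAlgebra K⟦X⟧ 0 0 0)).imK = q.imK * s := fun q s => by simp
  have h2 : ∀ (q : QuaternionAlgebra K⟦X⟧ 0 0 0) (s : K⟦X⟧),
      (q * (s : QuaternionAlgebra K⟦X⟧ 0 0 0)).imI = q.imI * s := fun q s => by simp
  have h3 : ∀ (q : QuaternionAlgebra K⟦X⟧ 0 0 0) (s : K⟦X⟧),
      (q * (s : QuaternionAlgebra K⟦X⟧ 0 0 0)).imJ = q.imJ * s := fun q s => by simp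
  have h4 : ∀ (a b : K⟦X⟧) (q : QuaternionAlgebra K⟦X⟧ 0 0 0),
      ((⟨0, a, b, 0⟩ : QuaternionAlgebra K⟦X⟧ 0 0 0) * q).imK = a * q.imJ - b * q.imI :=
    fun a b q => by simp
  rw [h1, h4, h2, h3, testEval_comp_ΔUnit_imK t hm, testEval_mul, testEval_mul, testEval_series,
    testEval_series, h2, h2]
  ring

end Test

variable {L : (A : DiffCommAlg K) → LInfinity A.gr} {c : ℕ × ℕ → K}
  (hc : ∀ A, lProj L A = A.koszulSum c) (hc1 : c (0, 1) = 1)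

omit [CharZero K] in
theorem constantCoeff_column (c : ℕ × ℕ → K) (j : ℕ) : constantCoeff (column c j) = c (0, j) := by
  rw [← coeff_zero_eq_constantCoeff_apply, column, coeff_mk]
  simp

omit [CharZero K] in
theorem column_ne_zero (hc1 : c (0, 1) = 1) : column c 1 ≠ 0 := fun h => by
  have := constantCoeff_column c 1
  rw [h, map_zero, hc1] at this
  exact zero_ne_one this

include hc in
/-- The coefficient of `e f` in `l² = 0`, evaluated on the divided powers of `x` in the algebra with
`Δ(x) = e` and `Δ(x^m) = f`. Only the columns `1` and `m` contribute, one through each order in which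
the differentials `e` and `f` arise. -/
theorem column_mul_derivative {m : ℕ} (hm : 2 ≤ m) :
    column c m * derivative K (column c 1) = column c 1 * derivative K (column c m) := by
  have hm0 : m ≠ 0 := by omega
  have h := lProj_comp L (testAlg 1 0 m)
  rw [hc, koszulSum_eq_lsum, ofConv_toConv, lsum_comp] at h
  have h0 : (testEval (K := K) (y := 1) (z := 0) (m := m) 1 (toConv (lsum _
      ((locFin_column (testAlg 1 0 m) c).comp_right (SymCoalg.extend (L (testAlg 1 0 m)).l))))).imK =
        0 := by
    rw [h]
    ext n
    simp [testEval, evalExterior, extValue]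
  have hterm : ∀ k, (testEval (K := K) (y := 1) (z := 0) (m := m) 1 (toConv
      (((testAlg 1 0 m).dSeries (monomial k (k.factorial : K)⁻¹) *
        (testAlg 1 0 m).series (column c k)).ofConv ∘ₗ SymCoalg.extend (L (testAlg 1 0 m)).l))).imK =
      (monomial 1 (coeff 1 (monomial k (k.factorial : K)⁻¹)) *
        (monomial m (1 * (m.factorial : K)⁻¹) * column c m) -
        monomial m (1 * coeff m (monomial k (k.factorial : K)⁻¹)) * (X * column c 1)) *
          derivative K (column c k) := fun k => by
    rw [testEval_comp_imK 1 hm0 (isCoder_extend L _) _ _ (hc _), testEval_koszulSum_imI 1 c hm0,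
      testEval_koszulSum_imJ 1 c hm0, rescale_one, zero_smul, zero_mul, zero_add]
    rfl
  have h1m : (1 : ℕ) ≠ m := by omega
  rw [testEval, evalExterior_lsum_imK _ _ _ {1, m} fun k hk => ?_] at h0
  · rw [Finset.sum_pair h1m] at h0
    have e1 := hterm 1
    have em := hterm m
    rw [testEval] at e1 em
    rw [e1, em] at h0
    simp only [coeff_monomial, h1m, h1m.symm, if_false, if_true, map_zero, zero_mul, mul_zero,
      sub_zero, zero_sub, one_mul, Nat.factorial_one, Nat.cast_one, inv_one] at h0
    have hX : (monomial 1 (1 : K)) = X := rfl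
    have hmm : monomial m (m.factorial : K)⁻¹ ≠ 0 := fun hz => by
      have := congrArg (coeff m) hz
      rw [coeff_monomial, if_pos rfl, map_zero] at this
      exact inv_ne_zero (Nat.cast_ne_zero.2 m.factorial_ne_zero) this
    rw [hX] at h0
    refine mul_left_cancel₀ (mul_ne_zero X_ne_zero hmm) ?_
    linear_combination h0
  · rw [Finset.mem_insert, Finset.mem_singleton, not_or] at hk
    have := hterm k
    rw [testEval] at this
    rw [this, coeff_monomial, coeff_monomial, if_neg (Ne.symm hk.1), if_neg (Ne.symm hk.2)]
    simp

include hc hc1 in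
/-- The columns of the coefficients are proportional to each other. -/
theorem column_eq {m : ℕ} (hm : m ≠ 0) : column c m = C (c (0, m)) * column c 1 := by
  rcases Nat.lt_or_ge m 2 with h | h
  · obtain rfl : m = 1 := by omega
    rw [hc1, map_one, one_mul]
  · have hne : constantCoeff (column c 1) ≠ 0 := by
      rw [constantCoeff_column, hc1]; exact one_ne_zero
    set w := column c m * (column c 1)⁻¹ with hw
    have hmul : column c m = w * column c 1 := by
      rw [hw, mul_assoc, PowerSeries.inv_mul_cancel _ hne, mul_one]
    have hd := column_mul_derivative hc h
    rw [hmul, Derivation.leibniz, smul_eq_mul, smul_eq_mul] at hd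
    have hd0 : derivative K w = 0 := by
      refine (mul_eq_zero.1 (?_ : column c 1 ^ 2 * derivative K w = 0)).resolve_left
        (pow_ne_zero 2 (column_ne_zero hc1))
      linear_combination -hd
    have hwC : w = C (c (0, m)) := by
      refine derivative.ext (by rw [hd0, derivative_C]) ?_
      have := congrArg constantCoeff hmul
      rw [constantCoeff_column, map_mul, constantCoeff_column, hc1, mul_one] at this
      rw [← this, constantCoeff_C]
    rw [hmul, hwC]

/-- The exponential generating function of the coefficients of `Δ(a₁ ⋯ a_n)`. -/
def rowSeries (c : ℕ × ℕ → K) : K⟦X⟧ :=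
  PowerSeries.mk fun j => if j = 0 then 0 else (j.factorial : K)⁻¹ * c (0, j)

include hc hc1 in
/-- As the columns are proportional, the projection of `l` is a single convolution product. -/
theorem lProj_eq_dSeries_mul_series (A : DiffCommAlg K) :
    lProj L A = A.dSeries (rowSeries c) * A.series (column c 1) := by
  rw [hc, dSeries_mul_series]
  refine koszulSum_congr A fun p hp => ?_
  obtain ⟨i, k⟩ := p
  have h : ∀ n : ℕ, (n.factorial : K) ≠ 0 := fun n => Nat.cast_ne_zero.2 n.factorial_ne_zero
  have := congrArg (coeff i) (column_eq hc hc1 hp)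
  rw [coeff_C_mul, column, coeff_mk, inv_mul_eq_iff_eq_mul₀ (h i)] at this
  dsimp only at this hp ⊢
  rw [this, rowSeries, coeff_mk, if_neg hp, mul_inv_cancel_left₀ (h k)]
  ring

omit [CharZero K] in
theorem constantCoeff_rowSeries (c : ℕ × ℕ → K) : constantCoeff (rowSeries c) = 0 := by
  rw [← coeff_zero_eq_constantCoeff_apply, rowSeries, coeff_mk, if_pos rfl]

omit [CharZero K] in
theorem coeff_one_rowSeries (hc1 : c (0, 1) = 1) : coeff 1 (rowSeries c) = 1 := by
  simp [rowSeries, hc1]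

include hc hc1 in
/-- The coefficient of `e f` in `l² = 0`, evaluated on the divided powers of `x` in the algebra with
`Δ(x) = e` and `Δ(s e) = (s - s(0)) e f`. Here only the summand where `Δ` is applied twice contributes. -/
theorem column_mul_derivative_rowSeries : column c 1 * derivative K (rowSeries c) = 1 := by
  set P := column c 1 with hP
  set G := rowSeries c with hG
  have h := lProj_comp L (testAlg 0 1 2)
  have h0 : (testEval (K := K) (y := 0) (z := 1) (m := 2) 1
      (toConv ((lProj L (testAlg 0 1 2)).ofConv ∘ₗ SymCoalg.extend (L (testAlg 0 1 2)).l))).imK =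
        0 := by
    rw [h]
    ext n
    simp [testEval, evalExterior, extValue]
  rw [lProj_eq_dSeries_mul_series hc hc1, ← hP, ← hG,
    testEval_comp_imK 1 two_ne_zero (isCoder_extend L _) _ _ (hc _),
    testEval_koszulSum_imI 1 c two_ne_zero, testEval_koszulSum_imI 0 c two_ne_zero,
    testEval_koszulSum_imJ 1 c two_ne_zero, ← hP] at h0
  have hG1 : constantCoeff (derivative K G) = 1 := by
    rw [← coeff_zero_eq_constantCoeff_apply, coeff_derivative, zero_add, coeff_one_rowSeries hc1]
    simp
  have hP1 : constantCoeff P = 1 := by rw [hP, constantCoeff_column, hc1]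
  simp only [rescale_one, rescale_zero, RingHom.coe_comp, Function.comp_apply, hG1, hP1, map_one,
    RingHom.id_apply, zero_mul, map_zero, mul_zero, sub_zero, add_zero, one_smul, mul_one] at h0
  have h1 := (mul_eq_zero.1 h0).resolve_right (column_ne_zero hc1)
  refine mul_left_cancel₀ (X_ne_zero (R := K)) ?_
  linear_combination h1

include hc hc1 in
/-- The generating function intertwines the `L∞`-structure with the differential. -/
theorem series_rowSeries_comp (A : DiffCommAlg K) :
    toConv ((A.series (rowSeries c)).ofConv ∘ₗ SymCoalg.extend (L A).l) = A.dSeries (rowSeries c) := by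
  have h1 : A.series 1 = 1 := psum_one _ _
  rw [series_comp (isCoder_extend L A)]
  change lProj L A * _ = _
  rw [lProj_eq_dSeries_mul_series hc hc1, mul_assoc, ← series_mul,
    column_mul_derivative_rowSeries hc hc1, h1, mul_one]

include hc hc1 in
/-- The generating function is determined by the intertwining property. -/
theorem eq_rowSeries {G : K⟦X⟧} (hG0 : constantCoeff G = 0) (hG1 : coeff 1 G = 1)
    (h : ∀ A : DiffCommAlg K,
      toConv ((A.series G).ofConv ∘ₗ SymCoalg.extend (L A).l) = A.dSeries G) :
    G = rowSeries c := by
  have hA := h (testAlg 0 0 2)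
  rw [series_comp (isCoder_extend L _)] at hA
  have h1 := congrArg (fun g => (testEval (K := K) 1 g).imI) hA
  have h2 : ∀ (q : QuaternionAlgebra K⟦X⟧ 0 0 0) (s : K⟦X⟧),
      (q * (s : QuaternionAlgebra K⟦X⟧ 0 0 0)).imI = q.imI * s := fun q s => by simp
  have h3 : SymCoalg.coderProj (testAlg (K := K) 0 0 2).toUnit
      (SymCoalg.extend (L (testAlg 0 0 2)).l) = koszulSum _ c := hc _
  rw [testEval_mul, testEval_series, h2, h3, testEval_koszulSum_imI 1 c two_ne_zero,
    testEval_dSeries 1 two_ne_zero, rescale_one, hG1] at h1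
  have h4 : column c 1 * derivative K G = 1 := by
    refine mul_left_cancel₀ (X_ne_zero (R := K)) ?_
    rw [mul_one, ← mul_assoc]
    exact h1
  refine derivative.ext ?_ (by rw [hG0, constantCoeff_rowSeries])
  refine mul_left_cancel₀ (column_ne_zero hc1) ?_
  rw [h4, column_mul_derivative_rowSeries hc hc1]

end Relations

end DiffCommAlg

/-! ### Conjugation of `L∞`-structures by automorphisms -/

/-- A linear injection that preserves the degrees also reflects them. -/
theorem mem_of_map_mem {K : Type u} [Field K] {M N : Type*} [AddCommGroup M] [Module K M]
    [AddCommGroup N] [Module K N] {𝒱 : ℤ → Submodule K M} {𝒲 : ℤ → Submodule K N}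
    [DirectSum.Decomposition 𝒱] [DirectSum.Decomposition 𝒲] {f : M →ₗ[K] N}
    (hf : ∀ i, ∀ x ∈ 𝒱 i, f x ∈ 𝒲 i) (hinj : Function.Injective f) {n : ℤ} {x : M}
    (hx : f x ∈ 𝒲 n) : x ∈ 𝒱 n := by
  have hcomm : ∀ y : M, f (DirectSum.decompose 𝒱 y n) = DirectSum.decompose 𝒲 (f y) n := fun y => by
    induction y using DirectSum.Decomposition.inductionOn 𝒱 with
    | zero => simp
    | add y z hy hz => simp [DirectSum.decompose_add, hy, hz]
    | @homogeneous i y =>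
      by_cases h : i = n
      · subst h
        rw [DirectSum.decompose_of_mem_same 𝒱 y.2, DirectSum.decompose_of_mem_same 𝒲 (hf i y y.2)]
      · rw [DirectSum.decompose_of_mem_ne 𝒱 y.2 h, DirectSum.decompose_of_mem_ne 𝒲 (hf i y y.2) h,
          map_zero]
  have : (DirectSum.decompose 𝒱 x n : M) = x := hinj (by
    rw [hcomm, DirectSum.decompose_of_mem_same 𝒲 hx])
  rw [← this]
  exact SetLike.coe_mem _

namespace SymCoalg

open KoszulBraces.SymAlg WithConv

variable {K : Type u} [Field K] {V : Type v} [AddCommGroup V] [Module K V]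
variable {𝒱 : ℤ → Submodule K V} [DirectSum.Decomposition 𝒱]

theorem Aut.hom_coe (ψ : Aut 𝒱) (x : SymCoalg 𝒱) : ψ.hom (x : SymAlg 𝒱) = ψ.toEquiv x := by
  rw [Aut.hom_apply, reduce_coe, counit_coe, zero_smul, add_zero]

theorem Aut.hom_injective (ψ : Aut 𝒱) : Function.Injective ψ.hom := by
  intro x y hxy
  have hc : counit 𝒱 x = counit 𝒱 y := by
    rw [← ψ.isCoalgHom_hom.counit_apply, hxy, ψ.isCoalgHom_hom.counit_apply]
  rw [Aut.hom_apply, Aut.hom_apply, hc, add_left_inj] at hxy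
  have h := congrArg Subtype.val (ψ.toEquiv.injective (Subtype.ext hxy))
  rwa [coe_reduce, coe_reduce, hc, sub_left_inj] at h

theorem Aut.hom_mem_gr (ψ : Aut 𝒱) (n : ℤ) (x : SymAlg 𝒱) (hx : x ∈ gr 𝒱 n) :
    ψ.hom x ∈ gr 𝒱 n := by
  have h1 := ψ.hasDegree n (reduce 𝒱 x) (reduce_mem_gr hx)
  rw [add_zero] at h1
  have h2 : counit 𝒱 x • (1 : SymAlg 𝒱) = x - reduce 𝒱 x := by rw [coe_reduce, sub_sub_cancel]
  rw [Aut.hom_apply, h2]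
  exact add_mem h1 (sub_mem hx (reduce_mem_gr hx))

theorem Aut.hom_twist (ψ : Aut 𝒱) (x : SymAlg 𝒱) :
    ψ.hom (twist (gr 𝒱) 1 x) = twist (gr 𝒱) 1 (ψ.hom x) :=
  LinearMap.congr_fun (f := ψ.hom ∘ₗ twist (gr 𝒱) 1) (g := twist (gr 𝒱) 1 ∘ₗ ψ.hom)
    (linearMap_ext_homogeneous (gr 𝒱) fun i x hx => by
      rw [LinearMap.comp_apply, LinearMap.comp_apply, twist_of_mem _ _ hx,
        twist_of_mem _ _ (ψ.hom_mem_gr i x hx), map_smul]) x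

theorem Aut.hasDegree_symm (ψ : Aut 𝒱) : HasDegree 𝒱 0 ψ.toEquiv.symm.toLinearMap := by
  intro n x hx
  rw [add_zero]
  refine mem_of_map_mem (f := ψ.hom) (𝒲 := gr 𝒱) ψ.hom_mem_gr ψ.hom_injective ?_
  rw [Aut.hom_coe, LinearEquiv.coe_coe, LinearEquiv.apply_symm_apply]
  exact hx

theorem Aut.sign_comp (ψ : Aut 𝒱) :
    ψ.toEquiv.toLinearMap ∘ₗ sign 𝒱 = sign 𝒱 ∘ₗ ψ.toEquiv.toLinearMap :=
  LinearMap.ext fun x => Subtype.ext <| by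
    change (ψ.toEquiv (sign 𝒱 x) : SymAlg 𝒱) = sign 𝒱 (ψ.toEquiv x)
    rw [sign_apply, ← ψ.hom_coe, ← ψ.hom_coe, ← ψ.hom_twist, sign_apply]

end SymCoalg

namespace LInfinity

variable {K : Type u} [Field K] {V : Type v} [AddCommGroup V] [Module K V]
variable {𝒱 : ℤ → Submodule K V} [DirectSum.Decomposition 𝒱]

/-- The `L∞`-algebra whose twisting by `φ` is `L`. -/
def conj (L : LInfinity 𝒱) (φ : SymCoalg.Aut 𝒱) : LInfinity 𝒱 where
  l := φ.toEquiv.toLinearMap ∘ₗ L.l ∘ₗ φ.toEquiv.symm.toLinearMap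
  isCoderivation := by
    refine ⟨fun n x hx => ?_, ?_⟩
    · have h := φ.hasDegree _ _ (L.isCoderivation.hasDegree _ _ (φ.hasDegree_symm n x hx))
      rwa [add_zero, add_zero] at h
    · set e := φ.toEquiv.toLinearMap
      set e' := φ.toEquiv.symm.toLinearMap
      have he : e ∘ₗ e' = LinearMap.id := LinearMap.ext fun x => φ.toEquiv.apply_symm_apply x
      have hsymm : SymCoalg.diag 𝒱 ∘ₗ e' = TensorProduct.map e' e' ∘ₗ SymCoalg.diag 𝒱 := by
        have he' : e' ∘ₗ e = LinearMap.id := LinearMap.ext fun x => φ.toEquiv.symm_apply_apply x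
        calc SymCoalg.diag 𝒱 ∘ₗ e' = TensorProduct.map e' e' ∘ₗ (TensorProduct.map e e ∘ₗ
              SymCoalg.diag 𝒱) ∘ₗ e' := by
              rw [← LinearMap.comp_assoc, ← LinearMap.comp_assoc, ← TensorProduct.map_comp, he',
                TensorProduct.map_id, LinearMap.id_comp]
          _ = TensorProduct.map e' e' ∘ₗ SymCoalg.diag 𝒱 := by
              rw [← φ.diag_comp, LinearMap.comp_assoc, he, LinearMap.comp_id]
      have hs : e ∘ₗ SymCoalg.sign 𝒱 ∘ₗ e' = SymCoalg.sign 𝒱 := by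
        rw [← LinearMap.comp_assoc, φ.sign_comp, LinearMap.comp_assoc, he, LinearMap.comp_id]
      rw [← LinearMap.comp_assoc, φ.diag_comp, LinearMap.comp_assoc, ← LinearMap.comp_assoc _ L.l,
        L.isCoderivation.diag_comp, LinearMap.comp_assoc, hsymm, ← LinearMap.comp_assoc,
        ← LinearMap.comp_assoc]
      congr 1
      rw [LinearMap.comp_add, LinearMap.add_comp, ← TensorProduct.map_comp, ← TensorProduct.map_comp,
        ← TensorProduct.map_comp, ← TensorProduct.map_comp, LinearMap.comp_id, he,
        LinearMap.comp_assoc, LinearMap.comp_assoc, show φ.toEquiv.toLinearMap = e from rfl, hs]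
  sq_zero := by
    refine LinearMap.ext fun x => ?_
    simp only [LinearMap.comp_apply, LinearEquiv.coe_coe, LinearEquiv.symm_apply_apply,
      LinearMap.zero_apply]
    have := LinearMap.congr_fun L.sq_zero (φ.toEquiv.symm x)
    rw [LinearMap.comp_apply] at this
    rw [this]
    simp

theorem isTwisting_conj (L : LInfinity 𝒱) (φ : SymCoalg.Aut 𝒱) : L.IsTwisting (L.conj φ) φ :=
  LinearMap.ext fun x => by simp [conj]

open KoszulBraces.SymAlg in
/-- The trivial `L∞`-structures are those whose projection to the generators is `Δ` composed with
the projection. -/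
theorem isTrivial_iff (E : LInfinity 𝒱) (Δ : V →ₗ[K] V) :
    E.IsTrivial Δ ↔ ∀ x, proj 𝒱 (E.l x : SymAlg 𝒱) = Δ (proj 𝒱 (x : SymAlg 𝒱)) := by
  have hop : ∀ (k : ℕ) (a : Fin k → V), E.op k a =
      proj 𝒱 (E.l (SymCoalg.reduce 𝒱 (mono 𝒱 (List.ofFn a)))) := fun k a => by
    rw [op, SymCoalg.component_apply, SymCoalg.extend_apply]
  have hproj : ∀ x : SymAlg 𝒱, proj 𝒱 (SymCoalg.reduce 𝒱 x : SymAlg 𝒱) = proj 𝒱 x := fun x => by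
    rw [SymCoalg.coe_reduce, map_sub, map_smul, proj_one, smul_zero, sub_zero]
  have hι : ∀ a : V, mono 𝒱 [a] = ι 𝒱 a := fun a => by rw [mono_cons, mono_nil, mul_one]
  have hmono : ∀ (a b : V) (l : List V), proj 𝒱 (mono 𝒱 (a :: b :: l)) = 0 := fun a b l => by
    rw [mono_cons, proj_ι_mul, mono_cons, counit_ι_mul, zero_smul]
  refine ⟨fun h x => ?_, fun h => ⟨fun v => ?_, fun k hk => MultilinearMap.ext fun a => ?_⟩⟩
  · have := LinearMap.congr_fun (f := proj 𝒱 ∘ₗ SymCoalg.extend E.l)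
      (g := Δ ∘ₗ proj 𝒱) (linearMap_ext_mono fun l => ?_) (x : SymAlg 𝒱)
    · rwa [LinearMap.comp_apply, SymCoalg.extend_apply, SymCoalg.reduce_coe] at this
    · have h1 := hop l.length l.get
      rw [List.ofFn_get] at h1
      rw [LinearMap.comp_apply, SymCoalg.extend_apply, ← h1, LinearMap.comp_apply]
      match l with
      | [] =>
        rw [mono_nil, proj_one, map_zero, hop]
        simp
      | [a] =>
        rw [hι, proj_ι, ← h.1]
        congr 1
        ext i
        fin_cases i
        rfl
      | a :: b :: l => rw [hmono, map_zero, h.2 _ (by simp), zero_apply]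
  · rw [hop, h, hproj]
    refine congrArg Δ ((congrArg (proj 𝒱) (hι v)).trans (proj_ι _))
  · obtain ⟨k, rfl⟩ := Nat.exists_eq_add_of_le' hk
    rw [hop, h, hproj, List.ofFn_succ, List.ofFn_succ, hmono, map_zero, zero_apply]

end LInfinity

namespace DiffCommAlg

open KoszulBraces.SymAlg WithConv PowerSeries

/-! ### The automorphism given by a generating function -/

section SeriesAut

variable {K : Type u} [Field K]

/-- The part with values in `A` of the substitution of the projection `S(A) → A` in `f`. -/
def seriesSnd (f : K⟦X⟧) (A : DiffCommAlg K) : SymAlg A.gr →ₗ[K] A :=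
  Unitization.sndHom K K A ∘ₗ (A.series f).ofConv

variable [CharZero K] (f : K⟦X⟧)

theorem seriesSnd_mono (A : DiffCommAlg K) (l : List A) : seriesSnd f A (mono A.gr l) =
    ((l.length.factorial : K) * coeff l.length f) • (l.map A.toUnit).prod.snd :=
  congrArg (Unitization.sndHom K K A) (series_mono A f l)

theorem seriesSnd_one (A : DiffCommAlg K) : seriesSnd f A 1 = 0 := by
  rw [← mono_nil (𝒱 := A.gr), seriesSnd_mono, List.map_nil, List.prod_nil, Unitization.snd_one, smul_zero]

theorem seriesSnd_ι (hf : coeff 1 f = 1) (A : DiffCommAlg K) (a : A) :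
    seriesSnd f A (ι A.gr a) = a := by
  have h : ι A.gr a = mono A.gr [a] := by rw [mono_cons, mono_nil, mul_one]
  rw [h, seriesSnd_mono]
  simp [hf]

theorem seriesSnd_mem (A : DiffCommAlg K) (n : ℤ) (x : SymAlg A.gr) (hx : x ∈ SymAlg.gr A.gr n) :
    seriesSnd f A x ∈ A.gr n := by
  induction hx using Submodule.span_induction with
  | zero => simp
  | add x y _ _ hx hy => rw [map_add]; exact add_mem hx hy
  | smul c x _ hx => rw [map_smul]; exact Submodule.smul_mem _ _ hx
  | mem x hx =>
    obtain ⟨l, hl, rfl, rfl⟩ := hx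
    have : (l.map fun p => ι A.gr p.2).prod = mono A.gr (l.map Prod.snd) := by
      simp [mono, Function.comp_def]
    rw [this, seriesSnd_mono, List.map_map]
    exact Submodule.smul_mem _ _ (A.snd_prod_map_toUnit l hl)

theorem toUnit_seriesSnd (hf : constantCoeff f = 0) (A : DiffCommAlg K) (x : SymAlg A.gr) :
    A.toUnit (seriesSnd f A x) = (A.series f).ofConv x := by
  refine LinearMap.congr_fun (f := A.toUnit ∘ₗ seriesSnd f A) (g := (A.series f).ofConv)
    (linearMap_ext_mono fun l => ?_) x
  rw [LinearMap.comp_apply, seriesSnd_mono, series_mono]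
  cases l with
  | nil => simp [hf]
  | cons a l =>
    rw [map_smul, toUnit_snd]
    rw [List.map_cons, List.prod_cons, toUnit_mul_eq_inr]
    rfl

/-- The automorphism of `S^c A` whose components are multiples of the products, with exponential
generating function `f`. -/
def seriesAut (hf : coeff 1 f = 1) (A : DiffCommAlg K) : SymCoalg.Aut A.gr :=
  SymCoalg.expAut (seriesSnd f A) (seriesSnd_one f A) (seriesSnd_ι f hf A) (seriesSnd_mem f A)

theorem component_seriesAut (hf : coeff 1 f = 1) (A : DiffCommAlg K) (k : ℕ) (a : Fin k → A) :
    SymCoalg.component A.gr (seriesAut f hf A).toEquiv.toLinearMap k a =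
      seriesSnd f A (mono A.gr (List.ofFn a)) :=
  SymCoalg.component_expAut _ _ _ _ k a

omit [CharZero K] in
theorem mono_ofFn_swap (A : DiffCommAlg K) {k : ℕ} (n : Fin k → ℤ) (a : Fin k → A)
    (ha : ∀ i, a i ∈ A.gr (n i)) (i j : Fin k) (hij : (j : ℕ) = i + 1) :
    mono A.gr (List.ofFn (a ∘ Equiv.swap i j)) =
      ksign K (n i * n j) • mono A.gr (List.ofFn a) := by
  induction k with
  | zero => exact i.elim0
  | succ k ih =>
    refine Fin.cases (motive := fun i => (j : ℕ) = i + 1 →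
      mono A.gr (List.ofFn (a ∘ Equiv.swap i j)) =
        ksign K (n i * n j) • mono A.gr (List.ofFn a)) (fun hij => ?_) (fun i hij => ?_) i hij
    · cases k with
      | zero => have := j.2; simp at hij
      | succ k =>
        obtain rfl : j = 1 := Fin.ext (by simpa using hij)
        have htail : (fun i : Fin k => (a ∘ Equiv.swap 0 1) i.succ.succ) =
            fun i => a i.succ.succ := funext fun i => by
          rw [Function.comp_apply, Equiv.swap_apply_of_ne_of_ne (Fin.succ_ne_zero _)]
          intro h
          exact Fin.succ_ne_zero i (Fin.succ_injective _ h)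
        have h1 : (Fin.succ 0 : Fin (k + 2)) = 1 := rfl
        rw [List.ofFn_succ, List.ofFn_succ, List.ofFn_succ (f := a), List.ofFn_succ, htail,
          mono_cons, mono_cons, mono_cons, mono_cons, h1, Function.comp_apply, Function.comp_apply,
          Equiv.swap_apply_left, Equiv.swap_apply_right, ← mul_assoc, ← mul_assoc,
          ι_swap A.gr (ha 1) (ha 0), smul_mul_assoc, _root_.mul_comm (n 0)]
    · obtain ⟨j, rfl⟩ := Fin.exists_succ_eq.2 (show j ≠ 0 by
        rintro rfl
        simp at hij)
      have htail : (fun l : Fin k => (a ∘ Equiv.swap i.succ j.succ) l.succ) =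
          (fun l => a l.succ) ∘ Equiv.swap i j := funext fun l => by
        rw [Function.comp_apply, Function.comp_apply]
        congr 1
        rw [Equiv.swap_apply_def, Equiv.swap_apply_def]
        simp only [Fin.succ_inj]
        split_ifs <;> rfl
      have h0 : (a ∘ Equiv.swap i.succ j.succ) 0 = a 0 := by
        rw [Function.comp_apply, Equiv.swap_apply_of_ne_of_ne (Fin.succ_ne_zero _).symm
          (Fin.succ_ne_zero _).symm]
      rw [List.ofFn_succ, List.ofFn_succ (f := a), htail, h0, mono_cons, mono_cons,
        ih (fun l => n l.succ) (fun l => a l.succ) (fun l => ha l.succ) i j (by simpa using hij),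
        mul_smul_comm]

theorem isNaturalAut_seriesAut (hf : coeff 1 f = 1) :
    IsNaturalAut fun A => seriesAut f hf A := by
  intro k hk
  refine ⟨fun A n a ha => ?_, fun A n a ha i j hij => ?_, fun A B φ hφ a => ?_,
    fun A n c hc a i hi => ?_⟩
  · rw [component_seriesAut, add_zero]
    refine seriesSnd_mem f A _ _ (Submodule.subset_span
      ⟨List.ofFn fun i => (n i, a i), fun p hp => ?_, ?_, ?_⟩)
    · obtain ⟨i, rfl⟩ := List.mem_ofFn.1 hp
      exact ha i
    · rw [List.map_ofFn, List.sum_ofFn]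
      rfl
    · rw [mono, List.map_ofFn, List.map_ofFn]
      rfl
  · rw [component_seriesAut, component_seriesAut, mono_ofFn_swap A n a ha i j hij, map_smul]
  · rw [component_seriesAut, component_seriesAut, seriesSnd_mono, seriesSnd_mono, map_smul,
      List.length_ofFn, List.length_ofFn, ← snd_unitMap hφ, map_list_prod, List.map_map,
      List.map_ofFn, List.map_ofFn]
    congr 4
    exact congrArg List.ofFn (funext fun i => unitMap_inr hφ (a i))
  · obtain ⟨k, rfl⟩ := Nat.exists_eq_add_of_le' hk
    obtain rfl : i = 0 := Fin.ext hi
    rw [component_seriesAut, component_seriesAut, seriesSnd_mono, seriesSnd_mono, zero_mul,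
      ksign_zero, one_smul, mul_smul_comm, List.length_ofFn, List.length_ofFn, List.ofFn_succ,
      List.ofFn_succ (f := a), List.map_cons, List.prod_cons, List.map_cons, List.prod_cons,
      Function.update_self]
    have h : (fun l : Fin k => Function.update a 0 (c * a 0) l.succ) = fun l => a l.succ :=
      funext fun l => Function.update_of_ne (Fin.succ_ne_zero l) _ _
    have hmul : A.toUnit (c * a 0) = A.toUnit c * A.toUnit (a 0) := Unitization.inr_mul K c (a 0)
    rw [h, hmul, mul_assoc, snd_toUnit_mul]
    rw [toUnit_mul_eq_inr]
    rfl

end SeriesAut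

end DiffCommAlg

namespace DiffCommAlg

open KoszulBraces.SymAlg WithConv PowerSeries

/-! ### Natural `L∞`-algebras are twistings of the trivial one -/

section Twisting

variable {K : Type u} [Field K] [CharZero K] {L : (A : DiffCommAlg K) → LInfinity A.gr}

/-- A generating function that intertwines the `L∞`-structure with the differential gives a
twisting. -/
theorem isNaturalTwisting_seriesAut {f : K⟦X⟧} (hf1 : coeff 1 f = 1)
    (h : ∀ A : DiffCommAlg K,
      toConv ((A.series f).ofConv ∘ₗ SymCoalg.extend (L A).l) = A.dSeries f) :
    IsNaturalTwisting L fun A => seriesAut f hf1 A := by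
  refine ⟨isNaturalAut_seriesAut f hf1, fun A a => ?_, fun A =>
    ⟨(L A).conj (seriesAut f hf1 A), ?_, (L A).isTwisting_conj _⟩⟩
  · rw [component_seriesAut]
    have : mono A.gr (List.ofFn ![a]) = ι A.gr a := by
      change mono A.gr [a] = ι A.gr a
      rw [mono_cons, mono_nil, mul_one]
    rw [this, seriesSnd_ι f hf1]
  · rw [LInfinity.isTrivial_iff]
    intro y
    obtain ⟨x, rfl⟩ := (seriesAut f hf1 A).toEquiv.surjective y
    have hproj : ∀ x, proj A.gr ((seriesAut f hf1 A).toEquiv x : SymAlg A.gr) =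
        seriesSnd f A x := fun x => SymCoalg.proj_expAut _ _ _ _ x
    have hl := congrArg (Unitization.sndHom K K A)
      (LinearMap.congr_fun (congrArg ofConv (h A)) (x : SymAlg A.gr))
    change proj A.gr ((seriesAut f hf1 A).toEquiv ((L A).l ((seriesAut f hf1 A).toEquiv.symm
      ((seriesAut f hf1 A).toEquiv x))) : SymAlg A.gr) = _
    rw [LinearEquiv.symm_apply_apply, hproj, hproj]
    refine Eq.trans ?_ hl
    rw [ofConv_toConv, LinearMap.comp_apply, SymCoalg.extend_apply, SymCoalg.reduce_coe]
    rfl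

/-- The projection of a natural automorphism with linear part the identity is `f(π)` for some `f`. -/
theorem exists_component_eq {ψ : (A : DiffCommAlg K) → SymCoalg.Aut A.gr}
    (hψ : IsNaturalTwisting L ψ) : ∃ f : K⟦X⟧, constantCoeff f = 0 ∧ coeff 1 f = 1 ∧
      ∀ A, proj A.gr ∘ₗ SymCoalg.extend (ψ A).toEquiv.toLinearMap = seriesSnd f A := by
  choose s hs using fun k : ℕ => exists_eq_smul_prodMap
    (Γ := fun A => proj A.gr ∘ₗ SymCoalg.extend (ψ A).toEquiv.toLinearMap)
    (hψ.natural (k + 1) (by omega)) fun A a => SymCoalg.component_apply _ _ _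
  set f : K⟦X⟧ := PowerSeries.mk fun n => if n = 0 then 0 else (n.factorial : K)⁻¹ * s (n - 1)
    with hf
  have hψf : ∀ A, proj A.gr ∘ₗ SymCoalg.extend (ψ A).toEquiv.toLinearMap = seriesSnd f A :=
    fun A => linearMap_ext_mono fun l => by
      match l with
      | [] =>
        rw [mono_nil, seriesSnd_one, LinearMap.comp_apply, SymCoalg.extend_apply,
          SymCoalg.reduce_one]
        simp
      | a :: l =>
        have h := congrArg (Unitization.sndHom K K A) (hs l.length A (a :: l) rfl)
        rw [prodMap_mono, if_pos (by simp), map_smul] at h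
        rw [seriesSnd_mono, hf, coeff_mk, if_neg (by simp),
          mul_inv_cancel_left₀ (Nat.cast_ne_zero.2 (Nat.factorial_ne_zero _))]
        exact h
  have h0 : constantCoeff f = 0 := by
    rw [← coeff_zero_eq_constantCoeff_apply, hf, coeff_mk, if_pos rfl]
  refine ⟨f, h0, ?_, hψf⟩
  set A := testAlg (K := K) 0 0 2
  set a : A := scalar _ _ _ _ Polynomial.X
  have h1 := hψ.linear_part A a
  have h2 := LinearMap.congr_fun (hψf A) (mono A.gr (List.ofFn ![a]))
  rw [LinearMap.comp_apply, ← SymCoalg.component_apply, h1, seriesSnd_mono] at h2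
  have h3 : a = coeff 1 f • a := by simpa using h2
  have h4 := congrArg QuaternionAlgebra.re h3
  have h5 := congrArg (fun p : Polynomial K => p.coeff 1) (show (Polynomial.X : Polynomial K) =
    coeff 1 f • Polynomial.X from h4)
  simpa using h5.symm

/-- The generating function of a natural twisting intertwines the `L∞`-structure with the
differential. -/
theorem series_comp_of_isNaturalTwisting {ψ : (A : DiffCommAlg K) → SymCoalg.Aut A.gr}
    (hψ : IsNaturalTwisting L ψ) {f : K⟦X⟧} (hf : constantCoeff f = 0)
    (hψf : ∀ A, proj A.gr ∘ₗ SymCoalg.extend (ψ A).toEquiv.toLinearMap = seriesSnd f A)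
    (A : DiffCommAlg K) :
    toConv ((A.series f).ofConv ∘ₗ SymCoalg.extend (L A).l) = A.dSeries f := by
  obtain ⟨E, hE, hL⟩ := hψ.twisting A
  rw [LInfinity.isTrivial_iff] at hE
  refine congrArg toConv (LinearMap.ext fun x => ?_)
  rw [LinearMap.comp_apply, LinearMap.comp_apply, ← toUnit_seriesSnd f hf, ← toUnit_seriesSnd f hf,
    ← hψf, LinearMap.comp_apply, LinearMap.comp_apply, SymCoalg.extend_apply, SymCoalg.extend_apply,
    SymCoalg.extend_apply, SymCoalg.reduce_coe]
  have h1 : (ψ A).toEquiv ((L A).l (SymCoalg.reduce A.gr x)) =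
      E.l ((ψ A).toEquiv (SymCoalg.reduce A.gr x)) := by
    rw [hL]
    simp
  rw [LinearEquiv.coe_coe, h1, hE]
  rfl

/-- The operation `l₂`. -/
theorem op_two {c : ℕ × ℕ → K} (hc : ∀ A, lProj L A = A.koszulSum c) (hc1 : c (0, 1) = 1)
    (A : DiffCommAlg K) {i : ℤ} {a : A} (ha : a ∈ A.gr i) (b : A) :
    (L A).op 2 ![a, b] =
      c (0, 2) • (A.Δ (a * b) - ksign K i • (a * A.Δ b) - A.Δ a * b) := by
  have hc2 : c (1, 1) = - c (0, 2) := by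
    have h := congrArg (coeff 1) (column_mul_derivative_rowSeries hc hc1)
    rw [coeff_mul, Finset.Nat.sum_antidiagonal_succ, Finset.Nat.antidiagonal_zero,
      Finset.sum_singleton] at h
    simp [column, rowSeries, coeff_derivative, coeff_one, hc1, Nat.factorial] at h
    have h2 : (2 : K) ≠ 0 := two_ne_zero
    field_simp at h
    refine mul_left_cancel₀ h2 ?_
    linear_combination h
  have h11 : (A.koszulOp 1 1).ofConv (mono A.gr [a, b]) =
      A.toUnit (A.Δ a * b + ksign K i • (a * A.Δ b)) := by
    induction b using DirectSum.Decomposition.inductionOn A.gr with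
    | zero => simp [mono_cons]
    | add b b' hb hb' =>
      have : mono A.gr [a, b + b'] = mono A.gr [a, b] + mono A.gr [a, b'] := by
        simp only [mono_cons, map_add, add_mul, mul_add]
      rw [this, map_add, hb, hb', ← map_add, map_add A.Δ, mul_add, mul_add, smul_add]
      congr 1
      abel
    | @homogeneous j b =>
      have hp1 : (A.prodMap 1).ofConv 1 = 0 := by
        rw [← mono_nil (𝒱 := A.gr), prodMap_mono, if_neg (by simp)]
      have hpι : ∀ a, (A.prodMap 1).ofConv (ι A.gr a) = A.toUnit a := fun a => by
        have : ι A.gr a = mono A.gr [a] := by rw [mono_cons, mono_nil, mul_one]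
        rw [this, prodMap_mono, if_pos (by simp)]
        simp
      have hp2 : ∀ a b, (A.prodMap 1).ofConv (ι A.gr a * ι A.gr b) = 0 := fun a b => by
        have : ι A.gr a * ι A.gr b = mono A.gr [a, b] := by rw [mono_cons, mono_cons, mono_nil, mul_one]
        rw [this, prodMap_mono, if_neg (by simp)]
      have hx : mono A.gr [a, (b : A)] = ι A.gr a * (ι A.gr (b : A) * 1) := rfl
      have hsign : ksign K (i * j) * ksign K ((j + 1) * i) = ksign K i := by
        rw [← ksign_add]
        exact ksign_congr ⟨i * j, by ring⟩
      have hmul : ∀ a b : A, A.toUnit a * A.toUnit b = A.toUnit (a * b) := fun a b =>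
        (Unitization.inr_mul K a b).symm
      have hΔ : ∀ a : A, A.ΔUnit (A.toUnit a) = A.toUnit (A.Δ a) := fun a => rfl
      have hone : ∀ n : ℤ, twist (SymAlg.gr A.gr) n (1 : SymAlg A.gr) = 1 := fun n => by
        rw [twist_of_mem _ n (SetLike.GradedOne.one_mem (A := SymAlg.gr A.gr)), mul_zero,
          ksign_zero, one_smul]
      rw [koszulOp, hx, conv_apply_ι_mul _ _ ha, conv_apply_ι_mul _ _ b.2,
        conv_apply_ι_mul _ _ b.2]
      simp only [conv_apply_one, LinearMap.comp_apply, LinearMap.mulLeft_apply, mul_one, hone, hp1,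
        hp2, hpι, map_zero, mul_zero, add_zero, zero_add,
        twist_of_mem _ _ (ι_mem_gr A.gr b.2), map_smul, hΔ, hmul, smul_mul_assoc]
      rw [A.mul_comm (A.Δ_mem b.2) ha, map_smul, smul_smul, hsign, map_add, map_smul]
  have h02 : (A.koszulOp 0 2).ofConv (mono A.gr [a, b]) = A.toUnit (A.Δ (a * b)) := by
    have hp0 : A.prodMap 0 = 1 := by rw [prodMap, dpow, pow_zero]; simp
    rw [koszulOp, hp0, mul_one, ofConv_toConv, LinearMap.comp_apply, prodMap_mono, if_pos (by simp)]
    have : ([a, b].map A.toUnit).prod = A.toUnit (a * b) := by simp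
    rw [this]
    rfl
  have h := lProj_mono L A ![a, b]
  have hl : List.ofFn ![a, b] = [a, b] := rfl
  have hlen : [a, b].length = 2 := rfl
  rw [hc, koszulSum_mono, hl, hlen, Finset.Nat.sum_antidiagonal_succ,
    Finset.Nat.sum_antidiagonal_succ, Finset.Nat.antidiagonal_zero, Finset.sum_singleton] at h
  simp only [zero_add, Nat.reduceAdd] at h
  rw [koszulOp_zero, h02, h11, hc2, ofConv_zero, LinearMap.zero_apply, smul_zero, add_zero] at h
  refine (congrArg (Unitization.sndHom K K A) h).symm.trans ?_
  rw [map_add, map_smul, map_smul]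
  change c (0, 2) • A.Δ (a * b) + -c (0, 2) • (A.Δ a * b + ksign K i • (a * A.Δ b)) = _
  module

/-- The element `x` of `K[x]⟨e, f⟩`, in the case where `Δ(x^n) = 0` for `n ≠ 1`. -/
def testX (K : Type u) [Field K] : testAlg (K := K) 0 0 2 := scalar _ _ _ _ Polynomial.X

omit [CharZero K] in
theorem testX_mem : testX K ∈ (testAlg (K := K) 0 0 2).gr 0 := scalar_mem _ _ _ _ _

omit [CharZero K] in
theorem testX_mul_self_ne_zero : testX K * testX K ≠ 0 := fun h => by
  have h1 : ((Polynomial.X : Polynomial K) : QuaternionAlgebra (Polynomial K) 0 0 0) *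
      (Polynomial.X : Polynomial K) = 0 := h
  rw [← QuaternionAlgebra.coe_mul] at h1
  have h2 : (Polynomial.X : Polynomial K) * Polynomial.X = 0 := congrArg QuaternionAlgebra.re h1
  exact mul_ne_zero Polynomial.X_ne_zero Polynomial.X_ne_zero h2

/-- The deviation of `Δ` from being a derivation takes the value `-2 x e` at `x, x`. -/
theorem testX_bracket_ne_zero :
    (testAlg (K := K) 0 0 2).Δ (testX K * testX K) -
      ksign K 0 • (testX K * (testAlg (K := K) 0 0 2).Δ (testX K)) -
      (testAlg (K := K) 0 0 2).Δ (testX K) * testX K ≠ 0 := fun h => by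
  rw [ksign_zero, one_smul] at h
  set q : QuaternionAlgebra (Polynomial K) 0 0 0 :=
    ((Polynomial.X : Polynomial K) : QuaternionAlgebra (Polynomial K) 0 0 0) with hq
  have h1 : ∀ p : QuaternionAlgebra (Polynomial K) 0 0 0, (testAlg (K := K) 0 0 2).Δ p =
      (⟨0, coeffMap 1 1 p.re, coeffMap 0 2 p.re, remMap 0 p.imI⟩ :
        QuaternionAlgebra (Polynomial K) 0 0 0) := fun p => rfl
  have h2 : (⟨0, coeffMap 1 1 (q * q).re, coeffMap 0 2 (q * q).re, remMap 0 (q * q).imI⟩ :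
      QuaternionAlgebra (Polynomial K) 0 0 0) -
      q * ⟨0, coeffMap 1 1 q.re, coeffMap 0 2 q.re, remMap 0 q.imI⟩ -
      ⟨0, coeffMap 1 1 q.re, coeffMap 0 2 q.re, remMap 0 q.imI⟩ * q = 0 := h
  have h3 := congrArg (fun p : QuaternionAlgebra (Polynomial K) 0 0 0 => p.imI.coeff 1) h2
  simp [hq, coeffMap, ← pow_two] at h3
  norm_num at h3

end Twisting

end DiffCommAlg

end KoszulBraces

end

theorem mainTheorem2 {K : Type u} [Field K] [CharZero K]
    (L : (A : DiffCommAlg K) → LInfinity A.gr) (hL : IsNaturalLInfinity L)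
    (hΔ : ∀ (A : DiffCommAlg K) (a : A), (L A).op 1 ![a] = A.Δ a) :
    ∃ φ : (A : DiffCommAlg K) → SymCoalg.Aut A.gr,
      IsNaturalTwisting L φ ∧
      (∀ ψ : (A : DiffCommAlg K) → SymCoalg.Aut A.gr, IsNaturalTwisting L ψ → ψ = φ) ∧
      ((∀ (A : DiffCommAlg K) (i : ℤ) (a b : A), a ∈ A.gr i →
          (L A).op 2 ![a, b] = A.Δ (a * b) - ksign K i • (a * A.Δ b) - A.Δ a * b) ↔
        ∀ (A : DiffCommAlg K) (a b : A),
          SymCoalg.component A.gr (φ A).toEquiv.toLinearMap 2 ![a, b] = a * b) := by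
  obtain ⟨c, hc⟩ := DiffCommAlg.exists_lProj_eq_koszulSum L hL
  have hc1 := DiffCommAlg.coeff_zero_one hc hΔ
  have hG1 := DiffCommAlg.coeff_one_rowSeries hc1
  refine ⟨fun A => DiffCommAlg.seriesAut (DiffCommAlg.rowSeries c) hG1 A,
    DiffCommAlg.isNaturalTwisting_seriesAut hG1 (DiffCommAlg.series_rowSeries_comp hc hc1),
    fun ψ hψ => ?_, ?_⟩
  · obtain ⟨f, hf0, hf1, hψf⟩ := DiffCommAlg.exists_component_eq hψ
    have hf := DiffCommAlg.eq_rowSeries hc hc1 hf0 hf1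
      (DiffCommAlg.series_comp_of_isNaturalTwisting hψ hf0 hψf)
    refine funext fun A => SymCoalg.Aut.ext_component fun k _ => MultilinearMap.ext fun a => ?_
    rw [DiffCommAlg.component_seriesAut, ← hf, ← hψf, SymCoalg.component_apply]
    rfl
  · have hφ : ∀ (A : DiffCommAlg K) (a b : A), SymCoalg.component A.gr
        (DiffCommAlg.seriesAut (DiffCommAlg.rowSeries c) hG1 A).toEquiv.toLinearMap 2 ![a, b] =
          c (0, 2) • (a * b) := fun A a b => by
      have hl : List.ofFn ![a, b] = [a, b] := rfl
      rw [DiffCommAlg.component_seriesAut, hl, DiffCommAlg.seriesSnd_mono]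
      simp [DiffCommAlg.rowSeries, Nat.factorial]
    simp only [hφ]
    -- Both conditions say that the coefficient `c (0, 2)` is `1`.
    refine ⟨fun h => ?_, fun h A i a b ha => ?_⟩
    · have hx := h _ 0 _ (DiffCommAlg.testX K) DiffCommAlg.testX_mem
      rw [DiffCommAlg.op_two hc hc1 _ DiffCommAlg.testX_mem] at hx
      have hc2 : c (0, 2) = 1 := smul_left_injective K DiffCommAlg.testX_bracket_ne_zero
        (hx.trans (one_smul K _).symm)
      intro A a b
      rw [hc2, one_smul]
    · have hc2 : c (0, 2) = 1 := smul_left_injective K DiffCommAlg.testX_mul_self_ne_zero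
        ((h _ (DiffCommAlg.testX K) _).trans (one_smul K _).symm)
      rw [DiffCommAlg.op_two hc hc1 A ha, hc2, one_smul]
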